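/- Let $c\in\mathbb R$, put $\epsilon=-1$ if $c<0$ and $\epsilon=1$ if $c\ge 0$, and equip $\mathbb R^3$ with the scalar product $\langle u,v\rangle=u_1v_1+u_2v_2+\epsilon u_3v_3$, writing $|u|=\sqrt{\langle u,u\rangle}$ when $\langle u,u\rangle\ge 0$. Let $X^2_c$ be the oriented space form of curvature $c$: the sphere $\{\langle u,u\rangle=1/c\}$ (oriented by its outward normal) if $c>0$, the plane $\{u_3=0\}$ if $c=0$, and the sheet $\{\langle u,u\rangle=1/c,\ u_3>0\}$ of the hyperboloid if $c<0$ (the latter two oriented upward); let $dS$ be its area element. Let $\operatorname{sn}_c r$ be $\sin(\sqrt c\,r)/\sqrt c$, $r$, $\sinh(\sqrt{-c}\,r)/\sqrt{-c}$, and $\operatorname{cn}_c r$ be $\cos(\sqrt c\,r)$, $1$, $\cosh(\sqrt{-c}\,r)$, for $c>0$, $c=0$, $c<0$ respectively. Let $\gamma:\mathbb R\to X^2_c$ be a smooth simple closed curve of length $L>0$ (that is, $L$-periodic and injective on $[0,L)$), parametrized by arclength $s$. Let $k_g=|\gamma''+c\gamma|$ be its geodesic curvature and $k=|\gamma''|=\sqrt{k_g^2+c}$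 its curvature in the ambient space $\mathbb R^3$. Assume that $\gamma$ is strongly convex: $k_g(s)>0$ for all $s$ if $c\ge 0$, and $k_g(s)>\sqrt{|c|}$ for all $s$ if $c<0$. Let $n=(\gamma''+c\gamma)/k_g$ be its normal vector, $\rho(s)>0$ its radius of curvature, defined by $k_g=\operatorname{cn}_c\rho/\operatorname{sn}_c\rho$ (with $\sqrt c\,\rho<\pi/2$ if $c>0$), and $$\gamma_e(s)=\operatorname{cn}_c\rho(s)\,\gamma(s)+\operatorname{sn}_c\rho(s)\,n(s)$$ its evolute. For a closed curve $\alpha:[0,L]\to X^2_c$ and a point $P\in X^2_c$ not on $\alpha$, let $\operatorname{Ind}(\alpha,P)\in\mathbb Z$ be the winding number of $\alpha$ about $P$ in the oriented chart given by the exponential map at $P$ (geodesic polar coordinates about $P$). If $c>0$, this is the definition when $\alpha$ and $P$ lie in a common open hemisphere, and otherwise $\operatorname{Ind}(\alpha,P)=0$. Assume that $\gamma$ is positively oriented: $\operatorname{Ind}(\gamma,P)=1$ for every $P$ in the interior of $\gamma$, the interior being formed by the components of $X^2_c\setminus\gamma$ that are bounded (if $c\le 0$), or that lie in an open hemisphere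 (if $c>0$). Then $P\mapsto\operatorname{Ind}(\gamma_e,P)$ is integrable on $X^2_c$, and the area with multiplicities enclosed by the evolute, $F_e=\int_{X^2_c}\operatorname{Ind}(\gamma_e,P)\,dS$, satisfies $$\int_0^L k(s)\,ds-2\pi=c\,|F_e|.$$ -/

import Mathlib

namespace SpaceForm

/-- The sign `ε` in the ambient metric `diag(1, 1, ε)` of `ℝ³`: Lorentzian for `c < 0`,
Euclidean otherwise. -/
noncomputable def sgn (c : ℝ) : ℝ := if c < 0 then -1 else 1

/-- The ambient scalar product `⟨u, v⟩` on `ℝ³`. -/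
noncomputable def ip (c : ℝ) (u v : Fin 3 → ℝ) : ℝ :=
  u 0 * v 0 + u 1 * v 1 + sgn c * (u 2 * v 2)

/-- The space form `X²_c`: the plane `u₃ = 0` for `c = 0`, the sphere `⟨u, u⟩ = 1 / c` for `c > 0`,
the upper sheet of the hyperboloid `⟨u, u⟩ = 1 / c` for `c < 0`. -/
def space (c : ℝ) : Set (Fin 3 → ℝ) :=
  {u | if c = 0 then u 2 = 0 else ip c u u = 1 / c ∧ (c < 0 → 0 < u 2)}

/-- A vector orthogonal to the tangent plane of `X²_c` at `P`, which also fixes the orientation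
(outward for the sphere, upward for the plane and the hyperboloid). -/
noncomputable def normalVec (c : ℝ) (P : Fin 3 → ℝ) : Fin 3 → ℝ :=
  if c = 0 then ![0, 0, 1] else P

/-- The generalized sine. -/
noncomputable def sn (c r : ℝ) : ℝ :=
  if c < 0 then Real.sinh (√(-c) * r) / √(-c)
  else if c = 0 then r
  else Real.sin (√c * r) / √c

/-- The generalized cosine. -/
noncomputable def cn (c r : ℝ) : ℝ :=
  if c < 0 then Real.cosh (√(-c) * r)
  else if c = 0 then 1
  else Real.cos (√c * r)

/-- The geodesic curvature `|∇_{γ'} γ'| = |γ'' + c γ|` of a curve parametrized by arclength. -/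
noncomputable def geodesicCurvature (c : ℝ) (γ : ℝ → Fin 3 → ℝ) (s : ℝ) : ℝ :=
  √(ip c (deriv (deriv γ) s + c • γ s) (deriv (deriv γ) s + c • γ s))

/-- The normal vector `n`, defined by `∇_{γ'} γ' = k_g n`. -/
noncomputable def normal (c : ℝ) (γ : ℝ → Fin 3 → ℝ) (s : ℝ) : Fin 3 → ℝ :=
  (geodesicCurvature c γ s)⁻¹ • (deriv (deriv γ) s + c • γ s)

/-- The curvature `|γ''|` of a curve parametrized by arclength, as a curve in the ambient `ℝ³`. -/
noncomputable def ambientCurvature (c : ℝ) (γ : ℝ → Fin 3 → ℝ) (s : ℝ) : ℝ :=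
  √(ip c (deriv (deriv γ) s) (deriv (deriv γ) s))

/-- `γ` is a closed strongly convex curve of length `L` on `X²_c`, parametrized by arclength
(and extended to `ℝ` periodically). -/
structure IsClosedStronglyConvex (c L : ℝ) (γ : ℝ → Fin 3 → ℝ) : Prop where
  length_pos : 0 < L
  smooth : ContDiff ℝ (⊤ : ℕ∞) γ
  mem_space : ∀ s, γ s ∈ space c
  arclength : ∀ s, ip c (deriv γ s) (deriv γ s) = 1
  closed : Function.Periodic γ L
  simple : Set.InjOn γ (Set.Ico 0 L)
  convex_of_nonneg : 0 ≤ c → ∀ s, 0 < geodesicCurvature c γ s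
  convex_of_neg : c < 0 → ∀ s, √|c| < geodesicCurvature c γ s

/-- The radius of curvature: the solution `ρ > 0` of `k_g = cot_c ρ`, with `√c ρ < π / 2` when
`c > 0`. Under strong convexity it exists and is unique, so the set below is a singleton. -/
noncomputable def radius (c : ℝ) (γ : ℝ → Fin 3 → ℝ) (s : ℝ) : ℝ :=
  sInf {ρ : ℝ | 0 < ρ ∧ (0 < c → √c * ρ < Real.pi / 2) ∧
    geodesicCurvature c γ s = cn c ρ / sn c ρ}

/-- The evolute. -/
noncomputable def evolute (c : ℝ) (γ : ℝ → Fin 3 → ℝ) (s : ℝ) : Fin 3 → ℝ :=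
  cn c (radius c γ s) • γ s + sn c (radius c γ s) • normal c γ s

/-- `(e₁, e₂)` is a positively oriented orthonormal basis of the tangent plane of `X²_c` at `P`. -/
structure IsPositiveFrame (c : ℝ) (P e₁ e₂ : Fin 3 → ℝ) : Prop where
  tangent₁ : ip c e₁ (normalVec c P) = 0
  tangent₂ : ip c e₂ (normalVec c P) = 0
  unit₁ : ip c e₁ e₁ = 1
  unit₂ : ip c e₂ e₂ = 1
  orthogonal : ip c e₁ e₂ = 0
  positive : 0 < (Matrix.of ![e₁, e₂, normalVec c P]).det

/-- The point of `X²_c` with geodesic polar coordinates `(r, ψ)` about `P`: the value at `r` of the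
geodesic that starts at `P` in the direction `cos ψ e₁ + sin ψ e₂`. -/
noncomputable def expPolar (c : ℝ) (P e₁ e₂ : Fin 3 → ℝ) (r ψ : ℝ) : Fin 3 → ℝ :=
  cn c r • P + sn c r • (Real.cos ψ • e₁ + Real.sin ψ • e₂)

/-- The closed curve `γ : [0, L] → X²_c` has winding number `m` about `P` in the oriented chart
given by the exponential map at `P` (a chart of all of `X²_c` for `c ≤ 0`, and of the sphere minus
the point antipodal to `P` for `c > 0`): in that chart `γ` is the plane curve
`r (cos ψ, sin ψ)` with `r > 0`, the point `P` is the origin, `ψ` is a continuous branch of the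
argument, and `ψ(L) - ψ(0) = 2 π m`. -/
def HasIndex (c L : ℝ) (γ : ℝ → Fin 3 → ℝ) (P : Fin 3 → ℝ) (m : ℤ) : Prop :=
  ∃ e₁ e₂ : Fin 3 → ℝ, IsPositiveFrame c P e₁ e₂ ∧ ∃ r ψ : ℝ → ℝ,
    ContinuousOn ψ (Set.Icc 0 L) ∧
    (∀ s ∈ Set.Icc 0 L, 0 < r s ∧ (0 < c → √c * r s < Real.pi) ∧
      γ s = expPolar c P e₁ e₂ (r s) (ψ s)) ∧
    ψ L - ψ 0 = 2 * Real.pi * m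

/-- The subset `A` of the sphere lies in an open hemisphere. -/
def InOpenHemisphere (c : ℝ) (A : Set (Fin 3 → ℝ)) : Prop :=
  ∃ v : Fin 3 → ℝ, ∀ u ∈ A, 0 < ip c v u

open Classical in
/-- The index (winding number) of a closed curve `γ : [0, L] → X²_c` with respect to `P`.
On the sphere, where a closed curve has no unbounded side, the index of a curve that lies in an open
hemisphere is normalized to vanish outside that hemisphere: it is the winding number if `γ` and `P`
lie in a common open hemisphere, and `0` otherwise. For `P` on `γ` the value is `0`. -/
noncomputable def index (c L : ℝ) (γ : ℝ → Fin 3 → ℝ) (P : Fin 3 → ℝ) : ℤ :=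
  if h : (0 < c → InOpenHemisphere c (insert P (γ '' Set.Icc 0 L))) ∧ ∃ m, HasIndex c L γ P m
  then h.2.choose else 0

/-- `P` is in the interior of the simple closed curve `γ : [0, L] → X²_c`: its component in the
complement of `γ` is bounded (`c ≤ 0`), lies in an open hemisphere (`c > 0`). -/
def IsInteriorPoint (c L : ℝ) (γ : ℝ → Fin 3 → ℝ) (P : Fin 3 → ℝ) : Prop :=
  P ∈ space c \ γ '' Set.Icc 0 L ∧
  (c ≤ 0 → Bornology.IsBounded (connectedComponentIn (space c \ γ '' Set.Icc 0 L) P)) ∧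
  (0 < c → InOpenHemisphere c (connectedComponentIn (space c \ γ '' Set.Icc 0 L) P))

/-- `γ` is positively oriented: it has index `1` about the points of its interior. -/
def IsPositivelyOriented (c L : ℝ) (γ : ℝ → Fin 3 → ℝ) : Prop :=
  ∀ P, IsInteriorPoint c L γ P → index c L γ P = 1

/-- The point of `X²_c` above (`σ = 1`) or, on the sphere, below (`σ = -1`) the point `p` of the
coordinate plane. Here `(1 - c |p|²) / |c| = |1 / c - |p|²|`. -/
noncomputable def lift (c σ : ℝ) (p : ℝ × ℝ) : Fin 3 → ℝ :=
  ![p.1, p.2, if c = 0 then 0 else σ * √((1 - c * (p.1 ^ 2 + p.2 ^ 2)) / |c|)]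

/-- The area element of `X²_c` in the coordinates `p = (u₁, u₂)`: the square root of the determinant
of the induced metric is `1 / √(1 - c |p|²)`. -/
noncomputable def sheetArea (c : ℝ) : MeasureTheory.Measure (ℝ × ℝ) :=
  (MeasureTheory.volume.restrict {p : ℝ × ℝ | 0 < 1 - c * (p.1 ^ 2 + p.2 ^ 2)}).withDensity
    (fun p => ENNReal.ofReal (1 / √(1 - c * (p.1 ^ 2 + p.2 ^ 2))))

/-- The Riemannian area measure `dS` of `X²_c`, as a measure on the ambient space. For `c ≤ 0` the
surface is the graph of `lift c 1`; the sphere is the union of two such graphs and the equator,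
which has area zero. -/
noncomputable def area (c : ℝ) : MeasureTheory.Measure (Fin 3 → ℝ) :=
  (sheetArea c).map (lift c 1) + if 0 < c then (sheetArea c).map (lift c (-1)) else 0

/-- The area with multiplicities enclosed by the closed curve `γ : [0, L] → X²_c`. -/
noncomputable def areaWithMultiplicities (c L : ℝ) (γ : ℝ → Fin 3 → ℝ) : ℝ :=
  ∫ P, (index c L γ P : ℝ) ∂(area c)

end SpaceForm

/-!
The formula is Gauss–Bonnet for the evolute. Let `T` be the unit tangent of `γ` and `N` its
principal normal in the ambient space, so that `T' = k N`. At the point `γ_e(s)` the vectors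
`T(s)`, `N(s)` form an orthonormal frame of the tangent plane of `X²_c`, and `γ_e` runs in the
direction `± N`, with cusps where its speed vanishes. The frame `(T, N)` is smooth through the
cusps and rotates with speed `k` relative to parallel transport, so Gauss–Bonnet gives `∫ k = 2 π
· (rotation number) - c F`, where `F` is the area enclosed by `γ_e` with multiplicities; the
rotation number is one because `γ` is simple, and `F ≤ 0` because `γ_e` runs backwards around the
points that it encloses. All three signs of `c` are treated at once, in the coordinates of
`SpaceForm.IsFrame`: the orthogonal projection to `ℂ` and the height `h` with `h² + c |z|² = 1`.

Topology enters through winding numbers of projections to the plane. Hopf's theorem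
(`Winding.abs_winding_deriv_le_one`) bounds the rotation number of `γ`. For a point `q` off the
evolute, `IsFrontal.exists_winding_sub` writes the winding number of `γ_e - q` as the sum of the
rotation number and of the winding number of the components `x + i y` of `q` in the frame `(T,
N)`. Since `x' = k y`, this curve crosses the imaginary axis in one sense only, and its winding
number is at most `-1`. For `q` far away the sum vanishes, so that the rotation number is one; for
all other `q` it follows that the winding number about `q` is nonpositive. The Gauss–Bonnet
formula itself, `IsFrontal.integral_add_eq_two_pi`, is the integral of the logarithmic derivative
of `T - i N`.

The line integral that occurs there is identified with the area with multiplicities in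
`integral_winding_mul_density`: the winding number is an integral of the Cauchy kernel, whose
integral over the plane against the rotationally symmetric density of the area is given by
Newton's shell theorem, `integral_cauchyKernel_mul_density`. The index of a curve on `X²_c`,
defined by geodesic polar coordinates, is the winding number of the projection
(`hasWinding_index`). The absolute value `|F|` does not depend on the orientation of `γ`, and
neither does the left-hand side; the two orientations are exchanged by complex conjugation.

On the sphere the projection is injective on an open hemisphere only. A closed convex curve lies
on one side of each of its tangent great circles (`normal_dotProduct_nonneg`): otherwise some
generic point would lie on four of them, which is excluded by comparing the rotation numbers of
the two stereographic projections from that point and its antipode. Hence the curve and its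
evolute lie in a common open hemisphere (`exists_hemisphere`). A rotation moves it to the upper
one; the area is invariant under rotations (`area_mulVec`) because it is the radial projection of
Lebesgue measure.
-/

/-! ### Winding numbers of closed curves in the punctured plane -/

namespace Winding

open Complex

/-- The `L`-periodic curve `f : ℝ → ℂ \ {0}` has winding number `m` about the origin: it has a
continuous logarithm, which increases by `2 π i m` over each period. -/
def HasWinding (L : ℝ) (f : ℝ → ℂ) (m : ℤ) : Prop :=
  ∃ G : ℝ → ℂ, Continuous G ∧ (∀ s, f s = exp (G s)) ∧ ∀ s, G (s + L) = G s + 2 * Real.pi * I * m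

theorem exists_continuous_log {A : Type*} [TopologicalSpace A] [SimplyConnectedSpace A]
    [LocallyPathConnectedSpace A] {f : A → ℂ} (hf : Continuous f) (h0 : ∀ a, f a ≠ 0) :
    ∃ G : A → ℂ, Continuous G ∧ ∀ a, f a = exp (G a) := by
  obtain ⟨a₀⟩ : Nonempty A := inferInstance
  obtain ⟨F, ⟨-, hF⟩, -⟩ := isCoveringMap_exp.existsUnique_continuousMap_lifts
    ⟨fun a => (⟨f a, h0 a⟩ : {z : ℂ // z ≠ 0}), by fun_prop⟩ a₀ (log (f a₀))
    (Subtype.ext (exp_log (h0 a₀)))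
  exact ⟨F, F.continuous, fun a => (congrArg Subtype.val (congrFun hF a)).symm⟩

/-- Two continuous logarithms of the same function on a preconnected set differ by a constant. -/
theorem log_sub_log_eq {A : Type*} [TopologicalSpace A] {S : Set A} (hS : IsPreconnected S)
    {G H : A → ℂ} (hG : ContinuousOn G S) (hH : ContinuousOn H S)
    (h : ∀ a ∈ S, exp (G a) = exp (H a)) {a b : A} (ha : a ∈ S) (hb : b ∈ S) :
    G a - H a = G b - H b := by
  have : DiscreteTopology (AddSubgroup.zmultiples (2 * Real.pi * I) : Set ℂ) :=
    NormedSpace.discreteTopology_zmultiples (2 * Real.pi * I : ℂ)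
  refine hS.constant_of_mapsTo (T := (AddSubgroup.zmultiples (2 * Real.pi * I) : Set ℂ))
    ⟨this⟩ (hG.sub hH) (fun x hx => ?_) ha hb
  obtain ⟨n, hn⟩ := exp_eq_exp_iff_exists_int.1 (h x hx)
  refine AddSubgroup.mem_zmultiples_iff.2 ⟨n, ?_⟩
  simp [hn]

theorem log_sub_log_eq_of_continuous {G H : ℝ → ℂ} (hG : Continuous G) (hH : Continuous H)
    (h : ∀ a, exp (G a) = exp (H a)) (a b : ℝ) : G a - H a = G b - H b :=
  log_sub_log_eq isPreconnected_univ hG.continuousOn hH.continuousOn (fun a _ => h a)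
    (Set.mem_univ a) (Set.mem_univ b)

theorem exists_hasWinding {L : ℝ} {f : ℝ → ℂ} (hf : Continuous f) (h0 : ∀ s, f s ≠ 0)
    (hp : Function.Periodic f L) : ∃ m, HasWinding L f m := by
  obtain ⟨G, hG, hfG⟩ := exists_continuous_log hf h0
  have hexp : ∀ s, exp (G (s + L)) = exp (G s) := fun s => by rw [← hfG, ← hfG, hp s]
  obtain ⟨m, hm⟩ := exp_eq_exp_iff_exists_int.1 (hexp 0)
  refine ⟨m, G, hG, hfG, fun s => ?_⟩
  have := log_sub_log_eq_of_continuous (G := fun s => G (s + L)) (by fun_prop) hG hexp s 0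
  simp only [hm] at this
  linear_combination this

theorem HasWinding.ne_zero {L : ℝ} {f : ℝ → ℂ} {m : ℤ} (h : HasWinding L f m) (s : ℝ) :
    f s ≠ 0 := by
  obtain ⟨G, -, hf, -⟩ := h
  rw [hf]
  exact exp_ne_zero _

theorem HasWinding.continuous {L : ℝ} {f : ℝ → ℂ} {m : ℤ} (h : HasWinding L f m) :
    Continuous f := by
  obtain ⟨G, hG, hf, -⟩ := h
  rw [funext hf]
  fun_prop

theorem two_pi_I_mul_int_inj {m n : ℤ} (h : (2 * Real.pi * I * m : ℂ) = 2 * Real.pi * I * n) :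
    m = n := by
  have := mul_left_cancel₀ two_pi_I_ne_zero h
  exact_mod_cast this

theorem HasWinding.unique {L : ℝ} {f : ℝ → ℂ} {m n : ℤ} (hm : HasWinding L f m)
    (hn : HasWinding L f n) : m = n := by
  obtain ⟨G, hG, hfG, hGm⟩ := hm
  obtain ⟨H, hH, hfH, hHn⟩ := hn
  have := log_sub_log_eq_of_continuous hG hH (fun a => by rw [← hfG, ← hfH]) (0 + L) 0
  rw [hGm, hHn] at this
  apply two_pi_I_mul_int_inj
  linear_combination this

theorem HasWinding.mul {L : ℝ} {f g : ℝ → ℂ} {m n : ℤ} (hf : HasWinding L f m)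
    (hg : HasWinding L g n) : HasWinding L (fun s => f s * g s) (m + n) := by
  obtain ⟨G, hG, hfG, hGm⟩ := hf
  obtain ⟨H, hH, hfH, hHn⟩ := hg
  refine ⟨fun s => G s + H s, by fun_prop, fun s => by simp only [exp_add, hfG, hfH], fun s => ?_⟩
  simp only [hGm, hHn]
  push_cast
  ring

theorem hasWinding_const {L : ℝ} {a : ℂ} (ha : a ≠ 0) : HasWinding L (fun _ => a) 0 :=
  ⟨fun _ => log a, by fun_prop, fun _ => (exp_log ha).symm, by simp⟩

theorem HasWinding.const_mul {L : ℝ} {f : ℝ → ℂ} {m : ℤ} (hf : HasWinding L f m) {a : ℂ}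
    (ha : a ≠ 0) : HasWinding L (fun s => a * f s) m := by
  simpa using (hasWinding_const ha).mul hf

theorem HasWinding.conj {L : ℝ} {f : ℝ → ℂ} {m : ℤ} (hf : HasWinding L f m) :
    HasWinding L (fun s => starRingEnd ℂ (f s)) (-m) := by
  obtain ⟨G, hG, hfG, hGm⟩ := hf
  refine ⟨fun s => starRingEnd ℂ (G s), by fun_prop, fun s => by simp only [hfG, exp_conj],
    fun s => ?_⟩
  simp [hGm, conj_ofNat]

/-- If `f / g` avoids the half-line `(-∞, 0]`, then `f` and `g` have the same winding number: the
difference of their arguments is given by the principal argument of `f / g`. -/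
theorem HasWinding.of_div_mem_slitPlane {L : ℝ} {f g : ℝ → ℂ} {m : ℤ} (hg : HasWinding L g m)
    (hf : Continuous f) (hp : Function.Periodic f L) (h : ∀ s, f s / g s ∈ slitPlane) :
    HasWinding L f m := by
  have hg0 := hg.ne_zero
  have hgc := hg.continuous
  obtain ⟨G, hG, hgG, hGm⟩ := hg
  refine ⟨fun s => G s + log (f s / g s), ?_, fun s => ?_, fun s => ?_⟩
  · exact hG.add (continuous_iff_continuousAt.2 fun s =>
      ContinuousAt.clog ((hf.div hgc hg0).continuousAt) (h s))
  · rw [exp_add, exp_log (slitPlane_ne_zero (h s)), ← hgG, mul_div_cancel₀ _ (hg0 s)]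
  · have hgp : g (s + L) = g s := by
      rw [hgG, hGm, hgG, show G s + 2 * Real.pi * I * m = G s + m * (2 * Real.pi * I) by ring,
        exp_periodic.int_mul m (G s)]
    simp only [hGm, hp s, hgp]
    ring

/-- Two closed curves that always span an acute angle have the same winding number. -/
theorem HasWinding.of_re_mul_conj_pos {L : ℝ} {f g : ℝ → ℂ} {m : ℤ} (hg : HasWinding L g m)
    (hf : Continuous f) (hp : Function.Periodic f L)
    (h : ∀ s, 0 < (f s * starRingEnd ℂ (g s)).re) : HasWinding L f m := by
  refine hg.of_div_mem_slitPlane hf hp fun s => Or.inl ?_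
  have hn : 0 < normSq (g s) := normSq_pos.2 (hg.ne_zero s)
  have : f s / g s = ((normSq (g s))⁻¹ : ℝ) * (f s * starRingEnd ℂ (g s)) := by
    rw [div_eq_mul_inv, inv_def]
    push_cast
    ring
  rw [this, re_ofReal_mul]
  exact mul_pos (inv_pos.2 hn) (h s)

/-- A continuous logarithm of a `C¹` curve is differentiable, with the logarithmic derivative of
the curve as its derivative. -/
theorem hasDerivAt_of_exp_eq {f f' G : ℝ → ℂ} (hf : ∀ s, HasDerivAt f (f' s) s)
    (hf' : Continuous f') (hG : Continuous G) (h : ∀ s, f s = exp (G s)) (s : ℝ) :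
    HasDerivAt G (f' s / f s) s := by
  have h0 : ∀ s, f s ≠ 0 := fun s => by rw [h]; exact exp_ne_zero _
  have hfc : Continuous f := continuous_iff_continuousAt.2 fun s => (hf s).continuousAt
  have hq : Continuous fun s => f' s / f s := hf'.div hfc h0
  set H : ℝ → ℂ := fun s => G 0 + ∫ x in (0 : ℝ)..s, f' x / f x with hH
  have hHd : ∀ s, HasDerivAt H (f' s / f s) s := fun s =>
    (intervalIntegral.integral_hasDerivAt_right (hq.intervalIntegrable _ _)
      (hq.stronglyMeasurableAtFilter _ _) hq.continuousAt).const_add _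
  have hHc : Continuous H := continuous_iff_continuousAt.2 fun s => (hHd s).continuousAt
  have hconst : ∀ s, exp (-H s) * f s = exp (-H 0) * f 0 := by
    have hd : ∀ s, HasDerivAt (fun s => exp (-H s) * f s) 0 s := fun s => by
      have h1 := ((hHd s).neg.cexp).mul (hf s)
      convert! h1 using 1
      field_simp [h0 s]
      simp
    exact fun s => is_const_of_deriv_eq_zero (fun s => (hd s).differentiableAt)
      (fun s => (hd s).deriv) s 0
  have hexp : ∀ s, exp (G s) = exp (H s) := fun s => by
    have h1 := hconst s
    rw [h 0, ← exp_add, show -H 0 + G 0 = 0 by simp [hH], exp_zero, exp_neg,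
      inv_mul_eq_one₀ (exp_ne_zero _)] at h1
    rw [← h, h1]
  have hGH : G = fun s => H s + (G 0 - H 0) := funext fun s => by
    linear_combination log_sub_log_eq_of_continuous hG hHc hexp s 0
  rw [hGH]
  exact (hHd s).add_const _

/-- The winding number of a `C¹` curve is the integral of its logarithmic derivative. -/
theorem HasWinding.integral_eq {L : ℝ} {f f' : ℝ → ℂ} {m : ℤ} (hm : HasWinding L f m)
    (hf : ∀ s, HasDerivAt f (f' s) s) (hf' : Continuous f') :
    ∫ s in (0 : ℝ)..L, f' s / f s = 2 * Real.pi * I * m := by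
  have h0 := hm.ne_zero
  have hfc := hm.continuous
  obtain ⟨G, hG, hfG, hGm⟩ := hm
  rw [intervalIntegral.integral_eq_sub_of_hasDerivAt
    (fun s _ => hasDerivAt_of_exp_eq hf hf' hG hfG s) ((hf'.div hfc h0).intervalIntegrable _ _)]
  have := hGm 0
  rw [zero_add] at this
  rw [this]
  ring

/-- A function that is decreasing at each of its zeros cannot leave `(-∞, 0]`. -/
theorem neg_of_nonpos_of_deriv_neg {φ φ' : ℝ → ℝ} (hφ : ∀ s, HasDerivAt φ (φ' s) s)
    (h : ∀ s, φ s = 0 → φ' s < 0) {a b : ℝ} (hab : a < b) (ha : φ a ≤ 0) : φ b < 0 := by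
  have hle : ∀ x ∈ Set.Icc a b, φ x ≤ 0 := fun x hx =>
    image_le_of_deriv_right_lt_deriv_boundary (B := fun _ => 0) (B' := fun _ => 0)
      (fun s _ => (hφ s).continuousAt.continuousWithinAt)
      (fun s _ => (hφ s).hasDerivWithinAt) ha (fun s => hasDerivAt_const s 0)
      (fun s _ hs => h s hs) hx
  refine lt_of_le_of_ne (hle b ⟨hab.le, le_rfl⟩) fun hb => ?_
  have hslope := (hasDerivAt_iff_tendsto_slope_left_right.1 (hφ b)).1.eventually
    (gt_mem_nhds (h b hb))
  have hIoo : ∀ᶠ x in nhdsWithin b (Set.Iio b), x ∈ Set.Ioo a b := Ioo_mem_nhdsLT hab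
  obtain ⟨x, hx, hxab⟩ := (hslope.and hIoo).exists
  rw [slope_def_field, hb, sub_zero] at hx
  have h1 := hle x ⟨hxab.1.le, hxab.2.le⟩
  have h2 : x - b < 0 := by linarith [hxab.2]
  have h3 := (div_neg_iff.1 hx)
  rcases h3 with h3 | h3 <;> linarith [h3.1, h3.2]

/-- Let `f = X + i Y` with `Y' = - κ X`, `κ > 0`, so that `f` crosses the real axis in the negative
sense only. If the argument of `f` is at most `n π`, it stays below `n π` from then on. -/
theorem arg_lt_of_arg_le {f f' G : ℝ → ℂ} {κ : ℝ → ℝ} (hf : ∀ s, HasDerivAt f (f' s) s)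
    (hf' : Continuous f') (hG : Continuous G) (h : ∀ s, f s = exp (G s)) (hκ : ∀ s, 0 < κ s)
    (hY : ∀ s, (f' s).im = -κ s * (f s).re) {a b : ℝ} (hab : a < b) {n : ℤ}
    (ha : (G a).im ≤ n * Real.pi) : (G b).im < n * Real.pi := by
  have hd := hasDerivAt_of_exp_eq hf hf' hG h
  have hd' : ∀ s, HasDerivAt (fun s => (G s).im - n * Real.pi) ((f' s / f s).im) s := fun s =>
    (imCLM.hasFDerivAt.comp_hasDerivAt s (hd s)).sub_const _
  have := neg_of_nonpos_of_deriv_neg hd' (fun s hs => ?_) hab (by linarith)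
  · linarith
  have h0 : f s ≠ 0 := by rw [h]; exact exp_ne_zero _
  have him : (f s).im = 0 := by
    rw [h, exp_im, sub_eq_zero.1 hs, Real.sin_int_mul_pi, mul_zero]
  have hre : (f s).re ≠ 0 := fun hre => h0 (Complex.ext hre him)
  rw [div_im, him, hY, normSq_apply, him]
  have : -κ s * (f s).re * (f s).re / ((f s).re * (f s).re + 0 * 0)
      - (f' s).re * 0 / ((f s).re * (f s).re + 0 * 0) = -κ s := by
    field_simp
    ring
  rw [this]
  linarith [hκ s]

/-- In the situation of `arg_lt_of_arg_le`, the argument has to drop by another `π` before `f`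
reaches the half-plane opposite to the one entered below `n π`. -/
theorem arg_lt_of_im_sign {f f' G : ℝ → ℂ} {κ : ℝ → ℝ} (hf : ∀ s, HasDerivAt f (f' s) s)
    (hf' : Continuous f') (hG : Continuous G) (h : ∀ s, f s = exp (G s)) (hκ : ∀ s, 0 < κ s)
    (hY : ∀ s, (f' s).im = -κ s * (f s).re) {a b : ℝ} (hab : a < b) {n : ℤ}
    (ha : (G a).im ≤ n * Real.pi) (hb : 0 < (-1) ^ n * (f b).im) :
    (G b).im < (n - 1 : ℤ) * Real.pi := by
  have h1 := arg_lt_of_arg_le hf hf' hG h hκ hY hab ha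
  rw [h, exp_im, mul_left_comm, ← Real.sin_sub_int_mul_pi] at hb
  have h2 := pos_of_mul_pos_right hb (Real.exp_pos _).le
  by_contra! h3
  push_cast at h3
  have := Real.sin_nonpos_of_nonpos_of_neg_pi_le (x := (G b).im - n * Real.pi) (by linarith)
    (by linarith)
  linarith

theorem exists_arg_mem_of_im_neg {f G : ℝ → ℂ} (h : ∀ s, f s = exp (G s)) {a : ℝ}
    (ha : (f a).im < 0) :
    ∃ j : ℤ, (2 * j - 1 : ℝ) * Real.pi < (G a).im ∧ (G a).im ≤ (2 * j : ℤ) * Real.pi := by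
  have hpi := Real.pi_pos
  refine ⟨⌈(G a).im / (2 * Real.pi)⌉, ?_, ?_⟩
  · set j := ⌈(G a).im / (2 * Real.pi)⌉ with hj
    have h1 := Int.ceil_lt_add_one ((G a).im / (2 * Real.pi))
    rw [← hj, ← sub_lt_iff_lt_add, lt_div_iff₀ (by positivity)] at h1
    by_contra! h2
    have h3 := Real.sin_nonneg_of_nonneg_of_le_pi (x := (G a).im - (j - 1 : ℤ) * (2 * Real.pi))
      (by push_cast; linarith) (by push_cast; linarith)
    rw [Real.sin_sub_int_mul_two_pi] at h3
    rw [h, exp_im] at ha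
    have := mul_nonneg (Real.exp_pos (G a).re).le h3
    linarith
  · have h1 := Int.le_ceil ((G a).im / (2 * Real.pi))
    rw [div_le_iff₀ (by positivity)] at h1
    push_cast
    linarith

theorem im_of_periodic_log {L : ℝ} {G : ℝ → ℂ} {m : ℤ}
    (hGm : ∀ s, G (s + L) = G s + 2 * Real.pi * I * m) (s : ℝ) :
    (G (s + L)).im = (G s).im + 2 * Real.pi * m := by
  rw [hGm]
  simp

/-- A closed curve that crosses the real axis in the negative sense only, and does cross it, has
negative winding number. -/
theorem HasWinding.le_neg_one {L : ℝ} {f f' : ℝ → ℂ} {κ : ℝ → ℝ} {m : ℤ} (hm : HasWinding L f m)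
    (hf : ∀ s, HasDerivAt f (f' s) s) (hf' : Continuous f') (hκ : ∀ s, 0 < κ s)
    (hY : ∀ s, (f' s).im = -κ s * (f s).re) {a b : ℝ} (hab : a < b) (hba : b < a + L)
    (ha : (f a).im < 0) (hb : 0 < (f b).im) : m ≤ -1 := by
  obtain ⟨G, hG, hfG, hGm⟩ := hm
  have hp : f (a + L) = f a := by
    rw [hfG, hGm, hfG, show G a + 2 * Real.pi * I * m = G a + m * (2 * Real.pi * I) by ring,
      exp_periodic.int_mul m (G a)]
  obtain ⟨j, hj1, hj2⟩ := exists_arg_mem_of_im_neg hfG ha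
  have e : (-1 : ℝ) ^ (2 * j : ℤ) = 1 := by rw [zpow_mul]; simp
  have o : (-1 : ℝ) ^ (2 * j - 1 : ℤ) = -1 := by rw [zpow_sub₀ (by norm_num), e]; norm_num
  have h1 := arg_lt_of_im_sign hf hf' hG hfG hκ hY hab hj2 (by rw [e]; linarith)
  have h2 := arg_lt_of_im_sign hf hf' hG hfG hκ hY hba h1.le (by rw [o, hp]; linarith)
  rw [im_of_periodic_log hGm] at h2
  push_cast at h2
  have h3 : (m : ℝ) * Real.pi < 0 * Real.pi := by nlinarith [Real.pi_pos]
  have h4 : (m : ℝ) < 0 := lt_of_mul_lt_mul_right h3 Real.pi_pos.le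
  have : m < 0 := by exact_mod_cast h4
  omega

/-- A closed curve that crosses the real axis in the negative sense only, and does so at least four
times, has winding number at most `-2`. -/
theorem HasWinding.le_neg_two {L : ℝ} {f f' : ℝ → ℂ} {κ : ℝ → ℝ} {m : ℤ} (hm : HasWinding L f m)
    (hf : ∀ s, HasDerivAt f (f' s) s) (hf' : Continuous f') (hκ : ∀ s, 0 < κ s)
    (hY : ∀ s, (f' s).im = -κ s * (f s).re) {a b c d : ℝ} (hab : a < b) (hbc : b < c)
    (hcd : c < d) (hda : d < a + L) (ha : (f a).im < 0) (hb : 0 < (f b).im) (hc : (f c).im < 0)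
    (hd : 0 < (f d).im) : m ≤ -2 := by
  obtain ⟨G, hG, hfG, hGm⟩ := hm
  have hp : f (a + L) = f a := by
    rw [hfG, hGm, hfG, show G a + 2 * Real.pi * I * m = G a + m * (2 * Real.pi * I) by ring,
      exp_periodic.int_mul m (G a)]
  obtain ⟨j, hj1, hj2⟩ := exists_arg_mem_of_im_neg hfG ha
  have e : (-1 : ℝ) ^ (2 * j : ℤ) = 1 := by rw [zpow_mul]; simp
  have o : (-1 : ℝ) ^ (2 * j - 1 : ℤ) = -1 := by rw [zpow_sub₀ (by norm_num), e]; norm_num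
  have e2 : (-1 : ℝ) ^ (2 * j - 1 - 1 : ℤ) = 1 := by rw [zpow_sub₀ (by norm_num), o]; norm_num
  have o2 : (-1 : ℝ) ^ (2 * j - 1 - 1 - 1 : ℤ) = -1 := by
    rw [zpow_sub₀ (by norm_num), e2]; norm_num
  have h1 := arg_lt_of_im_sign hf hf' hG hfG hκ hY hab hj2 (by rw [e]; linarith)
  have h2 := arg_lt_of_im_sign hf hf' hG hfG hκ hY hbc h1.le (by rw [o]; linarith)
  have h3 := arg_lt_of_im_sign hf hf' hG hfG hκ hY hcd h2.le (by rw [e2]; linarith)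
  have h4 := arg_lt_of_im_sign hf hf' hG hfG hκ hY hda h3.le (by rw [o2, hp]; linarith)
  rw [im_of_periodic_log hGm] at h4
  push_cast at h4
  have h5 : (m : ℝ) * Real.pi < (-1) * Real.pi := by nlinarith [Real.pi_pos]
  have h6 : (m : ℝ) < -1 := lt_of_mul_lt_mul_right h5 Real.pi_pos.le
  have : m < -1 := by exact_mod_cast h6
  omega

end Winding

/-! ### The rotation number of a simple closed plane curve -/

namespace Winding

open Complex

/-- A continuous function on an interval whose sine is nonnegative increases by at most `π`. -/
theorem sub_le_pi_of_sin_nonneg {θ : ℝ → ℝ} {a b : ℝ} (hab : a ≤ b)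
    (hθ : ContinuousOn θ (Set.Icc a b)) (h : ∀ x ∈ Set.Icc a b, 0 ≤ Real.sin (θ x)) :
    θ b - θ a ≤ Real.pi := by
  by_contra! hlt
  have hpi := Real.pi_pos
  set j := ⌊θ a / (2 * Real.pi)⌋ with hj
  have h1 := Int.floor_le (θ a / (2 * Real.pi))
  have h2 := Int.lt_floor_add_one (θ a / (2 * Real.pi))
  rw [← hj, le_div_iff₀ (by positivity)] at h1
  rw [← hj, div_lt_iff₀ (by positivity)] at h2
  have h3 : θ a ≤ (2 * j + 1) * Real.pi := by
    by_contra! h4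
    have h5 := Real.sin_neg_of_neg_of_neg_pi_lt (x := θ a - (j + 1 : ℤ) * (2 * Real.pi))
      (by push_cast; linarith) (by push_cast; linarith)
    rw [Real.sin_sub_int_mul_two_pi] at h5
    linarith [h a ⟨le_rfl, hab⟩]
  obtain ⟨y, hy1, hy2⟩ := exists_between (lt_min (by linarith : (2 * j + 1) * Real.pi < θ b)
    (by linarith : (2 * j + 1) * Real.pi < (2 * j + 2) * Real.pi))
  obtain ⟨x, hx, rfl⟩ := intermediate_value_Icc hab hθ
    ⟨h3.trans hy1.le, hy2.le.trans (min_le_left _ _)⟩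
  have h5 := Real.sin_neg_of_neg_of_neg_pi_lt (x := θ x - (j + 1 : ℤ) * (2 * Real.pi))
    (by push_cast; linarith [hy2.trans_le (min_le_right _ _)]) (by push_cast; linarith)
  rw [Real.sin_sub_int_mul_two_pi] at h5
  linarith [h x hx]

theorem abs_sub_le_pi_of_sin_nonneg {θ : ℝ → ℝ} {a b : ℝ} (hab : a ≤ b)
    (hθ : ContinuousOn θ (Set.Icc a b)) (h : ∀ x ∈ Set.Icc a b, 0 ≤ Real.sin (θ x)) :
    |θ b - θ a| ≤ Real.pi := by
  refine abs_le.2 ⟨?_, sub_le_pi_of_sin_nonneg hab hθ h⟩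
  have := sub_le_pi_of_sin_nonneg (θ := fun x => Real.pi - θ x) hab (by fun_prop)
    (fun x hx => by rw [Real.sin_pi_sub]; exact h x hx)
  linarith

theorem abs_sub_le_pi_of_sin_nonpos {θ : ℝ → ℝ} {a b : ℝ} (hab : a ≤ b)
    (hθ : ContinuousOn θ (Set.Icc a b)) (h : ∀ x ∈ Set.Icc a b, Real.sin (θ x) ≤ 0) :
    |θ b - θ a| ≤ Real.pi := by
  have := abs_sub_le_pi_of_sin_nonneg (θ := fun x => θ x + Real.pi) hab (by fun_prop)
    (fun x hx => by rw [Real.sin_add_pi]; linarith [h x hx])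
  simpa using this

theorem ne_of_injOn_Ico {α : Type*} {L : ℝ} {g : ℝ → α} (hL : 0 < L)
    (hp : Function.Periodic g L) (hi : Set.InjOn g (Set.Ico 0 L)) {s t : ℝ} (hst : s < t)
    (hts : t < s + L) : g s ≠ g t := fun h => by
  have hm : ∀ x, g (toIcoMod hL 0 x) = g x := fun x => by
    rw [toIcoMod, zsmul_eq_mul, hp.sub_int_mul_eq]
  have h1 := hi (by simpa using toIcoMod_mem_Ico hL 0 s) (by simpa using toIcoMod_mem_Ico hL 0 t)
    (by rw [hm, hm, h])
  rw [toIcoMod_eq_toIcoMod] at h1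
  obtain ⟨n, hn⟩ := h1
  rw [zsmul_eq_mul] at hn
  have h2 : (0 : ℝ) < n := by
    by_contra! h3
    nlinarith
  have h3 : (n : ℝ) < 1 := by
    by_contra! h3
    nlinarith
  have h4 : 0 < n := by exact_mod_cast h2
  have h5 : n < 1 := by exact_mod_cast h3
  omega

/-- The mean velocity `(g (s + d) - g s) / d` of a curve with velocity `g'`, equal to `g' s` for
`d = 0`. -/
noncomputable def meanVelocity (g' : ℝ → ℂ) (s d : ℝ) : ℂ := ∫ x in (0 : ℝ)..1, g' (s + x * d)

theorem continuous_meanVelocity {g' : ℝ → ℂ} (hg' : Continuous g') :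
    Continuous fun p : ℝ × ℝ => meanVelocity g' p.1 p.2 :=
  intervalIntegral.continuous_parametric_intervalIntegral_of_continuous'
    (f := fun (p : ℝ × ℝ) x => g' (p.1 + x * p.2)) (by fun_prop) 0 1

theorem mul_meanVelocity {g g' : ℝ → ℂ} (hg : ∀ s, HasDerivAt g (g' s) s)
    (hg' : Continuous g') (s d : ℝ) : d * meanVelocity g' s d = g (s + d) - g s := by
  have hd : ∀ x : ℝ, HasDerivAt (fun x : ℝ => g (s + x * d)) (d • g' (s + x * d)) x := fun x => by
    have h1 : HasDerivAt (fun x : ℝ => s + x * d) d x := by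
      simpa using ((hasDerivAt_id x).mul_const d).const_add s
    exact HasDerivAt.scomp x (hg _) h1
  have := intervalIntegral.integral_eq_sub_of_hasDerivAt (a := 0) (b := 1) (fun x _ => hd x)
    (Continuous.intervalIntegrable (by fun_prop) _ _)
  rw [intervalIntegral.integral_smul] at this
  simpa [meanVelocity] using this

/-- Hopf's theorem (inequality part): the tangent of a simple closed plane curve makes at most one
turn. The proof follows the direction of the secant from `g s` to `g (s + d)` over the triangle
`0 ≤ s`, `0 ≤ d`, `s + d ≤ L`. On the side `d = 0` this is the tangent; if the curve starts at its
lowest point, the secant stays in a half-plane along each of the two other sides. -/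
theorem abs_winding_deriv_le_one {L : ℝ} (hL : 0 < L) {g g' : ℝ → ℂ}
    (hg : ∀ s, HasDerivAt g (g' s) s) (hg' : Continuous g') (hp : Function.Periodic g L)
    (hi : Set.InjOn g (Set.Ico 0 L)) {m : ℤ} (hm : HasWinding L g' m) : |m| ≤ 1 := by
  have hg0 := hm.ne_zero
  have hgc : Continuous g := continuous_iff_continuousAt.2 fun s => (hg s).continuousAt
  have hp' : Function.Periodic g' L := fun s => by
    have h1 : HasDerivAt (fun x => g (x + L)) (g' (s + L)) s := (hg (s + L)).comp_add_const s L
    rw [show (fun x => g (x + L)) = g from funext hp] at h1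
    exact h1.unique (hg s)
  -- the parameter of a lowest point of the curve
  obtain ⟨a, ha⟩ : ∃ a, ∀ s, (g a).im ≤ (g s).im := by
    obtain ⟨a, -, ha⟩ := isCompact_Icc.exists_isMinOn (Set.nonempty_Icc.2 hL.le)
      (f := fun s => (g s).im) (by fun_prop)
    refine ⟨a, fun s => ?_⟩
    obtain ⟨y, hy, hys⟩ := hp.exists_mem_Ico₀ hL s
    rw [hys]
    exact ha ⟨hy.1, hy.2.le⟩
  set V := meanVelocity g' with hV
  -- the secant, rescaled so as to extend to `d = 0` and to `d = L` without zeros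
  set F : ℝ × ℝ → ℂ := fun q => V q.1 q.2 - V q.1 (q.2 - L) with hF
  have hFc : Continuous F := by
    have h1 := continuous_meanVelocity hg'
    exact h1.sub (h1.comp (g := fun p : ℝ × ℝ => meanVelocity g' p.1 p.2)
      (f := fun q : ℝ × ℝ => (q.1, q.2 - L)) (by fun_prop))
  have hFd : ∀ s d : ℝ, (d * (L - d) : ℝ) * F (s, d) = L * (g (s + d) - g s) := fun s d => by
    have h1 := mul_meanVelocity hg hg' s d
    have h2 := mul_meanVelocity hg hg' s (d - L)
    rw [show g (s + (d - L)) = g (s + d) by rw [← add_sub_assoc, hp.sub_eq]] at h2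
    simp only [hF]
    push_cast at h2 ⊢
    linear_combination ((L : ℂ) - d) * h1 + (d : ℂ) * h2
  have hV0 : ∀ s, V s 0 = g' s := fun s => by simp [hV, meanVelocity]
  have hVL : ∀ s, V s L = 0 := fun s => by
    have h1 := mul_meanVelocity hg hg' s L
    rw [hp s, sub_self] at h1
    exact (mul_eq_zero.1 h1).resolve_left (by exact_mod_cast hL.ne')
  have hVnL : ∀ s, V s (-L) = 0 := fun s => by
    have h1 := mul_meanVelocity hg hg' s (-L)
    rw [← sub_eq_add_neg, hp.sub_eq, sub_self] at h1
    exact (mul_eq_zero.1 h1).resolve_left (by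
      rw [ofReal_neg]; exact neg_ne_zero.2 (by exact_mod_cast hL.ne'))
  have hF0 : ∀ s, F (s, 0) = g' s := fun s => by simp [hF, hV0, hVnL]
  have hFL : ∀ s, F (s, L) = -g' s := fun s => by simp [hF, hV0, hVL]
  have hFne : ∀ s, ∀ d ∈ Set.Icc 0 L, F (s, d) ≠ 0 := fun s d hd h => by
    rcases hd.1.eq_or_lt with h0 | h0
    · rw [← h0, hF0] at h
      exact hg0 s h
    rcases hd.2.eq_or_lt with h1 | h1
    · rw [h1, hFL, neg_eq_zero] at h
      exact hg0 s h
    have h2 := hFd s d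
    rw [h, mul_zero, eq_comm, mul_eq_zero, sub_eq_zero] at h2
    rcases h2 with h2 | h2
    · exact hL.ne' (by exact_mod_cast h2)
    · exact ne_of_injOn_Ico hL hp hi (s := s) (t := s + d) (by linarith) (by linarith) h2.symm
  obtain ⟨G, hG, hFG⟩ := exists_continuous_log
    (f := fun q : ℝ × ℝ => F (q.1, (Set.projIcc 0 L hL.le q.2 : ℝ))) (by fun_prop)
    (fun q => hFne _ _ (Set.projIcc 0 L hL.le q.2).2)
  have hFG' : ∀ s, ∀ d ∈ Set.Icc 0 L, F (s, d) = exp (G (s, d)) := fun s d hd => by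
    rw [← hFG, Set.projIcc_of_mem hL.le hd]
  have hsin : ∀ s, ∀ d ∈ Set.Icc 0 L, ∀ y : ℝ, y * (F (s, d)).im ≥ 0 →
      0 ≤ y * Real.sin (G (s, d)).im := fun s d hd y hy => by
    rw [hFG' s d hd, exp_im, mul_left_comm] at hy
    exact nonneg_of_mul_nonneg_right hy (Real.exp_pos _)
  have him : ∀ s d : ℝ, d * (L - d) * (F (s, d)).im = L * ((g (s + d)).im - (g s).im) :=
    fun s d => by
      have := congrArg im (hFd s d)
      rwa [im_ofReal_mul, im_ofReal_mul, sub_im] at this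
  -- the tangent is horizontal at the lowest point
  have hga : (g' a).im = 0 :=
    IsLocalMin.hasDerivAt_eq_zero (f := fun s => (g s).im) (Filter.Eventually.of_forall ha)
      (imCLM.hasFDerivAt.comp_hasDerivAt a (hg a))
  have h1 : |(G (a, L)).im - (G (a, 0)).im| ≤ Real.pi := by
    refine abs_sub_le_pi_of_sin_nonneg (θ := fun d => (G (a, d)).im) hL.le (by fun_prop)
      fun d hd => ?_
    have := hsin a d hd 1 ?_
    · simpa using this
    rw [one_mul]
    rcases hd.1.eq_or_lt with h0 | h0
    · rw [← h0, hF0, hga]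
    rcases hd.2.eq_or_lt with h1 | h1
    · rw [h1, hFL, neg_im, hga, neg_zero]
    have h3 : 0 < d * (L - d) := mul_pos h0 (sub_pos.2 h1)
    have h4 : 0 ≤ d * (L - d) * (F (a, d)).im := by
      rw [him]
      exact mul_nonneg hL.le (sub_nonneg.2 (ha _))
    exact nonneg_of_mul_nonneg_right h4 h3
  have h2 : |(G (a + L, L - L)).im - (G (a + 0, L - 0)).im| ≤ Real.pi := by
    refine abs_sub_le_pi_of_sin_nonpos (θ := fun s => (G (a + s, L - s)).im) hL.le (by fun_prop)
      fun s hs => ?_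
    have hs' : L - s ∈ Set.Icc 0 L := ⟨by linarith [hs.2], by linarith [hs.1]⟩
    have := hsin (a + s) (L - s) hs' (-1) ?_
    · linarith
    rcases hs.1.eq_or_lt with h0 | h0
    · rw [← h0, add_zero, sub_zero, hFL, neg_im, hga]
      simp
    rcases hs.2.eq_or_lt with h1 | h1
    · rw [h1, sub_self, hF0, hp', hga]
      simp
    have h3 : 0 < (L - s) * s := mul_pos (sub_pos.2 h1) h0
    have h4 := him (a + s) (L - s)
    rw [sub_sub_cancel, show a + s + (L - s) = a + L by ring, hp] at h4
    have h5 : L * ((g a).im - (g (a + s)).im) ≤ 0 :=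
      mul_nonpos_of_nonneg_of_nonpos hL.le (sub_nonpos.2 (ha _))
    have h6 := nonpos_of_mul_nonpos_right (h4.trans_le h5) h3
    linarith
  simp only [sub_self, add_zero, sub_zero] at h2
  obtain ⟨H, hH, hgH, hHm⟩ := hm
  have h3 := log_sub_log_eq_of_continuous (G := fun s => G (s, 0)) (by fun_prop) hH
    (fun s => by rw [← hFG' s 0 ⟨le_rfl, hL.le⟩, hF0, hgH]) (a + L) a
  rw [hHm] at h3
  have h4 := congrArg im h3
  simp only [sub_im, add_im] at h4
  have h5 : (2 * (Real.pi : ℂ) * I * m).im = 2 * Real.pi * m := by simp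
  rw [h5] at h4
  have h6 := abs_le.1 h1
  have h7 := abs_le.1 h2
  have hpi := Real.pi_pos
  have h8 : (m : ℝ) ≤ 1 := by
    by_contra! h
    nlinarith
  have h9 : (-1 : ℝ) ≤ m := by
    by_contra! h
    nlinarith
  exact abs_le.2 ⟨by exact_mod_cast h9, by exact_mod_cast h8⟩

end Winding

/-! ### Orthonormal frames in projected coordinates -/

namespace SpaceForm

open Complex Winding

/-- A positively oriented frame `(T, n)` at a point of `X²_c`, in coordinates that depend
polynomially on `c`. A point `P` of `X²_c` is represented by its projection `B = P₁ + i P₂` and by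
`h = √|c| P₃` (`h = 1` if `c = 0`), so that `h² + c |B|² = 1`. A tangent vector at `P` is
represented by its projection and by a number `t` with `c t = √|c| T₃`; orthogonality to `P`
becomes `T · B + h t = 0`, which also defines `t` for `c = 0`. The scalar product is
`T · T' + c t t'`, and `n`, `u` are the components of the vector product of `P` and `T`. -/
structure IsFrame (c : ℝ) (T n B : ℂ) (t u h : ℝ) : Prop where
  norm_tangent : T.re ^ 2 + T.im ^ 2 + c * t ^ 2 = 1
  inner_eq_zero : T.re * B.re + T.im * B.im + h * t = 0
  norm_point : h ^ 2 + c * (B.re ^ 2 + B.im ^ 2) = 1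
  normal_eq : n = I * (h * T - c * t * B)
  normal_height : u = B.re * T.im - B.im * T.re

namespace IsFrame

variable {c t u h : ℝ} {T n B : ℂ}

theorem normal_re (F : IsFrame c T n B t u h) : n.re = -(h * T.im - c * t * B.im) := by
  simp [F.normal_eq]

theorem normal_im (F : IsFrame c T n B t u h) : n.im = h * T.re - c * t * B.re := by
  simp [F.normal_eq]

theorem cross_tangent_normal (F : IsFrame c T n B t u h) : T.re * n.im - T.im * n.re = h := by
  have := F.norm_tangent
  have := F.inner_eq_zero
  grind [F.normal_re, F.normal_im]

theorem cross_normal_point (F : IsFrame c T n B t u h) : n.re * B.im - n.im * B.re = t := by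
  have := F.norm_point
  have := F.inner_eq_zero
  grind [F.normal_re, F.normal_im]

theorem norm_normal (F : IsFrame c T n B t u h) : n.re ^ 2 + n.im ^ 2 + c * u ^ 2 = 1 := by
  have := F.norm_point
  have := F.inner_eq_zero
  have := F.norm_tangent
  have := F.normal_height
  grind [F.normal_re, F.normal_im]

theorem inner_normal_point (F : IsFrame c T n B t u h) :
    n.re * B.re + n.im * B.im + h * u = 0 := by
  have := F.normal_height
  grind [F.normal_re, F.normal_im]

theorem inner_tangent_normal (F : IsFrame c T n B t u h) :
    T.re * n.re + T.im * n.im + c * (t * u) = 0 := by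
  have := F.normal_height
  grind [F.normal_re, F.normal_im]

/-- The rows of the orthogonal matrix with columns `T`, `n`, `P` are orthonormal as well: the third
row has norm one. -/
theorem norm_height (F : IsFrame c T n B t u h) : c * (t ^ 2 + u ^ 2) + h ^ 2 = 1 := by
  have := F.norm_point
  have := F.inner_eq_zero
  have := F.norm_tangent
  have := F.normal_height
  grind

theorem height_combination (F : IsFrame c T n B t u h) : t * T + u * n + h * B = 0 := by
  have := F.norm_point
  have := F.inner_eq_zero
  have := F.norm_tangent
  have := F.normal_height
  apply Complex.ext
  · simp only [add_re, re_ofReal_mul, zero_re]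
    grind [F.normal_re, F.normal_im]
  · simp only [add_im, im_ofReal_mul, zero_im]
    grind [F.normal_re, F.normal_im]

theorem norm_re (F : IsFrame c T n B t u h) : T.re ^ 2 + n.re ^ 2 + c * B.re ^ 2 = 1 := by
  have := F.norm_point
  have := F.inner_eq_zero
  have := F.norm_tangent
  grind [F.normal_re]

theorem norm_im (F : IsFrame c T n B t u h) : T.im ^ 2 + n.im ^ 2 + c * B.im ^ 2 = 1 := by
  have := F.norm_point
  have := F.inner_eq_zero
  have := F.norm_tangent
  grind [F.normal_im]

theorem inner_re_im (F : IsFrame c T n B t u h) :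
    T.re * T.im + n.re * n.im + c * (B.re * B.im) = 0 := by
  have := F.norm_point
  have := F.inner_eq_zero
  have := F.norm_tangent
  grind [F.normal_re, F.normal_im]

/-- A vector orthogonal to `P` and to `T` is a multiple of `n`. -/
theorem eq_smul_normal (F : IsFrame c T n B t u h) {X : ℂ} {ξ : ℝ}
    (hB : X.re * B.re + X.im * B.im + h * ξ = 0)
    (hT : X.re * T.re + X.im * T.im + c * (t * ξ) = 0) :
    X = (X.re * n.re + X.im * n.im + c * (u * ξ) : ℝ) * n ∧
      ξ = (X.re * n.re + X.im * n.im + c * (u * ξ)) * u := by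
  have h1 := F.norm_re
  have h2 := F.norm_im
  have h3 := F.inner_re_im
  have h4 := congrArg re F.height_combination
  have h5 := congrArg im F.height_combination
  have h6 := F.norm_height
  simp only [add_re, add_im, re_ofReal_mul, im_ofReal_mul, zero_re, zero_im] at h4 h5
  refine ⟨Complex.ext ?_ ?_, ?_⟩
  · rw [re_ofReal_mul]
    linear_combination (-X.re) * h1 - X.im * h3 - c * ξ * h4 + c * B.re * hB + T.re * hT
  · rw [im_ofReal_mul]
    linear_combination (-X.im) * h2 - X.re * h3 - c * ξ * h5 + c * B.im * hB + T.im * hT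
  · linear_combination (-ξ) * h6 - X.re * h4 - X.im * h5 + h * hB + t * hT

/-- Rotation of the frame about its first vector: the point moves along the geodesic in the
direction `n`, by the distance with generalized cosine `p` and sine `q`. -/
theorem rotate (F : IsFrame c T n B t u h) {p q : ℝ} (hpq : p ^ 2 + c * q ^ 2 = 1) :
    IsFrame c T (p * n - c * q * B) (p * B + q * n) t (p * u - q * h) (p * h + c * q * u) where
  norm_tangent := F.norm_tangent
  inner_eq_zero := by
    have h1 := F.inner_eq_zero
    have h2 := F.inner_tangent_normal
    simp only [add_re, add_im, re_ofReal_mul, im_ofReal_mul]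
    linear_combination p * h1 + q * h2
  norm_point := by
    have h1 := F.norm_point
    have h2 := F.norm_normal
    have h3 := F.inner_normal_point
    simp only [add_re, add_im, re_ofReal_mul, im_ofReal_mul]
    linear_combination p ^ 2 * h1 + c * q ^ 2 * h2 + 2 * c * p * q * h3 + hpq
  normal_eq := by
    -- the frame `(n, P)` is obtained from `T` by a rotation of the plane orthogonal to `T`
    have h1 := F.normal_eq
    have h2 : B = -(I * (u * T - t * n)) := by
      have h3 := F.norm_point
      have h4 := F.inner_eq_zero
      have h5 := F.norm_tangent
      have h6 := F.normal_height
      apply Complex.ext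
      · simp
        grind [F.normal_re, F.normal_im]
      · simp
        grind [F.normal_re, F.normal_im]
    push_cast
    linear_combination (p : ℂ) * h1 - c * q * h2
  normal_height := by
    have h1 := F.normal_height
    have h2 := F.cross_tangent_normal
    simp only [add_re, add_im, re_ofReal_mul, im_ofReal_mul]
    linear_combination p * h1 + q * h2

/-- Stereographic projection is conformal: it maps the frame to `(T - i n, n + i T)`. -/
theorem mul_tangent_sub_normal (F : IsFrame c T n B t u h) :
    (t + u * I) * (T - I * n) = -((1 + h) * B) := by
  have := F.norm_point
  have := F.inner_eq_zero
  have := F.norm_tangent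
  have := F.normal_height
  apply Complex.ext
  · simp
    grind [F.normal_re, F.normal_im]
  · simp
    grind [F.normal_re, F.normal_im]

theorem mul_tangent_add_normal (F : IsFrame c T n B t u h) :
    (t - u * I) * (T + I * n) = (1 - h) * B := by
  have := F.norm_point
  have := F.inner_eq_zero
  have := F.norm_tangent
  have := F.normal_height
  apply Complex.ext
  · simp
    grind [F.normal_re, F.normal_im]
  · simp
    grind [F.normal_re, F.normal_im]

/-- The components of a point `(q, η)` with respect to the frame give the direction from `q` to `B`
in the central projection. -/
theorem central_projection (F : IsFrame c T n B t u h) (q : ℂ) (η : ℝ) :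
    B * η - q * h = I * ((T.re * q.re + T.im * q.im + t * η : ℝ) * n
      - (n.re * q.re + n.im * q.im + u * η : ℝ) * T) := by
  have := F.norm_point
  have := F.inner_eq_zero
  have := F.norm_tangent
  have := F.normal_height
  apply Complex.ext
  · simp
    grind [F.normal_re, F.normal_im]
  · simp
    grind [F.normal_re, F.normal_im]

theorem normSq_tangent_sub_normal (F : IsFrame c T n B t u h) :
    normSq (T - I * n) = (1 + h) ^ 2 := by
  have := F.norm_point
  have := F.inner_eq_zero
  have := F.norm_tangent
  rw [normSq_apply]
  simp
  grind [F.normal_re, F.normal_im]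

theorem re_point_mul_conj (F : IsFrame c T n B t u h) :
    (B * starRingEnd ℂ (T - I * n)).re = -(t * (1 + h)) := by
  have := F.norm_point
  have := F.inner_eq_zero
  have := F.norm_tangent
  simp
  grind [F.normal_re, F.normal_im]

end IsFrame

end SpaceForm

/-! ### Frenet curves and their evolutes -/

namespace SpaceForm

open Complex Winding

/-- A closed curve of length `L` parametrized by arclength, with its frame and signed curvature
`κ`, in the coordinates of `IsFrame`: the Frenet equations hold. -/
structure IsFrenetCurve (c L : ℝ) (T n g : ℝ → ℂ) (t u h κ κ' : ℝ → ℝ) : Prop where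
  isFrame : ∀ s, IsFrame c (T s) (n s) (g s) (t s) (u s) (h s)
  hasDerivAt_point : ∀ s, HasDerivAt g (T s) s
  hasDerivAt_height : ∀ s, HasDerivAt h (c * t s) s
  hasDerivAt_tangent : ∀ s, HasDerivAt T (-(c * g s) + κ s * n s) s
  hasDerivAt_tangent_height : ∀ s, HasDerivAt t (-h s + κ s * u s) s
  hasDerivAt_curvature : ∀ s, HasDerivAt κ (κ' s) s
  continuous_deriv_curvature : Continuous κ'
  periodic : ∀ s, T (s + L) = T s ∧ g (s + L) = g s ∧ t (s + L) = t s ∧ h (s + L) = h s ∧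
    κ (s + L) = κ s

theorem hasDerivAt_re {f : ℝ → ℂ} {f' : ℂ} {s : ℝ} (hf : HasDerivAt f f' s) :
    HasDerivAt (fun s => (f s).re) f'.re s :=
  reCLM.hasFDerivAt.comp_hasDerivAt s hf

theorem hasDerivAt_im {f : ℝ → ℂ} {f' : ℂ} {s : ℝ} (hf : HasDerivAt f f' s) :
    HasDerivAt (fun s => (f s).im) f'.im s :=
  imCLM.hasFDerivAt.comp_hasDerivAt s hf

theorem continuous_of_hasDerivAt {E : Type*} [NormedAddCommGroup E] [NormedSpace ℝ E]
    {f f' : ℝ → E} (hf : ∀ s, HasDerivAt f (f' s) s) : Continuous f :=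
  continuous_iff_continuousAt.2 fun s => (hf s).continuousAt

namespace IsFrenetCurve

variable {c L : ℝ} {T n g : ℝ → ℂ} {t u h κ κ' : ℝ → ℝ}

theorem normal_eq (F : IsFrenetCurve c L T n g t u h κ κ') :
    n = fun s => I * (h s * T s - c * t s * g s) :=
  funext fun s => (F.isFrame s).normal_eq

theorem normal_height (F : IsFrenetCurve c L T n g t u h κ κ') :
    u = fun s => (g s).re * (T s).im - (g s).im * (T s).re :=
  funext fun s => (F.isFrame s).normal_height

theorem continuous_point (F : IsFrenetCurve c L T n g t u h κ κ') : Continuous g :=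
  continuous_of_hasDerivAt F.hasDerivAt_point

theorem continuous_height (F : IsFrenetCurve c L T n g t u h κ κ') : Continuous h :=
  continuous_of_hasDerivAt F.hasDerivAt_height

theorem continuous_tangent (F : IsFrenetCurve c L T n g t u h κ κ') : Continuous T :=
  continuous_of_hasDerivAt F.hasDerivAt_tangent

theorem continuous_tangent_height (F : IsFrenetCurve c L T n g t u h κ κ') : Continuous t :=
  continuous_of_hasDerivAt F.hasDerivAt_tangent_height

theorem continuous_curvature (F : IsFrenetCurve c L T n g t u h κ κ') : Continuous κ :=
  continuous_of_hasDerivAt F.hasDerivAt_curvature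

theorem continuous_normal (F : IsFrenetCurve c L T n g t u h κ κ') : Continuous n := by
  have := F.continuous_point
  have := F.continuous_height
  have := F.continuous_tangent
  have := F.continuous_tangent_height
  rw [F.normal_eq]
  fun_prop

theorem continuous_normal_height (F : IsFrenetCurve c L T n g t u h κ κ') : Continuous u := by
  have := F.continuous_point
  have := F.continuous_tangent
  rw [F.normal_height]
  fun_prop

theorem periodic_normal (F : IsFrenetCurve c L T n g t u h κ κ') : Function.Periodic n L := by
  intro s
  obtain ⟨h1, h2, h3, h4, -⟩ := F.periodic s
  simp only [F.normal_eq, h1, h2, h3, h4]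

theorem periodic_normal_height (F : IsFrenetCurve c L T n g t u h κ κ') :
    Function.Periodic u L := by
  intro s
  obtain ⟨h1, h2, -⟩ := F.periodic s
  simp only [F.normal_height, h1, h2]

theorem hasDerivAt_normal (F : IsFrenetCurve c L T n g t u h κ κ') (s : ℝ) :
    HasDerivAt n (-(κ s * T s)) s := by
  have h1 := (((F.hasDerivAt_height s).ofReal_comp.mul (F.hasDerivAt_tangent s)).sub
    (((F.hasDerivAt_tangent_height s).ofReal_comp.const_mul (c : ℂ)).mul
      (F.hasDerivAt_point s))).const_mul I
  rw [F.normal_eq]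
  convert! h1 using 1
  -- the claim is that the vector product of `P` and `n` is `- T`
  have h2 : -(T s) = I * (h s * n s - c * u s * g s) := by
    have := (F.isFrame s).norm_point
    have := (F.isFrame s).inner_eq_zero
    have := (F.isFrame s).norm_tangent
    have := (F.isFrame s).normal_height
    apply Complex.ext
    · simp
      grind [(F.isFrame s).normal_re, (F.isFrame s).normal_im]
    · simp
      grind [(F.isFrame s).normal_re, (F.isFrame s).normal_im]
  push_cast
  linear_combination (κ s : ℂ) * h2

theorem hasDerivAt_normal_height (F : IsFrenetCurve c L T n g t u h κ κ') (s : ℝ) :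
    HasDerivAt u (-(κ s * t s)) s := by
  have h1 := ((hasDerivAt_re (F.hasDerivAt_point s)).mul
    (hasDerivAt_im (F.hasDerivAt_tangent s))).sub ((hasDerivAt_im (F.hasDerivAt_point s)).mul
    (hasDerivAt_re (F.hasDerivAt_tangent s)))
  rw [F.normal_height]
  convert! h1 using 1
  have h2 := (F.isFrame s).cross_normal_point
  simp only [add_re, add_im, neg_re, neg_im, re_ofReal_mul, im_ofReal_mul]
  linear_combination κ s * h2

end IsFrenetCurve

/-- The curvature of a curve as a curve in the ambient space. -/
noncomputable def spaceCurvature (c κ : ℝ) : ℝ := √(κ ^ 2 + c)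

/-- The projection of the evolute; see `IsFrame.rotate`. -/
noncomputable def evolutePoint (c κ : ℝ) (n g : ℂ) : ℂ :=
  (κ / spaceCurvature c κ : ℝ) * g + (1 / spaceCurvature c κ : ℝ) * n

/-- The height, in the sense of `IsFrame`, of the point of the evolute. -/
noncomputable def evoluteHeight (c κ u h : ℝ) : ℝ :=
  κ / spaceCurvature c κ * h + c * (1 / spaceCurvature c κ) * u

/-- The projection of the unit tangent of the evolute, which is the principal normal of the curve
in the ambient space. -/
noncomputable def evoluteTangent (c κ : ℝ) (n g : ℂ) : ℂ :=
  (κ / spaceCurvature c κ : ℝ) * n - c * (1 / spaceCurvature c κ : ℝ) * g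

/-- The height of the unit tangent of the evolute. -/
noncomputable def evoluteTangentHeight (c κ u h : ℝ) : ℝ :=
  κ / spaceCurvature c κ * u - 1 / spaceCurvature c κ * h

/-- The signed speed of the evolute. -/
noncomputable def evoluteSpeed (c κ κ' : ℝ) : ℝ := -(κ' / spaceCurvature c κ ^ 2)

section

variable {c κ : ℝ} (hk : 0 < κ ^ 2 + c)
include hk

theorem spaceCurvature_pos : 0 < spaceCurvature c κ := Real.sqrt_pos.2 hk

theorem spaceCurvature_sq : spaceCurvature c κ ^ 2 = κ ^ 2 + c := Real.sq_sqrt hk.le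

theorem evolute_coeff : (κ / spaceCurvature c κ) ^ 2 + c * (1 / spaceCurvature c κ) ^ 2 = 1 := by
  have h1 := spaceCurvature_pos hk
  have h2 := spaceCurvature_sq hk
  field_simp
  linarith

end

end SpaceForm

/-! ### The evolute as a frontal -/

namespace SpaceForm

open Complex Winding

/-- A closed curve `B` that runs in the direction of the unit vector `N`, with signed speed `τ`, and
whose frame `(T, N)` rotates with speed `k`, in the coordinates of `IsFrame`. The evolute of a curve
with tangent `T` is of this form, with cusps at the zeros of `τ`. -/
structure IsFrontal (c L : ℝ) (T N B : ℝ → ℂ) (t v η k τ : ℝ → ℝ) : Prop where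
  isFrame : ∀ s, IsFrame c (T s) (N s) (B s) (t s) (v s) (η s)
  hasDerivAt_T : ∀ s, HasDerivAt T (k s * N s) s
  hasDerivAt_t : ∀ s, HasDerivAt t (k s * v s) s
  hasDerivAt_N : ∀ s, HasDerivAt N (-(k s * T s) - c * τ s * B s) s
  hasDerivAt_v : ∀ s, HasDerivAt v (-(k s * t s) - τ s * η s) s
  hasDerivAt_B : ∀ s, HasDerivAt B (τ s * N s) s
  hasDerivAt_η : ∀ s, HasDerivAt η (c * τ s * v s) s
  continuous_k : Continuous k
  continuous_τ : Continuous τ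
  periodic : ∀ s, T (s + L) = T s ∧ N (s + L) = N s ∧ B (s + L) = B s ∧ t (s + L) = t s ∧
    v (s + L) = v s ∧ η (s + L) = η s

theorem IsFrenetCurve.isFrontal_evolute {c L : ℝ} {T n g : ℝ → ℂ} {t u h κ κ' : ℝ → ℝ}
    (F : IsFrenetCurve c L T n g t u h κ κ') (hk : ∀ s, 0 < κ s ^ 2 + c) :
    IsFrontal c L T (fun s => evoluteTangent c (κ s) (n s) (g s))
      (fun s => evolutePoint c (κ s) (n s) (g s)) t
      (fun s => evoluteTangentHeight c (κ s) (u s) (h s))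
      (fun s => evoluteHeight c (κ s) (u s) (h s)) (fun s => spaceCurvature c (κ s))
      (fun s => evoluteSpeed c (κ s) (κ' s)) := by
  have hκc := F.continuous_curvature
  have hk0 : ∀ s, spaceCurvature c (κ s) ≠ 0 := fun s => (spaceCurvature_pos (hk s)).ne'
  have hkc : Continuous fun s => spaceCurvature c (κ s) := by
    unfold spaceCurvature
    fun_prop
  have hdk : ∀ s, HasDerivAt (fun s => spaceCurvature c (κ s))
      (κ s * κ' s / spaceCurvature c (κ s)) s := fun s => by
    have h1 := (((F.hasDerivAt_curvature s).pow 2).add_const c).sqrt (hk s).ne'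
    convert! h1 using 1
    have := hk0 s
    simp only [spaceCurvature] at this ⊢
    simp only [Pi.pow_apply, Nat.cast_ofNat, Nat.add_one_sub_one, pow_one]
    field_simp
  -- the generalized cosine and sine of the radius of curvature
  have hdp : ∀ s, HasDerivAt (fun s => κ s / spaceCurvature c (κ s))
      (-(c * evoluteSpeed c (κ s) (κ' s) * (1 / spaceCurvature c (κ s)))) s := fun s => by
    have h1 := (F.hasDerivAt_curvature s).div (hdk s) (hk0 s)
    convert! h1 using 1
    have := hk0 s
    have h2 := spaceCurvature_sq (hk s)
    simp only [evoluteSpeed]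
    field_simp
    rw [h2]
    ring
  have hdq : ∀ s, HasDerivAt (fun s => 1 / spaceCurvature c (κ s))
      (evoluteSpeed c (κ s) (κ' s) * (κ s / spaceCurvature c (κ s))) s := fun s => by
    have h1 := (hasDerivAt_const s (1 : ℝ)).div (hdk s) (hk0 s)
    convert! h1 using 1
    have := hk0 s
    simp only [evoluteSpeed]
    field_simp
    ring
  have hpq : ∀ s, κ s / spaceCurvature c (κ s) = 1 / spaceCurvature c (κ s) * κ s := fun s => by
    ring
  have hkp : ∀ s, spaceCurvature c (κ s) * (κ s / spaceCurvature c (κ s)) = κ s := fun s => by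
    have := hk0 s
    field_simp
  have hkq : ∀ s, spaceCurvature c (κ s) * (1 / spaceCurvature c (κ s)) = 1 := fun s => by
    have := hk0 s
    field_simp
  have hpk : ∀ s, κ s / spaceCurvature c (κ s) * κ s + c * (1 / spaceCurvature c (κ s)) =
      spaceCurvature c (κ s) := fun s => by
    have := hk0 s
    field_simp
    rw [spaceCurvature_sq (hk s)]
  refine ⟨fun s => ?_, fun s => ?_, fun s => ?_, fun s => ?_, fun s => ?_, fun s => ?_,
    fun s => ?_, hkc, ?_, fun s => ?_⟩
  · exact (F.isFrame s).rotate (evolute_coeff (hk s))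
  · convert! F.hasDerivAt_tangent s using 1
    have h1 := congrArg ofReal (hkp s)
    have h2 := congrArg ofReal (hkq s)
    simp only [ofReal_mul, ofReal_one] at h1 h2
    simp only [evoluteTangent]
    linear_combination n s * h1 - c * g s * h2
  · convert! F.hasDerivAt_tangent_height s using 1
    simp only [evoluteTangentHeight]
    linear_combination u s * hkp s - h s * hkq s
  · convert! ((hdp s).ofReal_comp.mul (F.hasDerivAt_normal s)).sub
      (((hdq s).ofReal_comp.const_mul (c : ℂ)).mul (F.hasDerivAt_point s)) using 1
    have h1 := congrArg ofReal (hpk s)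
    simp only [ofReal_mul, ofReal_add] at h1
    simp only [evolutePoint]
    push_cast
    push_cast at h1
    linear_combination T s * h1
  · convert! ((hdp s).mul (F.hasDerivAt_normal_height s)).sub
      ((hdq s).mul (F.hasDerivAt_height s)) using 1
    simp only [evoluteHeight]
    linear_combination t s * hpk s
  · convert! ((hdp s).ofReal_comp.mul (F.hasDerivAt_point s)).add
      ((hdq s).ofReal_comp.mul (F.hasDerivAt_normal s)) using 1
    have h1 := congrArg ofReal (hpq s)
    simp only [ofReal_mul] at h1
    simp only [evoluteTangent]
    push_cast
    push_cast at h1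
    linear_combination (-T s) * h1
  · convert! ((hdp s).mul (F.hasDerivAt_height s)).add
      (((hdq s).const_mul c).mul (F.hasDerivAt_normal_height s)) using 1
    simp only [evoluteTangentHeight]
    linear_combination (-c * t s) * hpq s
  · have := F.continuous_deriv_curvature
    unfold evoluteSpeed
    exact (this.div (hkc.pow 2) fun s => pow_ne_zero 2 (hk0 s)).neg
  · obtain ⟨h1, h2, h3, h4, h5⟩ := F.periodic s
    simp only [h1, h2, h3, h4, h5, F.periodic_normal s, F.periodic_normal_height s, and_self]

/-- Let `(T, N)` be a positively oriented basis. The linear map `(x, y) ↦ i (y T - x N)` is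
homotopic to the complex linear map `(x, y) ↦ (x + i y) T`: no value of the former is a nonpositive
multiple of the latter. -/
theorem combination_div_mem_slitPlane {T N : ℂ} (hTN : 0 < T.re * N.im - T.im * N.re) {x y : ℝ}
    (hxy : (x : ℂ) * N - y * T ≠ 0) :
    -(I * (x * N - y * T)) / ((x + y * I) * T) ∈ slitPlane := by
  have hT : T ≠ 0 := fun h => by simp [h] at hTN
  obtain ⟨w, rfl⟩ : ∃ w, N = w * T := ⟨N / T, by field_simp⟩
  have hw : 0 < w.im := by
    simp only [mul_im, mul_re] at hTN
    have h1 : 0 < w.im * (T.re ^ 2 + T.im ^ 2) := by linarith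
    exact pos_of_mul_pos_left h1 (by positivity)
  have hxy' : 0 < x ^ 2 + y ^ 2 := by
    by_contra! h
    have hx : x = 0 := by nlinarith [sq_nonneg x, sq_nonneg y]
    have hy : y = 0 := by nlinarith [sq_nonneg x, sq_nonneg y]
    simp [hx, hy] at hxy
  have hz : ((x : ℂ) + y * I) ≠ 0 := fun h => by
    have h1 := congrArg re h
    have h2 := congrArg im h
    simp at h1 h2
    simp [h1, h2] at hxy'
  have e : -(I * (x * (w * T) - y * T)) / ((x + y * I) * T) =
      ((x ^ 2 + y ^ 2)⁻¹ : ℝ) *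
        ((y ^ 2 - x * y * w.re + x ^ 2 * w.im : ℝ) + (x * (y - x * w.re - y * w.im) : ℝ) * I) := by
    rw [div_eq_iff (mul_ne_zero hz hT)]
    have h1 : ((x ^ 2 + y ^ 2 : ℝ) : ℂ) ≠ 0 := ofReal_ne_zero.2 hxy'.ne'
    rw [ofReal_inv]
    field_simp
    apply Complex.ext <;> simp [pow_two] <;> ring
  rw [e, mem_slitPlane_iff]
  simp only [add_re, ofReal_re, add_im, ofReal_im, mul_re, mul_im,
    I_re, I_im, mul_zero, zero_mul, mul_one, sub_zero, zero_add, add_zero]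
  rw [or_iff_not_imp_right, not_not, mul_eq_zero]
  intro h1
  refine mul_pos (inv_pos.2 hxy') ?_
  have h2 := h1.resolve_left (inv_ne_zero hxy'.ne')
  rcases mul_eq_zero.1 h2 with h3 | h3
  · rw [h3] at hxy' ⊢
    linarith
  · have h4 : y ^ 2 - x * y * w.re + x ^ 2 * w.im = (x ^ 2 + y ^ 2) * w.im := by
      linear_combination y * h3
    rw [h4]
    exact mul_pos hxy' hw

/-- A function with a periodic antiderivative takes both signs, unless it vanishes identically. -/
theorem exists_neg_pos_of_periodic {L : ℝ} (hL : 0 < L) {Q x : ℝ → ℝ}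
    (hQ : ∀ s, HasDerivAt Q (x s) s) (hQp : Function.Periodic Q L)
    (hxp : Function.Periodic x L) (hx : ∃ s, x s ≠ 0) :
    ∃ a b, a < b ∧ b < a + L ∧ x a < 0 ∧ 0 < x b := by
  have key : ∀ {Q x : ℝ → ℝ}, (∀ s, HasDerivAt Q (x s) s) → Function.Periodic Q L →
      (∀ s, 0 ≤ x s) → ∀ s, x s = 0 := fun {Q x} hQ hQp hx => by
    have hm : Monotone Q := monotone_of_deriv_nonneg (fun s => (hQ s).differentiableAt)
      fun s => by rw [(hQ s).deriv]; exact hx s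
    have hc : ∀ r, Q r = Q 0 := fun r => by
      have h1 : ∀ r s, Q r ≤ Q s := fun r s => by
        obtain ⟨N, hN⟩ := exists_nat_ge ((r - s) / L)
        rw [div_le_iff₀ hL] at hN
        have h2 := hm (show r ≤ s + N * L by linarith)
        rwa [hQp.nat_mul N s] at h2
      exact le_antisymm (h1 _ _) (h1 _ _)
    intro s
    have h1 := hQ s
    rw [show Q = fun _ => Q 0 from funext hc] at h1
    exact h1.unique (hasDerivAt_const s _)
  obtain ⟨s₀, hs₀⟩ := hx
  obtain ⟨a, ha⟩ : ∃ a, x a < 0 := by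
    by_contra! h
    exact hs₀ (key hQ hQp h s₀)
  obtain ⟨b, hb⟩ : ∃ b, 0 < x b := by
    by_contra! h
    exact hs₀ (neg_eq_zero.1 (key (fun s => (hQ s).neg)
      (fun s => by simp only [Pi.neg_apply, hQp s]) (fun s => neg_nonneg.2 (h s)) s₀))
  obtain ⟨y, hy, hxy⟩ := hxp.exists_mem_Ico hL b a
  rw [hxy] at hb
  refine ⟨a, y, lt_of_le_of_ne hy.1 ?_, hy.2, ha, hb⟩
  rintro rfl
  linarith

/-- For points `(z, h)`, `(w, k)` of `X²_c`, with `0 < h, k`, the difference of the central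
projections makes an acute angle with the difference of the orthogonal projections. -/
theorem central_inner_orthogonal_pos {c : ℝ} {z w : ℂ} {h k : ℝ} (hh : 0 < h) (hk : 0 < k)
    (hz : h ^ 2 + c * (z.re ^ 2 + z.im ^ 2) = 1) (hw : k ^ 2 + c * (w.re ^ 2 + w.im ^ 2) = 1)
    (hzw : z ≠ w) : 0 < ((z * k - w * h) * starRingEnd ℂ (z - w)).re := by
  have e : ((z * k - w * h) * starRingEnd ℂ (z - w)).re =
      ‖z‖ ^ 2 * k + ‖w‖ ^ 2 * h - (z.re * w.re + z.im * w.im) * (h + k) := by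
    rw [← normSq_eq_norm_sq, ← normSq_eq_norm_sq, normSq_apply, normSq_apply]
    simp
    ring
  have hz' : h ^ 2 + c * ‖z‖ ^ 2 = 1 := by
    rw [← normSq_eq_norm_sq, normSq_apply]; linarith
  have hw' : k ^ 2 + c * ‖w‖ ^ 2 = 1 := by
    rw [← normSq_eq_norm_sq, normSq_apply]; linarith
  have hcs : (z.re * w.re + z.im * w.im) ^ 2 + (z.re * w.im - z.im * w.re) ^ 2
      = (‖z‖ * ‖w‖) ^ 2 := by
    rw [mul_pow, ← normSq_eq_norm_sq, ← normSq_eq_norm_sq, normSq_apply, normSq_apply]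
    ring
  have hd : ‖z - w‖ ^ 2 = ‖z‖ ^ 2 + ‖w‖ ^ 2 - 2 * (z.re * w.re + z.im * w.im) := by
    rw [← normSq_eq_norm_sq, ← normSq_eq_norm_sq, ← normSq_eq_norm_sq, normSq_apply, normSq_apply,
      normSq_apply]
    simp
    ring
  have hd0 : 0 < ‖z - w‖ ^ 2 := pow_pos (norm_pos_iff.2 (sub_ne_zero.2 hzw)) 2
  have hle : z.re * w.re + z.im * w.im ≤ ‖z‖ * ‖w‖ :=
    (abs_le.1 (abs_le_of_sq_le_sq (by linarith [sq_nonneg (z.re * w.im - z.im * w.re)])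
      (by positivity))).2
  -- `r / h` is an increasing function of `r`, because `(r k - r' h) (r k + r' h) = r² - r'²`
  have hmono : 0 ≤ (‖z‖ - ‖w‖) * (‖z‖ * k - ‖w‖ * h) := by
    have h1 : (‖z‖ * k - ‖w‖ * h) * (‖z‖ * k + ‖w‖ * h) = (‖z‖ - ‖w‖) * (‖z‖ + ‖w‖) := by
      linear_combination ‖z‖ ^ 2 * hw' - ‖w‖ ^ 2 * hz'
    have hz0 := norm_nonneg z
    have hw0 := norm_nonneg w
    have hS : 0 ≤ ‖z‖ * k + ‖w‖ * h := by positivity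
    rcases hS.eq_or_lt with h2 | h2
    · have h3 : ‖z‖ * k = 0 := by linarith [mul_nonneg hz0 hk.le, mul_nonneg hw0 hh.le]
      have h4 : ‖w‖ * h = 0 := by linarith [mul_nonneg hz0 hk.le, mul_nonneg hw0 hh.le]
      simp [h3, h4]
    · refine nonneg_of_mul_nonneg_left (b := ‖z‖ * k + ‖w‖ * h) ?_ h2
      have : (‖z‖ - ‖w‖) * (‖z‖ * k - ‖w‖ * h) * (‖z‖ * k + ‖w‖ * h) =
          (‖z‖ - ‖w‖) ^ 2 * (‖z‖ + ‖w‖) := by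
        linear_combination (‖z‖ - ‖w‖) * h1
      rw [this]
      positivity
  rw [e]
  rcases hle.lt_or_eq with h1 | h1
  · linarith [mul_pos (sub_pos.2 h1) (add_pos hh hk)]
  · have h2 : 0 < (‖z‖ - ‖w‖) ^ 2 := by
      rw [h1] at hd
      linarith
    have h3 : ‖z‖ - ‖w‖ ≠ 0 := fun h => by simp [h] at h2
    rw [h1]
    refine lt_of_le_of_ne (by linarith) fun h4 => ?_
    have h5 : (‖z‖ - ‖w‖) * (‖z‖ * k - ‖w‖ * h) = 0 := by linarith
    have h6 := (mul_eq_zero.1 h5).resolve_left h3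
    have h7 : (‖z‖ - ‖w‖) * (‖z‖ + ‖w‖) = 0 := by
      linear_combination (‖z‖ * k + ‖w‖ * h) * h6 - ‖z‖ ^ 2 * hw' + ‖w‖ ^ 2 * hz'
    have h8 := (mul_eq_zero.1 h7).resolve_left h3
    have hz0 := norm_nonneg z
    have hw0 := norm_nonneg w
    exact h3 (by linarith)

end SpaceForm

/-! ### The winding numbers and the boundary integral of the evolute -/

namespace SpaceForm

open Complex Winding

/-- A closed curve in the projection of `X²_c` stays inside a smaller disc about the origin. -/
theorem exists_norm_lt {c L : ℝ} (hL : 0 < L) {B : ℝ → ℂ} {η : ℝ → ℝ} (hB : Continuous B)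
    (hBp : Function.Periodic B L) (hη : ∀ s, 0 < η s)
    (hBη : ∀ s, η s ^ 2 + c * ((B s).re ^ 2 + (B s).im ^ 2) = 1) :
    ∃ r, 0 < r ∧ (∀ s, ‖B s‖ < r) ∧ 0 < 1 - c * r ^ 2 := by
  obtain ⟨a, ha⟩ : ∃ a, ∀ s, ‖B s‖ ≤ ‖B a‖ := by
    obtain ⟨a, -, ha⟩ := isCompact_Icc.exists_isMaxOn (Set.nonempty_Icc.2 hL.le)
      (f := fun s => ‖B s‖) (by fun_prop)
    refine ⟨a, fun s => ?_⟩
    obtain ⟨y, hy, hys⟩ := hBp.exists_mem_Ico₀ hL s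
    rw [hys]
    exact ha ⟨hy.1, hy.2.le⟩
  set δ := η a ^ 2 / (2 * (|c| + 1)) with hδ
  have hc := abs_nonneg c
  have hδ0 : 0 < δ := div_pos (pow_pos (hη a) 2) (by positivity)
  have hcδ : c * δ ≤ η a ^ 2 / 2 := by
    have h1 : (|c| + 1) * δ = η a ^ 2 / 2 := by
      rw [hδ]
      field_simp
    nlinarith [le_abs_self c]
  have hr2 : √(‖B a‖ ^ 2 + δ) ^ 2 = ‖B a‖ ^ 2 + δ := Real.sq_sqrt (by positivity)
  have hpt : η a ^ 2 + c * ‖B a‖ ^ 2 = 1 := by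
    rw [← normSq_eq_norm_sq, normSq_apply]
    linarith [hBη a]
  refine ⟨√(‖B a‖ ^ 2 + δ), Real.sqrt_pos.2 (by positivity),
    fun s => (ha s).trans_lt (Real.lt_sqrt_of_sq_lt (by linarith)), ?_⟩
  rw [hr2]
  have := pow_pos (hη a) 2
  linarith

theorem hasWinding_sub_of_norm_lt {L : ℝ} {B : ℝ → ℂ} (hB : Continuous B)
    (hBp : Function.Periodic B L) {q : ℂ} (h : ∀ s, ‖B s‖ < ‖q‖) :
    HasWinding L (fun s => B s - q) 0 := by
  have h1 : -q ≠ 0 := neg_ne_zero.2 (norm_pos_iff.1 ((norm_nonneg _).trans_lt (h 0)))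
  refine (hasWinding_const h1).of_re_mul_conj_pos (by fun_prop)
    (fun s => by simp only [hBp s]) fun s => ?_
  have h2 : ((B s - q) * starRingEnd ℂ (-q)).re = ‖q‖ ^ 2 - (B s * starRingEnd ℂ q).re := by
    rw [← normSq_eq_norm_sq, normSq_apply]
    simp
    ring
  have h3 := (abs_le.1 (abs_re_le_norm (B s * starRingEnd ℂ q))).2
  rw [norm_mul, norm_conj] at h3
  rw [h2]
  nlinarith [h s, norm_nonneg (B s)]

namespace IsFrontal

variable {c L : ℝ} {T N B : ℝ → ℂ} {t v η k τ : ℝ → ℝ}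

theorem continuous_T (F : IsFrontal c L T N B t v η k τ) : Continuous T :=
  continuous_of_hasDerivAt F.hasDerivAt_T

theorem continuous_t (F : IsFrontal c L T N B t v η k τ) : Continuous t :=
  continuous_of_hasDerivAt F.hasDerivAt_t

theorem continuous_N (F : IsFrontal c L T N B t v η k τ) : Continuous N :=
  continuous_of_hasDerivAt F.hasDerivAt_N

theorem continuous_v (F : IsFrontal c L T N B t v η k τ) : Continuous v :=
  continuous_of_hasDerivAt F.hasDerivAt_v

theorem continuous_B (F : IsFrontal c L T N B t v η k τ) : Continuous B :=
  continuous_of_hasDerivAt F.hasDerivAt_B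

theorem continuous_η (F : IsFrontal c L T N B t v η k τ) : Continuous η :=
  continuous_of_hasDerivAt F.hasDerivAt_η

/-- The winding number of `B` about `q` is the sum of the winding number of `T` and of that of the
components of `(q, χ)` with respect to `T` and `N`. The latter is negative, because the component
with respect to `T` is increasing whenever it vanishes and the one with respect to `N` is positive,
and it does vanish, being the derivative of a periodic function. -/
theorem exists_winding_sub (F : IsFrontal c L T N B t v η k τ) (hL : 0 < L) (hk : ∀ s, 0 < k s)
    (hη : ∀ s, 0 < η s) {g : ℝ → ℂ} {A : ℝ → ℝ} (hg : ∀ s, HasDerivAt g (T s) s)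
    (hA : ∀ s, HasDerivAt A (t s) s) (hgp : Function.Periodic g L) (hAp : Function.Periodic A L)
    {m : ℤ} (hm : HasWinding L T m) {q : ℂ} {χ : ℝ} (hχ : 0 < χ)
    (hq : χ ^ 2 + c * (q.re ^ 2 + q.im ^ 2) = 1) (hBq : ∀ s, B s ≠ q) :
    ∃ w ≤ -1, HasWinding L (fun s => B s - q) (w + m) := by
  have := F.continuous_T
  have := F.continuous_t
  have := F.continuous_N
  have := F.continuous_v
  have := F.continuous_B
  have := F.continuous_η
  have hkc := F.continuous_k
  have hτc := F.continuous_τ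
  set x : ℝ → ℝ := fun s => (T s).re * q.re + (T s).im * q.im + t s * χ with hx
  set y : ℝ → ℝ := fun s => (N s).re * q.re + (N s).im * q.im + v s * χ with hy
  have hxp : Function.Periodic x L := fun s => by
    obtain ⟨h1, h2, h3, h4, h5, h6⟩ := F.periodic s
    simp only [hx, h1, h4]
  have hyp : Function.Periodic y L := fun s => by
    obtain ⟨h1, h2, h3, h4, h5, h6⟩ := F.periodic s
    simp only [hy, h2, h5]
  have hcomb : ∀ s, B s * χ - q * η s = I * (x s * N s - y s * T s) := fun s =>
    (F.isFrame s).central_projection q χ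
  have hacute : ∀ s, 0 < ((B s * χ - q * η s) * starRingEnd ℂ (B s - q)).re := fun s =>
    central_inner_orthogonal_pos (hη s) hχ (F.isFrame s).norm_point hq (hBq s)
  have hDne : ∀ s, I * (x s * N s - y s * T s) ≠ 0 := fun s h => by
    have := hacute s
    rw [hcomb, h] at this
    simp at this
  have hdx : ∀ s, HasDerivAt x (k s * y s) s := fun s => by
    have h1 := ((hasDerivAt_re (F.hasDerivAt_T s)).mul_const q.re).add
      ((hasDerivAt_im (F.hasDerivAt_T s)).mul_const q.im) |>.add
      ((F.hasDerivAt_t s).mul_const χ)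
    convert! h1 using 1
    simp only [hy, re_ofReal_mul, im_ofReal_mul]
    ring
  have hdy : ∀ s, HasDerivAt y ((-(k s * T s) - c * τ s * B s).re * q.re +
      (-(k s * T s) - c * τ s * B s).im * q.im + (-(k s * t s) - τ s * η s) * χ) s := fun s =>
    ((hasDerivAt_re (F.hasDerivAt_N s)).mul_const q.re).add
      ((hasDerivAt_im (F.hasDerivAt_N s)).mul_const q.im) |>.add
      ((F.hasDerivAt_v s).mul_const χ)
  have hxy : ∀ s, (x s : ℂ) + y s * I ≠ 0 := fun s h => by
    have h1 := congrArg re h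
    have h2 := congrArg im h
    simp at h1 h2
    exact hDne s (by simp [h1, h2])
  obtain ⟨w, hw⟩ := exists_hasWinding (f := fun s => (x s : ℂ) + y s * I) (L := L) (by fun_prop)
    hxy (fun s => by simp only [hxp s, hyp s])
  -- the central projection of `B`, seen from that of `q`
  have hD : HasWinding L (fun s => I * (x s * N s - y s * T s)) (w + m) := by
    have h1 : HasWinding L (fun s => -(I * (x s * N s - y s * T s))) (w + m) := by
      refine (hw.mul hm).of_div_mem_slitPlane (by fun_prop) (fun s => ?_) fun s =>
        combination_div_mem_slitPlane ?_ (right_ne_zero_of_mul (hDne s))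
      · obtain ⟨h1, h2, h3, h4, h5, h6⟩ := F.periodic s
        simp only [hxp s, hyp s, h1, h2]
      · rw [(F.isFrame s).cross_tangent_normal]
        exact hη s
    simpa using h1.const_mul (a := -1) (by norm_num)
  refine ⟨w, ?_, hD.of_re_mul_conj_pos (by fun_prop) (fun s => ?_) fun s => ?_⟩
  · obtain ⟨a, b, hab, hba, ha, hb⟩ := exists_neg_pos_of_periodic hL
      (Q := fun s => (g s).re * q.re + (g s).im * q.im + A s * χ) (x := x) (fun s =>
        ((hasDerivAt_re (hg s)).mul_const q.re).add ((hasDerivAt_im (hg s)).mul_const q.im) |>.add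
          ((hA s).mul_const χ)) (fun s => by simp only [hgp s, hAp s]) hxp (by
        by_contra! h
        have h1 := hdx 0
        rw [show x = fun _ => 0 from funext h] at h1
        have h2 := h1.unique (hasDerivAt_const 0 _)
        have h3 := (mul_eq_zero.1 h2).resolve_left (hk 0).ne'
        exact hxy 0 (by simp [h, h3]))
    refine (hw.const_mul I_ne_zero).le_neg_one (κ := k) (f' := fun s => I * ((k s * y s : ℝ) +
      ((-(k s * T s) - c * τ s * B s).re * q.re + (-(k s * T s) - c * τ s * B s).im * q.im +
        (-(k s * t s) - τ s * η s) * χ : ℝ) * I)) (fun s =>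
      ((hdx s).ofReal_comp.add ((hdy s).ofReal_comp.mul_const I)).const_mul I) (by fun_prop) hk
      (fun s => by simp) hab hba (by simpa using ha) (by simpa using hb)
  · simp only [(F.periodic s).2.2.1]
  · have h1 := hacute s
    rw [hcomb, ← conj_re, map_mul, Complex.conj_conj, mul_comm] at h1
    exact h1

/-- The tangent `T` has winding number one: about points far away the winding number of `B`
vanishes, so that the winding number of `T` is positive. -/
theorem hasWinding_one (F : IsFrontal c L T N B t v η k τ) (hL : 0 < L) (hk : ∀ s, 0 < k s)
    (hη : ∀ s, 0 < η s) {g : ℝ → ℂ} {A : ℝ → ℝ} (hg : ∀ s, HasDerivAt g (T s) s)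
    (hA : ∀ s, HasDerivAt A (t s) s) (hgp : Function.Periodic g L) (hAp : Function.Periodic A L)
    {m : ℤ} (hm : HasWinding L T m) (hm1 : |m| ≤ 1) : HasWinding L T 1 := by
  have hBc := F.continuous_B
  have hBp : Function.Periodic B L := fun s => (F.periodic s).2.2.1
  obtain ⟨r, hr0, hBr, hpos⟩ := exists_norm_lt hL hBc hBp hη fun s => (F.isFrame s).norm_point
  obtain ⟨w, hw, hwm⟩ := F.exists_winding_sub hL hk hη hg hA hgp hAp hm (q := (r : ℂ))
    (χ := √(1 - c * r ^ 2)) (Real.sqrt_pos.2 hpos)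
    (by rw [Real.sq_sqrt hpos.le]; simp) (fun s h => by
      have := hBr s
      rw [h] at this
      simp [abs_of_pos hr0] at this)
  have h0 : HasWinding L (fun s => B s - r) 0 := hasWinding_sub_of_norm_lt hBc hBp fun s => by
    simpa [abs_of_pos hr0] using hBr s
  have h1 := hwm.unique h0
  have h2 : m = 1 := by
    have := (abs_le.1 hm1).2
    omega
  exact h2 ▸ hm

/-- The winding numbers of `B` are nonpositive. -/
theorem exists_nonpos_winding (F : IsFrontal c L T N B t v η k τ) (hL : 0 < L)
    (hk : ∀ s, 0 < k s) (hη : ∀ s, 0 < η s) {g : ℝ → ℂ} {A : ℝ → ℝ}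
    (hg : ∀ s, HasDerivAt g (T s) s) (hA : ∀ s, HasDerivAt A (t s) s)
    (hgp : Function.Periodic g L) (hAp : Function.Periodic A L) (hm : HasWinding L T 1) {q : ℂ}
    (hq : 0 < 1 - c * (q.re ^ 2 + q.im ^ 2)) (hBq : ∀ s, B s ≠ q) :
    ∃ w ≤ 0, HasWinding L (fun s => B s - q) w := by
  obtain ⟨w, hw, h⟩ := F.exists_winding_sub hL hk hη hg hA hgp hAp hm (q := q)
    (χ := √(1 - c * (q.re ^ 2 + q.im ^ 2))) (Real.sqrt_pos.2 hq)
    (by rw [Real.sq_sqrt hq.le]; simp) hBq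
  exact ⟨w + 1, by omega, h⟩

/-- The Gauss–Bonnet formula for `B`: the total rotation of the frame `(T, N)` along `B` is
`2 π`. The frame is compared with the constant one by stereographic projection. -/
theorem integral_add_eq_two_pi (F : IsFrontal c L T N B t v η k τ) (hη : ∀ s, 0 < η s)
    (hm : HasWinding L T 1) :
    c * (∫ s in (0 : ℝ)..L, (starRingEnd ℂ (B s) * (τ s * N s)).im / (1 + η s)) =
      2 * Real.pi - ∫ s in (0 : ℝ)..L, k s := by
  have := F.continuous_T
  have := F.continuous_t
  have := F.continuous_N
  have hBc := F.continuous_B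
  have := F.continuous_η
  have hkc := F.continuous_k
  have hτc := F.continuous_τ
  have hη1 : ∀ s, 1 + η s ≠ 0 := fun s => by linarith [hη s]
  set Z : ℝ → ℂ := fun s => T s - I * N s with hZ
  have hZn : ∀ s, normSq (Z s) = (1 + η s) ^ 2 := fun s =>
    (F.isFrame s).normSq_tangent_sub_normal
  have hZ0 : ∀ s, Z s ≠ 0 := fun s h => by
    have := hZn s
    rw [h, map_zero] at this
    exact pow_ne_zero 2 (hη1 s) this.symm
  have hZw : HasWinding L Z 1 := by
    refine hm.of_re_mul_conj_pos (by fun_prop) (fun s => ?_) fun s => ?_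
    · obtain ⟨h1, h2, -⟩ := F.periodic s
      simp only [hZ, h1, h2]
    · have h1 := (F.isFrame s).cross_tangent_normal
      have h2 := hη s
      simp [hZ]
      nlinarith [sq_nonneg (T s).re, sq_nonneg (T s).im]
  have hdZ : ∀ s, HasDerivAt Z (I * k s * Z s + I * c * τ s * B s) s := fun s => by
    convert! (F.hasDerivAt_T s).sub ((F.hasDerivAt_N s).const_mul I) using 1
    simp only [hZ]
    linear_combination (-(k s * N s)) * I_sq
  have hint := hZw.integral_eq hdZ (by fun_prop)
  have hq : ∀ s, (I * k s * Z s + I * c * τ s * B s) / Z s = I * (k s + c * τ s * (B s / Z s)) :=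
    fun s => by
      have := hZ0 s
      field_simp
  have hre : ∀ s, (B s / Z s).re = -t s / (1 + η s) := fun s => by
    have h1 := (F.isFrame s).re_point_mul_conj
    have h2 : B s / Z s = ((normSq (Z s))⁻¹ : ℝ) * (B s * starRingEnd ℂ (Z s)) := by
      rw [div_eq_mul_inv, inv_def]
      push_cast
      ring
    rw [h2, re_ofReal_mul, hZn]
    simp only [hZ, h1]
    have := hη1 s
    field_simp
  have hBZ : Continuous fun s => B s / Z s := hBc.div (by fun_prop) hZ0
  have him : ∀ s, (I * ((k s : ℂ) + c * τ s * (B s / Z s))).im =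
      k s + c * ((starRingEnd ℂ (B s) * (τ s * N s)).im / (1 + η s)) := fun s => by
    have h1 := (F.isFrame s).cross_normal_point
    rw [I_mul_im, add_re, ofReal_re, ← ofReal_mul, re_ofReal_mul, hre, ← h1]
    have := hη1 s
    field_simp
    simp
    ring
  simp only [hq] at hint
  have h1 : (∫ s in (0 : ℝ)..L, (I * ((k s : ℂ) + c * τ s * (B s / Z s)))).im =
      ∫ s in (0 : ℝ)..L, (I * ((k s : ℂ) + c * τ s * (B s / Z s))).im :=
    (imCLM.intervalIntegral_comp_comm (Continuous.intervalIntegrable (by fun_prop) _ _)).symm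
  rw [hint] at h1
  simp only [him] at h1
  rw [intervalIntegral.integral_add (hkc.intervalIntegrable _ _),
    intervalIntegral.integral_const_mul]
    at h1
  · have h2 : (2 * (Real.pi : ℂ) * I * (1 : ℤ)).im = 2 * Real.pi := by simp
    rw [h2] at h1
    linarith
  · refine Continuous.intervalIntegrable (continuous_const.mul (Continuous.div ?_ ?_ hη1)) _ _
    · fun_prop
    · fun_prop

end IsFrontal

end SpaceForm

namespace SpaceForm

open Complex Winding

namespace IsFrenetCurve

variable {c L : ℝ} {T n g : ℝ → ℂ} {t u h κ κ' : ℝ → ℝ}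

/-- The winding numbers and the boundary integral of the evolute of a simple closed curve with
positive curvature. -/
theorem evolute_winding_and_integral (F : IsFrenetCurve c L T n g t u h κ κ') (hL : 0 < L)
    (hi : Set.InjOn g (Set.Ico 0 L)) (hk : ∀ s, 0 < κ s ^ 2 + c)
    (hh : ∀ s, 0 < h s) (hη : ∀ s, 0 < evoluteHeight c (κ s) (u s) (h s)) :
    (∀ q : ℂ, 0 < 1 - c * (q.re ^ 2 + q.im ^ 2) →
      (∀ s, evolutePoint c (κ s) (n s) (g s) ≠ q) →
      ∃ w ≤ 0, HasWinding L (fun s => evolutePoint c (κ s) (n s) (g s) - q) w) ∧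
    c * (∫ s in (0 : ℝ)..L, (starRingEnd ℂ (evolutePoint c (κ s) (n s) (g s)) *
      (evoluteSpeed c (κ s) (κ' s) * evoluteTangent c (κ s) (n s) (g s))).im /
        (1 + evoluteHeight c (κ s) (u s) (h s))) =
      2 * Real.pi - ∫ s in (0 : ℝ)..L, spaceCurvature c (κ s) := by
  have E := F.isFrontal_evolute hk
  have hh1 : ∀ s, 1 + h s ≠ 0 := fun s => by linarith [hh s]
  -- a periodic antiderivative of `t`; it is `(h - 1) / c` for `c ≠ 0`
  have hA : ∀ s, HasDerivAt (fun s => -(((g s).re * (g s).re + (g s).im * (g s).im) / (1 + h s)))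
      (t s) s := fun s => by
    have h1 := hasDerivAt_re (F.hasDerivAt_point s)
    have h2 := hasDerivAt_im (F.hasDerivAt_point s)
    convert! (((h1.mul h1).add (h2.mul h2)).div ((F.hasDerivAt_height s).const_add 1)
      (hh1 s)).neg using 1
    have h3 := (F.isFrame s).norm_point
    have h4 := (F.isFrame s).inner_eq_zero
    have := hh1 s
    simp only [Pi.add_apply, Pi.mul_apply]
    field_simp
    linear_combination (-t s) * h3 + 2 * (1 + h s) * h4
  have hAp : Function.Periodic
      (fun s => -(((g s).re * (g s).re + (g s).im * (g s).im) / (1 + h s))) L := fun s => by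
    obtain ⟨h1, h2, h3, h4, -⟩ := F.periodic s
    simp only [h2, h4]
  have hgp : Function.Periodic g L := fun s => (F.periodic s).2.1
  have hT0 : ∀ s, T s ≠ 0 := fun s h0 => by
    have h1 := (F.isFrame s).cross_tangent_normal
    have h2 := hh s
    simp [h0] at h1
    linarith
  obtain ⟨m, hm⟩ := exists_hasWinding (L := L) F.continuous_tangent hT0
    (fun s => (F.periodic s).1)
  have hm1 := abs_winding_deriv_le_one hL F.hasDerivAt_point F.continuous_tangent hgp hi hm
  have hk0 : ∀ s, 0 < spaceCurvature c (κ s) := fun s => spaceCurvature_pos (hk s)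
  have h1 := E.hasWinding_one hL hk0 hη F.hasDerivAt_point hA hgp hAp hm hm1
  exact ⟨fun q hq hBq => E.exists_nonpos_winding hL hk0 hη F.hasDerivAt_point hA hgp hAp h1 hq hBq,
    E.integral_add_eq_two_pi hη h1⟩

/-- On the sphere, let `g ≠ 0`, so that the curve avoids the poles of the two stereographic
projections `g / (1 ± h)`. Their rotation numbers differ by twice the winding number of `t + i u`;
since both are at most one in absolute value, this winding number is at least `-1`, and `u` changes
sign only twice. -/
theorem not_four_sign_changes (F : IsFrenetCurve c L T n g t u h κ κ') (hc : 0 < c) (hL : 0 < L)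
    (hi : Set.InjOn (fun s => (g s, h s)) (Set.Ico 0 L)) (hκ : ∀ s, 0 < κ s) (hg : ∀ s, g s ≠ 0)
    {s₀ s₁ s₂ s₃ : ℝ} (h01 : s₀ < s₁) (h12 : s₁ < s₂) (h23 : s₂ < s₃) (h30 : s₃ < s₀ + L)
    (hu0 : u s₀ < 0) (hu1 : 0 < u s₁) (hu2 : u s₂ < 0) (hu3 : 0 < u s₃) : False := by
  have hTc := F.continuous_tangent
  have hnc := F.continuous_normal
  have htc := F.continuous_tangent_height
  have huc := F.continuous_normal_height
  have hgc := F.continuous_point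
  have hhc := F.continuous_height
  have hκc := F.continuous_curvature
  have hgp : Function.Periodic g L := fun s => (F.periodic s).2.1
  have hhp : Function.Periodic h L := fun s => (F.periodic s).2.2.2.1
  have hh : ∀ s, -1 < h s ∧ h s < 1 := fun s => by
    have h1 := (F.isFrame s).norm_point
    have h2 := normSq_pos.2 (hg s)
    rw [normSq_apply] at h2
    exact abs_lt.1 ((sq_lt_one_iff_abs_lt_one _).1 (by nlinarith))
  -- the rotation number of the stereographic projection from the pole with `h = - σ`
  have key : ∀ σ : ℝ, σ ^ 2 = 1 → ∀ m, HasWinding L (fun s => T s - σ * I * n s) m → |m| ≤ 1 := by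
    intro σ hσ m hm
    have hd0 : ∀ s, 0 < 1 + σ * h s := fun s => by
      rcases sq_eq_sq_iff_eq_or_eq_neg.1 (hσ.trans (one_pow 2).symm) with rfl | rfl <;>
        linarith [hh s]
    have hd0' : ∀ s, ((1 + σ * h s : ℝ) : ℂ) ≠ 0 := fun s => ofReal_ne_zero.2 (hd0 s).ne'
    set σg : ℝ → ℂ := fun s => g s / (1 + σ * h s : ℝ) with hσg
    have hd : ∀ s, HasDerivAt σg ((T s - σ * I * n s) / (1 + σ * h s : ℝ) ^ 2) s := fun s => by
      convert! (F.hasDerivAt_point s).div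
        (((F.hasDerivAt_height s).const_mul σ).const_add 1).ofReal_comp (hd0' s) using 1
      congr 1
      rw [(F.isFrame s).normal_eq]
      push_cast
      linear_combination (-σ * (h s * T s - c * t s * g s)) * I_sq
    have hcont : Continuous fun s => (T s - σ * I * n s) / (1 + σ * h s : ℝ) ^ 2 :=
      Continuous.div (by fun_prop) (by fun_prop) fun s => pow_ne_zero 2 (hd0' s)
    refine abs_winding_deriv_le_one hL hd hcont (fun s => by simp only [hσg, hgp s, hhp s])
      (fun a ha b hb hab => hi ha hb ?_) (hm.of_re_mul_conj_pos hcont (fun s => ?_) fun s => ?_)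
    · have h1 : g a * (1 + σ * h b : ℝ) = g b * (1 + σ * h a : ℝ) := by
        have := hd0' a
        have := hd0' b
        simp only [hσg] at hab
        field_simp at hab
        linear_combination hab
      have h2 := congrArg normSq h1
      rw [map_mul, map_mul, normSq_ofReal, normSq_ofReal] at h2
      have ha1 := (F.isFrame a).norm_point
      have hb1 := (F.isFrame b).norm_point
      rw [normSq_apply, normSq_apply] at h2
      have h3 : (1 + σ * h a) * (1 + σ * h b) * (2 * σ * (h b - h a)) = 0 := by
        linear_combination c * h2 - (1 + σ * h b) ^ 2 * ha1 + (1 + σ * h a) ^ 2 * hb1 +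
          (h b ^ 2 - h a ^ 2 - 2 * σ * h a * h b * (h a - h b)) * hσ
      have hσ0 : σ ≠ 0 := fun h => by simp [h] at hσ
      have h4 : h b - h a = 0 := by
        have := (mul_eq_zero.1 h3).resolve_left (mul_pos (hd0 a) (hd0 b)).ne'
        exact (mul_eq_zero.1 this).resolve_left (mul_ne_zero two_ne_zero hσ0)
      have h5 : h b = h a := by linarith
      rw [h5] at h1
      exact Prod.ext (mul_right_cancel₀ (hd0' a) h1) h5.symm
    · obtain ⟨h1, h2, h3, h4, -⟩ := F.periodic s
      simp only [h1, h4, F.periodic_normal s]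
    · have h1 : (T s - σ * I * n s) / (1 + σ * h s : ℝ) ^ 2 * starRingEnd ℂ (T s - σ * I * n s) =
          (normSq (T s - σ * I * n s) / (1 + σ * h s) ^ 2 : ℝ) := by
        rw [div_mul_eq_mul_div, mul_conj]
        push_cast
        ring
      rw [h1, ofReal_re]
      exact div_pos (normSq_pos.2 (hm.ne_zero s)) (pow_pos (hd0 s) 2)
  have e1 : ∀ s, (t s + u s * I) * (T s - I * n s) = -((1 + h s) * g s) := fun s =>
    (F.isFrame s).mul_tangent_sub_normal
  have e2 : ∀ s, (t s - u s * I) * (T s + I * n s) = (1 - h s) * g s := fun s =>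
    (F.isFrame s).mul_tangent_add_normal
  have hn1 : ∀ s, -((1 + h s : ℂ) * g s) ≠ 0 := fun s => by
    refine neg_ne_zero.2 (mul_ne_zero ?_ (hg s))
    rw [← ofReal_one, ← ofReal_add]
    exact ofReal_ne_zero.2 (by linarith [hh s])
  have hn2 : ∀ s, (1 - h s : ℂ) * g s ≠ 0 := fun s => by
    refine mul_ne_zero ?_ (hg s)
    rw [← ofReal_one, ← ofReal_sub]
    exact ofReal_ne_zero.2 (by linarith [hh s])
  have htp : Function.Periodic t L := fun s => (F.periodic s).2.2.1
  have hTp : Function.Periodic T L := fun s => (F.periodic s).1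
  have hnp := F.periodic_normal
  have hup := F.periodic_normal_height
  obtain ⟨w, hw⟩ := exists_hasWinding (L := L) (f := fun s => (t s : ℂ) + u s * I) (by fun_prop)
    (fun s => left_ne_zero_of_mul (e1 s ▸ hn1 s)) (fun s => by simp only [htp s, hup s])
  obtain ⟨m₁, hm₁⟩ := exists_hasWinding (L := L) (f := fun s => T s - I * n s) (by fun_prop)
    (fun s => right_ne_zero_of_mul (e1 s ▸ hn1 s)) (fun s => by simp only [hTp s, hnp s])
  obtain ⟨m₂, hm₂⟩ := exists_hasWinding (L := L) (f := fun s => T s + I * n s) (by fun_prop)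
    (fun s => right_ne_zero_of_mul (e2 s ▸ hn2 s)) (fun s => by simp only [hTp s, hnp s])
  obtain ⟨m, hm⟩ := exists_hasWinding (L := L) hgc hg hgp
  have hb1 := key 1 (by norm_num) m₁ (by simpa using hm₁)
  have hb2 := key (-1) (by norm_num) m₂ (by simpa using hm₂)
  have q1 : w + m₁ = m := by
    refine ((hw.mul hm₁).const_mul (a := -1) (by norm_num)).unique
      (hm.of_re_mul_conj_pos (by fun_prop) (fun s => ?_) fun s => ?_)
    · simp only [hTp s, hnp s, htp s, hup s]
    · rw [e1, show -1 * -((1 + h s : ℂ) * g s) * starRingEnd ℂ (g s) =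
        ((1 + h s) * normSq (g s) : ℝ) by
          push_cast; linear_combination (1 + h s : ℂ) * mul_conj (g s), ofReal_re]
      exact mul_pos (by linarith [hh s]) (normSq_pos.2 (hg s))
  have q2 : -w + m₂ = m := by
    refine (hw.conj.mul hm₂).unique (hm.of_re_mul_conj_pos (by fun_prop) (fun s => ?_) fun s => ?_)
    · simp only [hTp s, hnp s, htp s, hup s]
    · rw [show starRingEnd ℂ ((t s : ℂ) + u s * I) = t s - u s * I by simp [sub_eq_add_neg], e2,
        show (1 - h s : ℂ) * g s * starRingEnd ℂ (g s) = ((1 - h s) * normSq (g s) : ℝ) by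
          push_cast; linear_combination (1 - h s : ℂ) * mul_conj (g s), ofReal_re]
      exact mul_pos (by linarith [hh s]) (normSq_pos.2 (hg s))
  have hw2 : w ≤ -2 := by
    refine hw.le_neg_two (κ := κ) (f' := fun s => ((-h s + κ s * u s : ℝ) : ℂ) +
      (-(κ s * t s) : ℝ) * I) (fun s => (F.hasDerivAt_tangent_height s).ofReal_comp.add
      ((F.hasDerivAt_normal_height s).ofReal_comp.mul_const I)) (by fun_prop) hκ
      (fun s => by simp) h01 h12 h23 h30 (by simpa using hu0) (by simpa using hu1)
      (by simpa using hu2) (by simpa using hu3)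
  have := abs_le.1 hb1
  have := abs_le.1 hb2
  omega

end IsFrenetCurve

end SpaceForm

/-! ### The area enclosed by a plane curve with a radial density -/

namespace Winding

open Complex MeasureTheory

theorem integral_eq_integral_circleAverage {F : ℂ → ℂ} (hF : Integrable F) :
    ∫ z, F z = ∫ r in Set.Ioi (0 : ℝ), (2 * Real.pi * r) • Real.circleAverage F 0 r := by
  have hmeas : MeasurableSet polarCoord.target := polarCoord.open_target.measurableSet
  have hsymm : ∀ p : ℝ × ℝ, Complex.polarCoord.symm p = circleMap 0 p.1 p.2 := fun p => by
    rw [Complex.polarCoord_symm_apply, circleMap_zero, exp_mul_I]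
    push_cast
    ring
  have hm2 : Measurable fun p : ℝ × ℝ => Complex.polarCoord.symm p := by
    simp only [hsymm, circleMap]
    fun_prop
  have hint : IntegrableOn (fun p : ℝ × ℝ => p.1 • F (Complex.polarCoord.symm p))
      polarCoord.target := by
    -- the polar coordinates preserve null sets and the integral of the norm
    have hG := hF.1.stronglyMeasurable_mk
    have hae : (fun p : ℝ × ℝ => p.1 • F (Complex.polarCoord.symm p)) =ᵐ[volume.restrict
        polarCoord.target] fun p => p.1 • hF.1.mk F (Complex.polarCoord.symm p) := by
      obtain ⟨N, hNm, hN0, hN⟩ : ∃ N : Set ℂ, MeasurableSet N ∧ volume N = 0 ∧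
          ∀ z ∉ N, F z = hF.1.mk F z := by
        obtain ⟨N, h1, h2, h3⟩ := exists_measurable_superset_of_null (ae_iff.1 hF.1.ae_eq_mk)
        exact ⟨N, h2, h3, fun z hz => by
          by_contra h
          exact hz (h1 h)⟩
      have h4 : ∫⁻ z, N.indicator (fun _ => (1 : ENNReal)) z = 0 := by
        rw [lintegral_indicator hNm]
        simp [hN0]
      have h5 : Measurable fun p : ℝ × ℝ => ENNReal.ofReal p.1 •
          N.indicator (fun _ => (1 : ENNReal)) (Complex.polarCoord.symm p) :=
        (ENNReal.measurable_ofReal.comp measurable_fst).smul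
          ((measurable_const.indicator hNm).comp hm2)
      rw [← Complex.lintegral_comp_polarCoord_symm, lintegral_eq_zero_iff h5] at h4
      filter_upwards [h4, ae_restrict_mem hmeas] with p hp hpt
      have hp1 : 0 < p.1 := hpt.1
      simp only [smul_eq_mul, Pi.zero_apply, mul_eq_zero, ENNReal.ofReal_eq_zero,
        not_le.2 hp1, false_or, Set.indicator_apply_eq_zero, one_ne_zero, imp_false] at hp
      rw [hN _ hp]
    refine ⟨⟨_, (measurable_fst.stronglyMeasurable).smul (hG.comp_measurable hm2), hae⟩, ?_⟩
    have h1 := hF.2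
    rw [HasFiniteIntegral, ← Complex.lintegral_comp_polarCoord_symm] at h1
    rw [HasFiniteIntegral]
    refine lt_of_le_of_lt (le_of_eq ?_) h1
    refine setLIntegral_congr_fun hmeas fun p hp => ?_
    simp only [smul_eq_mul, enorm_smul]
    rw [Real.enorm_of_nonneg (le_of_lt hp.1)]
  rw [← Complex.integral_comp_polarCoord_symm]
  rw [IntegrableOn] at hint
  simp only [polarCoord_target, Measure.volume_eq_prod] at hint ⊢
  rw [setIntegral_prod _ hint]
  refine setIntegral_congr_fun measurableSet_Ioi fun r hr => ?_
  simp only [hsymm]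
  rw [integral_smul, Real.circleAverage, smul_smul, ← integral_Ioc_eq_integral_Ioo,
    ← intervalIntegral.integral_of_le (by linarith [Real.pi_pos])]
  have hper : Function.Periodic (fun θ => F (circleMap 0 r θ)) (2 * Real.pi) := fun θ => by
    simp only [periodic_circleMap 0 r θ]
  have h1 := hper.intervalIntegral_add_eq (-Real.pi) 0
  rw [show -Real.pi + 2 * Real.pi = Real.pi by ring, zero_add] at h1
  rw [h1]
  congr 1
  have := Real.pi_pos
  field_simp

theorem circleAverage_inv_sub_of_lt {a : ℂ} {r : ℝ} (hr : 0 ≤ r) (h : r < ‖a‖) :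
    Real.circleAverage (fun z => (a - z)⁻¹) 0 r = a⁻¹ := by
  have hd : DifferentiableOn ℂ (fun z => (a - z)⁻¹) (Metric.ball 0 ‖a‖) := fun z hz => by
    have hz0 : a - z ≠ 0 := fun h0 => by
      rw [sub_eq_zero] at h0
      simp [h0] at hz
    exact ((differentiableAt_const a).sub differentiableAt_id).inv hz0 |>.differentiableWithinAt
  have h1 : DiffContOnCl ℂ (fun z => (a - z)⁻¹) (Metric.ball 0 |r|) := by
    refine (hd.mono ?_).diffContOnCl
    rw [abs_of_nonneg hr]
    exact Metric.closure_ball_subset_closedBall.trans (Metric.closedBall_subset_ball h)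
  simpa using h1.circleAverage

theorem circleAverage_inv_sub_of_gt {a : ℂ} {r : ℝ} (h : ‖a‖ < r) :
    Real.circleAverage (fun z => (a - z)⁻¹) 0 r = 0 := by
  have hr : 0 < r := (norm_nonneg a).trans_lt h
  rw [Real.circleAverage_eq_circleAverage_zero_one,
    ← Real.circleAverage_zero_one_congr_inv (E := ℂ)]
  have hne : ∀ z : ℂ, ‖z‖ ≤ 1 → a * z - r ≠ 0 := fun z hz h0 => by
    rw [sub_eq_zero] at h0
    have h1 := congrArg norm h0
    rw [norm_mul, norm_real, Real.norm_of_nonneg hr.le] at h1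
    nlinarith [norm_nonneg a, norm_nonneg z]
  have hd : DiffContOnCl ℂ (fun z => z / (a * z - r)) (Metric.ball 0 |1|) := by
    refine DifferentiableOn.diffContOnCl fun z hz => ?_
    have hz1 : ‖z‖ ≤ 1 := by
      simpa using Metric.closure_ball_subset_closedBall hz
    exact (differentiableAt_id.div
      (((differentiableAt_const a).mul differentiableAt_id).sub_const _)
      (hne z hz1)).differentiableWithinAt
  have h2 := hd.circleAverage
  simp only [zero_div] at h2
  refine Eq.trans ?_ h2
  refine Real.circleAverage_congr_sphere fun z hz => ?_
  have hz1 : ‖z‖ = 1 := by simpa using hz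
  have hz0 : z ≠ 0 := fun h0 => by simp [h0] at hz1
  have := hne z hz1.le
  have h3 : a - (r * z⁻¹ + 0) = (a * z - r) / z := by
    field_simp
    ring
  simp only [h3, inv_div]

theorem integrable_indicator_norm_inv (R : ℝ) :
    Integrable fun z : ℂ => Set.indicator (Set.Iio R) (fun r : ℝ => r⁻¹) ‖z‖ := by
  refine (integrable_fun_norm_addHaar (E := ℂ) volume
    (f := Set.indicator (Set.Iio R) fun r : ℝ => r⁻¹)).2 ?_
  have h1 : IntegrableOn (Set.indicator (Set.Iio R) fun _ => (1 : ℝ)) (Set.Ioi 0) := by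
    rw [integrableOn_indicator_iff measurableSet_Iio]
    refine (integrableOn_const (C := (1 : ℝ)) (s := Set.Ioo 0 R) (μ := volume)
      (by simp)).mono_set ?_
    intro x hx
    exact ⟨hx.2, hx.1⟩
  refine h1.congr_fun (fun x hx => ?_) measurableSet_Ioi
  have hx0 : x ≠ 0 := ne_of_gt hx
  by_cases hxR : x ∈ Set.Iio R
  · simp [Set.indicator_of_mem hxR, finrank_real_complex, hx0]
  · simp [Set.indicator_of_notMem hxR]

/-- The density of the area of `X²_c` in the coordinates given by the orthogonal projection. -/
noncomputable def density (c r : ℝ) : ℝ := 1 / √(1 - c * r ^ 2)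

theorem measurable_density (c : ℝ) : Measurable (density c) := by
  unfold density
  fun_prop

theorem one_sub_mul_sq_ge {c R r : ℝ} (hr : 0 ≤ r) (hrR : r ≤ R) :
    min 1 (1 - c * R ^ 2) ≤ 1 - c * r ^ 2 := by
  have h1 : r ^ 2 ≤ R ^ 2 := pow_le_pow_left₀ hr hrR 2
  rcases le_total 0 c with hc | hc
  · exact (min_le_right _ _).trans (by nlinarith)
  · exact (min_le_left _ _).trans (by nlinarith [sq_nonneg r])

theorem one_sub_mul_sq_pos {c R r : ℝ} (hR : 0 < 1 - c * R ^ 2) (hr : 0 ≤ r) (hrR : r ≤ R) :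
    0 < 1 - c * r ^ 2 :=
  (lt_min one_pos hR).trans_le (one_sub_mul_sq_ge hr hrR)

theorem density_nonneg (c r : ℝ) : 0 ≤ density c r := div_nonneg zero_le_one (Real.sqrt_nonneg _)

theorem density_le {c R r : ℝ} (hR : 0 < 1 - c * R ^ 2) (hr : 0 ≤ r) (hrR : r ≤ R) :
    density c r ≤ 1 / √(min 1 (1 - c * R ^ 2)) :=
  one_div_le_one_div_of_le (Real.sqrt_pos.2 (lt_min one_pos hR))
    (Real.sqrt_le_sqrt (one_sub_mul_sq_ge hr hrR))

/-- The area of the disc of radius `ρ` with respect to the density, up to the factor `2 π`. -/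
theorem integral_mul_density {c ρ : ℝ} (hρ : 0 ≤ ρ) (h : 0 < 1 - c * ρ ^ 2) :
    ∫ r in (0 : ℝ)..ρ, r * density c r = ρ ^ 2 / (1 + √(1 - c * ρ ^ 2)) := by
  have hpos : ∀ r ∈ Set.uIcc 0 ρ, 0 < 1 - c * r ^ 2 := fun r hr => by
    rw [Set.uIcc_of_le hρ] at hr
    exact one_sub_mul_sq_pos h hr.1 hr.2
  have hd : ∀ r ∈ Set.uIcc 0 ρ, HasDerivAt (fun r => r ^ 2 / (1 + √(1 - c * r ^ 2)))
      (r * density c r) r := fun r hr => by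
    have h0 := hpos r hr
    have h1 := Real.sqrt_pos.2 h0
    have h2 := Real.sq_sqrt h0.le
    convert! ((hasDerivAt_id r).pow 2).div
      ((((((hasDerivAt_id r).pow 2).const_mul c).const_sub 1).sqrt h0.ne').const_add 1)
      (by positivity) using 1
    simp only [density, Pi.pow_apply, id_eq]
    set w := √(1 - c * r ^ 2)
    have hcr : c * r ^ 2 = 1 - w ^ 2 := by linarith
    field_simp
    push_cast
    linear_combination (-2 * r) * hcr
  rw [intervalIntegral.integral_eq_sub_of_hasDerivAt hd]
  · simp
  · refine ContinuousOn.intervalIntegrable fun r hr => ?_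
    have h1 := (Real.sqrt_pos.2 (hpos r hr)).ne'
    refine ContinuousAt.continuousWithinAt (ContinuousAt.mul continuousAt_id ?_)
    exact ContinuousAt.div (by fun_prop) (by fun_prop) h1

theorem integrable_cauchyKernel_mul_density {c R : ℝ} (hR : 0 < 1 - c * R ^ 2) {a : ℂ}
    (ha : ‖a‖ < R) :
    Integrable fun z : ℂ => Set.indicator (Set.Iio R) (density c) ‖z‖ * (a - z)⁻¹ := by
  have h1 : Integrable fun z : ℂ => Set.indicator (Set.Iio (2 * R)) (fun r : ℝ => r⁻¹) ‖a - z‖ :=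
    (integrable_indicator_norm_inv (2 * R)).comp_sub_left a
  have hm := measurable_density c
  refine (h1.const_mul (1 / √(min 1 (1 - c * R ^ 2)))).mono' (Measurable.aestronglyMeasurable ?_)
    (Filter.Eventually.of_forall fun z => ?_)
  · exact (measurable_ofReal.comp ((hm.indicator measurableSet_Iio).comp measurable_norm)).mul
      (measurable_const.sub measurable_id).inv
  by_cases hz : ‖z‖ ∈ Set.Iio R
  · have hz2 : ‖a - z‖ ∈ Set.Iio (2 * R) := by
      have h2 := norm_sub_le a z
      have h3 : ‖z‖ < R := hz
      exact Set.mem_Iio.2 (by linarith)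
    rw [Set.indicator_of_mem hz, Set.indicator_of_mem hz2, norm_mul, norm_real, norm_inv,
      Real.norm_of_nonneg (density_nonneg _ _)]
    exact mul_le_mul_of_nonneg_right (density_le hR (norm_nonneg z) (le_of_lt hz))
      (inv_nonneg.2 (norm_nonneg _))
  · rw [Set.indicator_of_notMem hz]
    simp only [ofReal_zero, zero_mul, norm_zero]
    exact mul_nonneg (by positivity) (Set.indicator_nonneg
      (fun r hr => inv_nonneg.2 (norm_nonneg _)) _)

/-- Newton's shell theorem in the plane: a radial mass distribution attracts a point `a` as if the
mass inside the circle through `a` were concentrated at the origin, the mass outside having no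
effect. -/
theorem integral_cauchyKernel_mul_density {c R : ℝ} (hR : 0 < 1 - c * R ^ 2) {a : ℂ}
    (ha : ‖a‖ < R) :
    ∫ z : ℂ, Set.indicator (Set.Iio R) (density c) ‖z‖ * (a - z)⁻¹ =
      2 * Real.pi * (starRingEnd ℂ a / (1 + √(1 - c * ‖a‖ ^ 2) : ℝ)) := by
  rw [integral_eq_integral_circleAverage (integrable_cauchyKernel_mul_density hR ha)]
  have hav : ∀ r, Real.circleAverage
      (fun z : ℂ => ((Set.indicator (Set.Iio R) (density c) ‖z‖ : ℝ) : ℂ) * (a - z)⁻¹) 0 r =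
      Set.indicator (Set.Iio R) (density c) |r| • Real.circleAverage (fun z => (a - z)⁻¹) 0 r :=
    fun r => by
      rw [← Real.circleAverage_fun_smul]
      refine Real.circleAverage_congr_sphere fun z hz => ?_
      have : ‖z‖ = |r| := by simpa using hz
      simp only [this, real_smul]
  have hcongr : ∀ᵐ r : ℝ ∂volume.restrict (Set.Ioi 0), (2 * Real.pi * r) • Real.circleAverage
      (fun z : ℂ => ((Set.indicator (Set.Iio R) (density c) ‖z‖ : ℝ) : ℂ) * (a - z)⁻¹) 0 r =
      (Set.Ioc 0 ‖a‖).indicator (fun r => ((r * density c r : ℝ) : ℂ) * (2 * Real.pi * a⁻¹)) r := by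
    have hne : ∀ᵐ r : ℝ ∂volume.restrict (Set.Ioi 0), r ≠ ‖a‖ :=
      ae_restrict_of_ae (Measure.ae_ne volume ‖a‖)
    filter_upwards [hne, ae_restrict_mem measurableSet_Ioi] with r hr hr0
    have hr0' : 0 < r := hr0
    rw [hav, abs_of_pos hr0']
    rcases lt_or_gt_of_ne hr with h1 | h1
    · rw [circleAverage_inv_sub_of_lt hr0'.le h1,
        Set.indicator_of_mem (show r ∈ Set.Iio R from h1.trans ha),
        Set.indicator_of_mem (show r ∈ Set.Ioc 0 ‖a‖ from ⟨hr0', h1.le⟩)]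
      simp only [real_smul]
      push_cast
      ring
    · rw [circleAverage_inv_sub_of_gt h1,
        Set.indicator_of_notMem (show r ∉ Set.Ioc 0 ‖a‖ from fun h => absurd h.2 (not_le.2 h1))]
      simp
  rw [integral_congr_ae hcongr, setIntegral_indicator measurableSet_Ioc,
    show Set.Ioi (0 : ℝ) ∩ Set.Ioc 0 ‖a‖ = Set.Ioc 0 ‖a‖ from
      Set.inter_eq_right.2 fun x hx => hx.1,
    ← intervalIntegral.integral_of_le (norm_nonneg a), intervalIntegral.integral_mul_const,
    intervalIntegral.integral_ofReal,
    integral_mul_density (norm_nonneg a) (one_sub_mul_sq_pos hR (norm_nonneg a) ha.le)]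
  rcases eq_or_ne a 0 with rfl | h0
  · simp
  · have h1 : ((1 + √(1 - c * ‖a‖ ^ 2) : ℝ) : ℂ) ≠ 0 :=
      ofReal_ne_zero.2 (by positivity)
    have h2 : ((‖a‖ ^ 2 : ℝ) : ℂ) = a * starRingEnd ℂ a := by
      rw [mul_conj, normSq_eq_norm_sq]
    rw [ofReal_div, h2]
    field_simp

end Winding

namespace SpaceForm

open Complex MeasureTheory Winding

theorem volume_range_eq_zero {p p' : ℝ → ℂ} (hp : ∀ s, HasDerivAt p (p' s) s) :
    volume (Set.range p) = 0 := by
  have h1 : Set.range p = (fun z : ℂ => p z.re) '' {z : ℂ | z.im = 0} := by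
    ext w
    constructor
    · rintro ⟨s, rfl⟩
      exact ⟨s, by simp, by simp⟩
    · rintro ⟨z, -, rfl⟩
      exact ⟨z.re, rfl⟩
  rw [h1]
  refine addHaar_image_eq_zero_of_differentiableOn_of_addHaar_eq_zero volume
    (fun z _ => ?_) ?_
  · exact ((hp z.re).differentiableAt.comp z
      reCLM.differentiableAt).differentiableWithinAt
  · have h2 : LinearMap.ker imLm ≠ ⊤ := fun h => by
      have h3 : I ∈ LinearMap.ker imLm := h ▸ Submodule.mem_top
      simp at h3
    exact Measure.addHaar_submodule volume _ h2

/-- The area, with multiplicities, enclosed by a plane curve `p`, with respect to the area of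
`X²_c` in the projection. The winding number is written as an integral of the Cauchy kernel along
`p`, and the integral over the plane is carried out first. -/
theorem integral_winding_mul_density {c L : ℝ} (hL : 0 < L) {p p' : ℝ → ℂ} {η : ℝ → ℝ}
    (hp : ∀ s, HasDerivAt p (p' s) s) (hp' : Continuous p') (hper : Function.Periodic p L)
    (hη : ∀ s, 0 < η s) (hpη : ∀ s, η s ^ 2 + c * ((p s).re ^ 2 + (p s).im ^ 2) = 1) {ι : ℂ → ℤ}
    (hι : ∀ q : ℂ, 0 < 1 - c * ‖q‖ ^ 2 → (∀ s, p s ≠ q) →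
      HasWinding L (fun s => p s - q) (ι q)) :
    IntegrableOn (fun q => (ι q : ℝ) * density c ‖q‖) {q : ℂ | 0 < 1 - c * ‖q‖ ^ 2} ∧
    ∫ q in {q : ℂ | 0 < 1 - c * ‖q‖ ^ 2}, (ι q : ℝ) * density c ‖q‖ =
      ∫ s in (0 : ℝ)..L, (starRingEnd ℂ (p s) * p' s).im / (1 + η s) := by
  have hpc : Continuous p := continuous_of_hasDerivAt hp
  obtain ⟨R, hR0, hpR, hR⟩ := exists_norm_lt hL hpc hper hη hpη
  have hpn : ∀ s, η s ^ 2 = 1 - c * ‖p s‖ ^ 2 := fun s => by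
    rw [← normSq_eq_norm_sq, normSq_apply]
    linarith [hpη s]
  have hΩ : MeasurableSet {q : ℂ | 0 < 1 - c * ‖q‖ ^ 2} :=
    measurableSet_lt measurable_const (by fun_prop)
  set D : ℂ → ℝ := fun q => Set.indicator (Set.Iio R) (density c) ‖q‖ with hD
  have hDm : Measurable D :=
    ((measurable_density c).indicator measurableSet_Iio).comp measurable_norm
  set ν : Measure ℝ := volume.restrict (Set.Ioc 0 L) with hν
  set K : ℝ × ℂ → ℂ := fun x => p' x.1 * (D x.2 * (p x.1 - x.2)⁻¹) with hK
  have hKm : Measurable K := by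
    have h1 : Measurable fun x : ℝ × ℂ => (D x.2 : ℂ) :=
      measurable_ofReal.comp (hDm.comp measurable_snd)
    exact (hp'.measurable.comp measurable_fst).mul
      (h1.mul ((hpc.measurable.comp measurable_fst).sub measurable_snd).inv)
  -- the kernel is dominated by a shear of an integrable function
  have hKi : Integrable K (ν.prod volume) := by
    obtain ⟨C, hC⟩ := isCompact_Icc.exists_bound_of_continuousOn (s := Set.Icc 0 L)
      hp'.continuousOn
    have hshear : MeasurePreserving (fun x : ℝ × ℂ => (x.1, p x.1 - x.2)) (ν.prod volume)
        (ν.prod volume) :=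
      (MeasurePreserving.id ν).skew_product (g := fun s q => p s - q)
        ((hpc.measurable.comp measurable_fst).sub measurable_snd)
        (Filter.Eventually.of_forall fun s =>
          (Measure.measurePreserving_sub_left volume (p s)).map_eq)
    have h1 : Integrable (fun x : ℝ × ℂ =>
        Set.indicator (Set.Iio (2 * R)) (fun r : ℝ => r⁻¹) ‖x.2‖) (ν.prod volume) :=
      (integrable_indicator_norm_inv (2 * R)).comp_snd ν
    have h2 := hshear.integrable_comp_of_integrable h1
    refine (h2.const_mul (C * (1 / √(min 1 (1 - c * R ^ 2))))).mono' hKm.aestronglyMeasurable ?_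
    have h3 : ∀ᵐ x : ℝ × ℂ ∂(ν.prod volume), x.1 ∈ Set.Ioc 0 L :=
      Measure.quasiMeasurePreserving_fst.ae (ae_restrict_mem measurableSet_Ioc)
    filter_upwards [h3] with x hx
    have hCx := hC x.1 ⟨hx.1.le, hx.2⟩
    have hC0 : 0 ≤ C := (norm_nonneg _).trans hCx
    simp only [Function.comp_apply]
    by_cases hz : ‖x.2‖ ∈ Set.Iio R
    · have hz2 : ‖p x.1 - x.2‖ ∈ Set.Iio (2 * R) := by
        have h4 := norm_sub_le (p x.1) x.2
        have h5 := hpR x.1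
        have h6 : ‖x.2‖ < R := hz
        exact Set.mem_Iio.2 (by linarith)
      simp only [hK, hD]
      rw [Set.indicator_of_mem hz, Set.indicator_of_mem hz2, norm_mul, norm_mul, norm_real,
        norm_inv, Real.norm_of_nonneg (density_nonneg _ _), ← mul_assoc]
      exact mul_le_mul_of_nonneg_right (mul_le_mul hCx
        (density_le hR (norm_nonneg _) (le_of_lt hz)) (density_nonneg _ _) hC0)
        (inv_nonneg.2 (norm_nonneg _))
    · simp only [hK, hD]
      rw [Set.indicator_of_notMem hz]
      simp only [ofReal_zero, zero_mul, mul_zero, norm_zero]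
      exact mul_nonneg (mul_nonneg hC0 (by positivity)) (Set.indicator_nonneg
        (fun r hr => inv_nonneg.2 (norm_nonneg _)) _)
  have hJ : Integrable (fun q => ∫ s, K (s, q) ∂ν) := hKi.integral_prod_right
  have hne : ∀ᵐ q : ℂ, ∀ s, p s ≠ q := by
    filter_upwards [compl_mem_ae_iff.2 (volume_range_eq_zero hp)] with q hq s hs
    exact hq ⟨s, hs⟩
  have hae : (fun q => Set.indicator {q : ℂ | 0 < 1 - c * ‖q‖ ^ 2}
      (fun q => (ι q : ℝ) * density c ‖q‖) q) =ᵐ[volume]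
      fun q => (2 * Real.pi)⁻¹ * (∫ s, K (s, q) ∂ν).im := by
    filter_upwards [hne] with q hq
    simp only [hK, hν]
    rw [← intervalIntegral.integral_of_le hL.le]
    by_cases hqR : ‖q‖ < R
    · have hqΩ : 0 < 1 - c * ‖q‖ ^ 2 := one_sub_mul_sq_pos hR (norm_nonneg q) hqR.le
      have h1 := (hι q hqΩ hq).integral_eq (fun s => (hp s).sub_const q) hp'
      have h2 : ∀ s, p' s * ((D q : ℂ) * (p s - q)⁻¹) = D q * (p' s / (p s - q)) := fun s => by
        rw [div_eq_mul_inv]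
        ring
      simp only [h2]
      rw [intervalIntegral.integral_const_mul, h1,
        Set.indicator_of_mem (show q ∈ {q : ℂ | 0 < 1 - c * ‖q‖ ^ 2} from hqΩ), im_ofReal_mul]
      simp only [hD]
      rw [Set.indicator_of_mem (show ‖q‖ ∈ Set.Iio R from hqR)]
      have := Real.pi_pos
      simp
      field_simp
    · have h1 : D q = 0 := Set.indicator_of_notMem (by simpa using hqR) _
      simp only [h1]
      rw [Set.indicator_apply]
      split_ifs with hqΩ
      · have h2 : ι q = 0 := (hι q hqΩ hq).unique
          (hasWinding_sub_of_norm_lt hpc hper fun s => (hpR s).trans_le (not_lt.1 hqR))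
        simp [h2]
      · simp
  have hJim : Integrable fun q => (2 * Real.pi)⁻¹ * (∫ s, K (s, q) ∂ν).im :=
    (imCLM.integrable_comp hJ).const_mul _
  refine ⟨(integrable_indicator_iff hΩ).1 (hJim.congr hae.symm), ?_⟩
  rw [← integral_indicator hΩ, integral_congr_ae hae, integral_const_mul]
  have him : ∫ q, (∫ s, K (s, q) ∂ν).im = (∫ q, ∫ s, K (s, q) ∂ν).im :=
    imCLM.integral_comp_comm hJ
  have hshell : ∀ s, ∫ q, K (s, q) = p' s * (2 * Real.pi * (starRingEnd ℂ (p s) /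
      (1 + η s : ℝ))) := fun s => by
    simp only [hK, hD]
    rw [integral_const_mul, integral_cauchyKernel_mul_density hR (hpR s), ← hpn,
      Real.sqrt_sq (hη s).le]
  rw [him, integral_integral_swap (f := fun q s => K (s, q)) hKi.swap]
  simp only [hshell]
  rw [hν, ← intervalIntegral.integral_of_le hL.le]
  have hηc : Continuous η := by
    have : η = fun s => √(1 - c * ‖p s‖ ^ 2) := funext fun s => by
      rw [← hpn, Real.sqrt_sq (hη s).le]
    rw [this]
    fun_prop
  have hη1 : ∀ s, ((1 + η s : ℝ) : ℂ) ≠ 0 := fun s => ofReal_ne_zero.2 (by linarith [hη s])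
  have hcont : Continuous fun s => p' s * (2 * Real.pi * (starRingEnd ℂ (p s) / (1 + η s : ℝ))) :=
    hp'.mul (continuous_const.mul (Continuous.div (by fun_prop) (by fun_prop) hη1))
  have him2 : (∫ s in (0 : ℝ)..L, p' s * (2 * Real.pi * (starRingEnd ℂ (p s) /
      (1 + η s : ℝ)))).im = ∫ s in (0 : ℝ)..L, (p' s * (2 * Real.pi * (starRingEnd ℂ (p s) /
      (1 + η s : ℝ)))).im :=
    (imCLM.intervalIntegral_comp_comm (hcont.intervalIntegrable _ _)).symm
  rw [him2, ← intervalIntegral.integral_const_mul]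
  congr 1
  funext s
  have h1 : p' s * (2 * Real.pi * (starRingEnd ℂ (p s) / (1 + η s : ℝ))) =
      (2 * Real.pi / (1 + η s) : ℝ) * (starRingEnd ℂ (p s) * p' s) := by
    push_cast
    ring
  rw [h1, im_ofReal_mul]
  have := Real.pi_pos
  field_simp

end SpaceForm

/-! ### The index of a curve on the space form -/

namespace SpaceForm

open Complex Winding

/-- The vector of the ambient space with coordinates `z`, `η` as in `IsFrame`. For `c = 0` the last
component vanishes, by the convention `η / 0 = 0`. -/
noncomputable def point (c : ℝ) (z : ℂ) (η : ℝ) : Fin 3 → ℝ := ![z.re, z.im, η / √|c|]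

theorem ip_point (c : ℝ) (z w : ℂ) (η χ : ℝ) :
    ip c (point c z η) (point c w χ) = z.re * w.re + z.im * w.im + η * χ / c := by
  have h1 : sgn c * (η / √|c| * (χ / √|c|)) = η * χ / c := by
    rw [div_mul_div_comm, Real.mul_self_sqrt (abs_nonneg c), sgn]
    split_ifs with hc
    · rw [abs_of_neg hc, div_neg]
      ring
    · rw [abs_of_nonneg (not_lt.1 hc), one_mul]
  simp only [ip, point, Matrix.cons_val_zero, Matrix.cons_val_one, Matrix.cons_val]
  rw [h1]

theorem lift_eq_point (c : ℝ) (q : ℂ) {σ : ℝ} :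
    lift c σ (q.re, q.im) = point c q (σ * √(1 - c * ‖q‖ ^ 2)) := by
  have h1 : ‖q‖ ^ 2 = q.re ^ 2 + q.im ^ 2 := by
    rw [← normSq_eq_norm_sq, normSq_apply]
    ring
  rw [h1]
  ext i
  fin_cases i
  · simp [lift, point]
  · simp [lift, point]
  · by_cases hc : c = 0
    · simp [lift, point, hc]
    · simp [lift, point, hc, Real.sqrt_div' _ (abs_nonneg c), mul_div_assoc]

theorem sn_pos {c r : ℝ} (hr : 0 < r) (h : 0 < c → √c * r < Real.pi) : 0 < sn c r := by
  unfold sn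
  split_ifs with h1 h2
  · have h3 : 0 < √(-c) := Real.sqrt_pos.2 (by linarith)
    exact div_pos (Real.sinh_pos_iff.2 (mul_pos h3 hr)) h3
  · exact hr
  · have hc : 0 < c := lt_of_le_of_ne (not_lt.1 h1) (Ne.symm h2)
    have h3 : 0 < √c := Real.sqrt_pos.2 hc
    exact div_pos (Real.sin_pos_of_pos_of_lt_pi (mul_pos h3 hr) (h hc)) h3

theorem cn_sq_add_sn_sq (c r : ℝ) : cn c r ^ 2 + c * sn c r ^ 2 = 1 := by
  unfold cn sn
  split_ifs with h1 h2
  · have h3 : 0 < √(-c) := Real.sqrt_pos.2 (by linarith)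
    have h4 : √(-c) ^ 2 = -c := Real.sq_sqrt (by linarith)
    rw [div_pow, h4, Real.cosh_sq]
    have : c ≠ 0 := h1.ne
    field_simp
    ring
  · rw [h2]
    ring
  · have hc : 0 < c := lt_of_le_of_ne (not_lt.1 h1) (Ne.symm h2)
    have h4 : √c ^ 2 = c := Real.sq_sqrt hc.le
    rw [div_pow, h4, Real.cos_sq']
    field_simp
    ring

/-- The existence of geodesic polar coordinates, radial part. -/
theorem exists_cn_sn_eq {c C ρ : ℝ} (hρ : 0 < ρ) (h : C ^ 2 + c * ρ ^ 2 = 1)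
    (hC : c ≤ 0 → 0 < C) :
    ∃ r, 0 < r ∧ (0 < c → √c * r < Real.pi) ∧ cn c r = C ∧ sn c r = ρ := by
  rcases lt_trichotomy c 0 with hc | hc | hc
  · have h3 : 0 < √(-c) := Real.sqrt_pos.2 (by linarith)
    have h4 : √(-c) ^ 2 = -c := Real.sq_sqrt (by linarith)
    have h5 : √(-c) * (Real.arsinh (√(-c) * ρ) / √(-c)) = Real.arsinh (√(-c) * ρ) := by
      field_simp
    refine ⟨Real.arsinh (√(-c) * ρ) / √(-c),
      div_pos (Real.arsinh_pos_iff.2 (mul_pos h3 hρ)) h3, fun h => absurd h (by linarith), ?_, ?_⟩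
    · rw [cn, if_pos hc, h5, Real.cosh_arsinh, mul_pow, h4,
        show 1 + -c * ρ ^ 2 = C ^ 2 by linarith, Real.sqrt_sq (hC hc.le).le]
    · rw [sn, if_pos hc, h5, Real.sinh_arsinh]
      field_simp
  · subst hc
    have h1 : C = 1 := by
      have := hC le_rfl
      nlinarith
    exact ⟨ρ, hρ, fun h => absurd h (lt_irrefl 0), by simp [cn, h1], by simp [sn]⟩
  · have h3 : 0 < √c := Real.sqrt_pos.2 hc
    have h4 : √c ^ 2 = c := Real.sq_sqrt hc.le
    have h5 : √c * (Real.arccos C / √c) = Real.arccos C := by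
      field_simp
    have h6 : 0 < c * ρ ^ 2 := mul_pos hc (pow_pos hρ 2)
    have h7 := abs_lt.1 ((sq_lt_one_iff_abs_lt_one C).1 (by linarith))
    refine ⟨Real.arccos C / √c, div_pos (Real.arccos_pos.2 h7.2) h3, fun _ => ?_, ?_, ?_⟩
    · rw [h5]
      refine lt_of_le_of_ne (Real.arccos_le_pi C) fun h => ?_
      rw [Real.arccos_eq_pi] at h
      linarith
    · rw [cn, if_neg (not_lt.2 hc.le), if_neg hc.ne', h5, Real.cos_arccos h7.1.le h7.2.le]
    · rw [sn, if_neg (not_lt.2 hc.le), if_neg hc.ne', h5, Real.sin_arccos,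
        show 1 - C ^ 2 = (√c * ρ) ^ 2 by rw [mul_pow, h4]; linarith, Real.sqrt_sq (by positivity)]
      field_simp

section frame

variable {c k : ℝ} {q : ℂ}

/-- The standard frame at the point of the axis, carried to the point `(q, k)` by parallel
transport along a geodesic: the image of the unit vector `a`. -/
noncomputable def transport (c : ℝ) (q : ℂ) (k : ℝ) (a : ℂ) : Fin 3 → ℝ :=
  point c ⟨a.re - c * (q.re * a.re + q.im * a.im) / (1 + k) * q.re,
    a.im - c * (q.re * a.re + q.im * a.im) / (1 + k) * q.im⟩ (-(c * (q.re * a.re + q.im * a.im)))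

theorem isPositiveFrame_transport (hk : 0 < k) (hq : k ^ 2 + c * (q.re ^ 2 + q.im ^ 2) = 1) :
    IsPositiveFrame c (point c q k) (transport c q k 1) (transport c q k I) := by
  have hk1 : 1 + k ≠ 0 := by linarith
  by_cases hc : c = 0
  · subst hc
    constructor <;> simp [transport, point, normalVec, ip, Matrix.det_fin_three]
  have hn : normalVec c (point c q k) = point c q k := by simp [normalVec, hc]
  constructor
  · rw [hn, transport, ip_point]
    simp
    field_simp
    grind
  · rw [hn, transport, ip_point]
    simp
    field_simp
    grind
  · rw [transport, ip_point]
    simp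
    field_simp
    grind
  · rw [transport, ip_point]
    simp
    field_simp
    grind
  · rw [transport, transport, ip_point]
    simp
    field_simp
    grind
  · have hs : 0 < √|c| := Real.sqrt_pos.2 (abs_pos.2 hc)
    have : (Matrix.of ![transport c q k 1, transport c q k I, normalVec c (point c q k)]).det =
        1 / √|c| := by
      rw [hn]
      simp [transport, point, Matrix.det_fin_three]
      field_simp
      grind
    rw [this]
    positivity

end frame

/-- A closed curve with an index about `P`, both in the open upper half of `X²_c`, has this index as
its winding number in the orthogonal projection: the polar coordinates about `P` give the direction
from `P` in the central projection, up to a linear map of positive determinant. -/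
theorem HasIndex.hasWinding {c L : ℝ} (hL : 0 < L) {z : ℝ → ℂ} {η : ℝ → ℝ} (hz : Continuous z)
    (hη : Continuous η) (hzp : Function.Periodic z L) (hηp : Function.Periodic η L)
    (hη0 : ∀ s, 0 < η s) (hzη : ∀ s, η s ^ 2 + c * ((z s).re ^ 2 + (z s).im ^ 2) = 1)
    {q : ℂ} {k : ℝ} (hk : 0 < k) (hq : k ^ 2 + c * (q.re ^ 2 + q.im ^ 2) = 1)
    (hzq : ∀ s, z s ≠ q) {m : ℤ}
    (h : HasIndex c L (fun s => point c (z s) (η s)) (point c q k) m) :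
    HasWinding L (fun s => z s - q) m := by
  obtain ⟨e₁, e₂, he, r, ψ, hψ, hr, hm⟩ := h
  set D : ℝ → ℂ := fun s => z s * k - q * η s with hD
  have hacute : ∀ s, 0 < (D s * starRingEnd ℂ (z s - q)).re := fun s =>
    central_inner_orthogonal_pos (hη0 s) hk (hzη s) hq (hzq s)
  have hD0 : ∀ s, D s ≠ 0 := fun s h => by
    have := hacute s
    simp [h] at this
  have hDc : Continuous D := by fun_prop
  have hDp : Function.Periodic D L := fun s => by simp only [hD, hzp s, hηp s]
  obtain ⟨w, hw⟩ := exists_hasWinding hDc hD0 hDp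
  have hgoal : HasWinding L (fun s => z s - q) w :=
    hw.of_re_mul_conj_pos (by fun_prop) (fun s => by simp only [hzp s]) fun s => by
      have h1 := hacute s
      rwa [← conj_re, map_mul, Complex.conj_conj, mul_comm] at h1
  suffices hwm : w = m from hwm ▸ hgoal
  -- the differential of the central projection at `P`, up to a factor
  have key : ∃ a b : ℂ, 0 < a.re * b.im - a.im * b.re ∧ ∀ s ∈ Set.Icc 0 L,
      D s = sn c (r s) * (Real.cos (ψ s) * a + Real.sin (ψ s) * b) := by
    have hdet := he.positive
    rw [Matrix.det_fin_three] at hdet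
    by_cases hc : c = 0
    · subst hc
      simp [normalVec] at hdet
      have hk1 : k = 1 := by
        simp at hq
        rcases hq with h | h <;> linarith
      refine ⟨⟨e₁ 0, e₁ 1⟩, ⟨e₂ 0, e₂ 1⟩, by simpa [mul_comm] using hdet, fun s hs => ?_⟩
      have hη1 : η s = 1 := by
        have h1 := hzη s
        simp at h1
        rcases h1 with h | h <;> linarith [hη0 s]
      have h0 := congrFun (hr s hs).2.2 0
      have h1 := congrFun (hr s hs).2.2 1
      simp [point, expPolar, cn] at h0 h1
      apply Complex.ext
      · simp [hD, hk1, hη1, h0, -ofReal_cos, -ofReal_sin]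
        ring
      · simp [hD, hk1, hη1, h1, -ofReal_cos, -ofReal_sin]
        ring
    · have hs0 : 0 < √|c| := Real.sqrt_pos.2 (abs_pos.2 hc)
      have hn : normalVec c (point c q k) = point c q k := by simp [normalVec, hc]
      rw [hn] at hdet
      simp [point] at hdet
      refine ⟨⟨e₁ 0 * k - q.re * (√|c| * e₁ 2), e₁ 1 * k - q.im * (√|c| * e₁ 2)⟩,
        ⟨e₂ 0 * k - q.re * (√|c| * e₂ 2), e₂ 1 * k - q.im * (√|c| * e₂ 2)⟩, ?_, fun s hs => ?_⟩
      · have : (e₁ 0 * k - q.re * (√|c| * e₁ 2)) * (e₂ 1 * k - q.im * (√|c| * e₂ 2)) -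
            (e₁ 1 * k - q.im * (√|c| * e₁ 2)) * (e₂ 0 * k - q.re * (√|c| * e₂ 2)) =
            √|c| * k * (e₁ 0 * e₂ 1 * (k / √|c|) - e₁ 0 * e₂ 2 * q.im - e₁ 1 * e₂ 0 * (k / √|c|) +
              e₁ 1 * e₂ 2 * q.re + e₁ 2 * e₂ 0 * q.im - e₁ 2 * e₂ 1 * q.re) := by
          field_simp
          ring
        simp only
        rw [this]
        exact mul_pos (mul_pos hs0 hk) (by linarith)
      · have h0 := congrFun (hr s hs).2.2 0
        have h1 := congrFun (hr s hs).2.2 1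
        have h2 := congrFun (hr s hs).2.2 2
        simp [point, expPolar] at h0 h1 h2
        have h3 : η s = cn c (r s) * k + sn c (r s) *
            (Real.cos (ψ s) * (√|c| * e₁ 2) + Real.sin (ψ s) * (√|c| * e₂ 2)) := by
          field_simp at h2
          linear_combination h2
        apply Complex.ext
        · simp [hD, h0, h3, -ofReal_cos, -ofReal_sin]
          ring
        · simp [hD, h1, h3, -ofReal_cos, -ofReal_sin]
          ring
  obtain ⟨a, b, hab, hDab⟩ := key
  have hb0 : -(I * b) ≠ 0 := fun h => by
    have : b = 0 := by simpa using h
    simp [this] at hab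
  have hslit : ∀ s ∈ Set.Icc 0 L, D s / (exp (ψ s * I) * -(I * b)) ∈ slitPlane := fun s hs => by
    have h1 := hDab s hs
    have h2 := sn_pos (hr s hs).1 (hr s hs).2.1
    have h3 : ((Real.cos (ψ s) : ℝ) : ℂ) * (I * a) - (Real.sin (ψ s) : ℝ) * -(I * b) =
        I * (Real.cos (ψ s) * a + Real.sin (ψ s) * b) := by
      push_cast
      ring
    have h4 : (Real.cos (ψ s) : ℂ) * a + Real.sin (ψ s) * b ≠ 0 := fun h => hD0 s (by
      rw [h1, h, mul_zero])
    have h5 := combination_div_mem_slitPlane (T := -(I * b)) (N := I * a) (x := Real.cos (ψ s))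
      (y := Real.sin (ψ s)) (by simp; linarith) (by rw [h3]; exact mul_ne_zero I_ne_zero h4)
    rw [h3, ← mul_assoc I I, I_mul_I, neg_one_mul, neg_neg] at h5
    have h6 : D s / (exp (ψ s * I) * -(I * b)) = sn c (r s) *
        ((Real.cos (ψ s) * a + Real.sin (ψ s) * b) /
          ((Real.cos (ψ s) + Real.sin (ψ s) * I) * -(I * b))) := by
      rw [h1, exp_mul_I, ofReal_cos, ofReal_sin]
      ring
    rw [h6, mem_slitPlane_iff, re_ofReal_mul, im_ofReal_mul]
    rw [mem_slitPlane_iff] at h5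
    exact h5.imp (fun h => mul_pos h2 h) (fun h => mul_ne_zero h2.ne' h)
  obtain ⟨G, hG, hDG, hGw⟩ := hw
  have hexpψ : exp (ψ L * I) = exp (ψ 0 * I) := by
    rw [show (ψ L : ℂ) * I = ψ 0 * I + m * (2 * Real.pi * I) by
      rw [show ψ L = ψ 0 + 2 * Real.pi * m by linarith]
      push_cast
      ring]
    exact exp_periodic.int_mul m _
  have hψI : ContinuousOn (fun s => (ψ s : ℂ) * I) (Set.Icc 0 L) :=
    (continuous_ofReal.comp_continuousOn hψ).mul continuousOn_const
  have h1 := log_sub_log_eq (S := Set.Icc 0 L) isPreconnected_Icc (G := G)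
    (H := fun s => ψ s * I + log (D s / (exp (ψ s * I) * -(I * b))) + log (-(I * b)))
    hG.continuousOn ((hψI.add (ContinuousOn.clog (hDc.continuousOn.div
      (hψI.cexp.mul continuousOn_const) fun s hs => mul_ne_zero (exp_ne_zero _) hb0) hslit)).add
      continuousOn_const) (fun s hs => by
        rw [exp_add, exp_add, exp_log (slitPlane_ne_zero (hslit s hs)), exp_log hb0, ← hDG]
        have := exp_ne_zero (ψ s * I)
        have : b ≠ 0 := fun h => hb0 (by rw [h, mul_zero, neg_zero])
        field_simp) (a := L) (b := 0) ⟨hL.le, le_rfl⟩ ⟨le_rfl, hL.le⟩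
  have hDL : D L = D 0 := by simpa using hDp 0
  have hGL := hGw 0
  rw [zero_add] at hGL
  simp only [hDL, hexpψ, hGL] at h1
  have h2 : (ψ L : ℂ) = ψ 0 + 2 * Real.pi * m := by
    rw [show ψ L = ψ 0 + 2 * Real.pi * m by linarith]
    push_cast
    ring
  rw [h2] at h1
  apply two_pi_I_mul_int_inj
  linear_combination h1

end SpaceForm

namespace SpaceForm

open Complex Winding

/-- The geodesic polar coordinates about a point of the upper half of `X²_c` of a curve in the upper
half, so that there is a winding number in these coordinates. -/
theorem exists_hasIndex {c L : ℝ} {z : ℝ → ℂ} {η : ℝ → ℝ} (hz : Continuous z)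
    (hη : Continuous η) (hzp : Function.Periodic z L) (hηp : Function.Periodic η L)
    (hη0 : ∀ s, 0 < η s) (hzη : ∀ s, η s ^ 2 + c * ((z s).re ^ 2 + (z s).im ^ 2) = 1)
    {q : ℂ} {k : ℝ} (hk : 0 < k) (hq : k ^ 2 + c * (q.re ^ 2 + q.im ^ 2) = 1)
    (hzq : ∀ s, z s ≠ q) :
    ∃ m, HasIndex c L (fun s => point c (z s) (η s)) (point c q k) m := by
  have hk1 : 1 + k ≠ 0 := by linarith
  set d : ℝ := (1 + k)⁻¹ with hd
  have hd1 : d * (1 + k) = 1 := inv_mul_cancel₀ hk1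
  set p : ℝ → ℝ := fun s => c * (q.re * (z s).re + q.im * (z s).im) with hp
  have hpc : Continuous p := by fun_prop
  set l : ℝ → ℝ := fun s => η s + p s * d with hl
  set C : ℝ → ℝ := fun s => k * η s + p s with hC
  set u : ℝ → ℂ := fun s => z s - l s * q with hu
  have hlc : Continuous l := by fun_prop
  have huc : Continuous u := by fun_prop
  have hu1 : ∀ s, (u s).re = (z s).re - l s * q.re := fun s => by simp [hu]
  have hu2 : ∀ s, (u s).im = (z s).im - l s * q.im := fun s => by simp [hu]
  have hup : Function.Periodic u L := fun s => by simp only [hu, hl, hp, hzp s, hηp s]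
  have hcu : ∀ s, c * (q.re * (u s).re + q.im * (u s).im) = p s - l s * (1 - k ^ 2) := fun s => by
    rw [hu1, hu2]
    simp only [hp]
    linear_combination (-l s) * hq
  have hu0 : ∀ s, u s ≠ 0 := fun s h => by
    have h1 : (z s).re = l s * q.re := by linarith [hu1 s, congrArg re h, zero_re]
    have h2 : (z s).im = l s * q.im := by linarith [hu2 s, congrArg im h, zero_im]
    have h3 : η s = l s * k := by
      have h4 := hcu s
      rw [h, zero_re, zero_im] at h4
      have h5 : l s = η s + p s * d := rfl
      linear_combination (-1 : ℝ) * h5 + d * h4 - l s * (1 - k) * hd1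
    have h4 : l s ^ 2 = 1 := by
      have := hzη s
      rw [h1, h2, h3] at this
      linear_combination this - l s ^ 2 * hq
    have h5 : 0 < l s := pos_of_mul_pos_left (h3 ▸ hη0 s) hk.le
    have h6 : l s = 1 := by nlinarith
    exact hzq s (Complex.ext (by rw [h1, h6, one_mul]) (by rw [h2, h6, one_mul]))
  have hCu : ∀ s, C s ^ 2 + c * ‖u s‖ ^ 2 = 1 := fun s => by
    rw [← normSq_eq_norm_sq, normSq_apply]
    have h1 := hzη s
    have h2 := hcu s
    have h3 : l s = η s + p s * d := rfl
    have h4 : C s = k * η s + p s := rfl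
    have h5 : p s = c * (q.re * (z s).re + q.im * (z s).im) := rfl
    rw [hu1, hu2] at h2 ⊢
    grind
  have hCpos : ∀ s, c ≤ 0 → 0 < C s := fun s hc => by
    have h1 := hCu s
    by_contra! h2
    have h3 := hzη s
    have h5 : p s = c * (q.re * (z s).re + q.im * (z s).im) := rfl
    have h4 : k * η s ≤ -p s := by
      simp only [hC] at h2
      linarith
    have h6 : (k * η s) ^ 2 ≤ (-p s) ^ 2 := pow_le_pow_left₀ (mul_pos hk (hη0 s)).le h4 2
    have h7 : (q.re * (z s).re + q.im * (z s).im) ^ 2 ≤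
        (q.re ^ 2 + q.im ^ 2) * ((z s).re ^ 2 + (z s).im ^ 2) := by
      nlinarith [sq_nonneg (q.re * (z s).im - q.im * (z s).re)]
    have h8 : (-p s) ^ 2 ≤ (c * (q.re ^ 2 + q.im ^ 2)) * (c * ((z s).re ^ 2 + (z s).im ^ 2)) := by
      rw [h5]
      nlinarith [sq_nonneg c]
    have h9 : c * (q.re ^ 2 + q.im ^ 2) ≤ 0 :=
      mul_nonpos_of_nonpos_of_nonneg hc (by positivity)
    have h10 : c * ((z s).re ^ 2 + (z s).im ^ 2) ≤ 0 :=
      mul_nonpos_of_nonpos_of_nonneg hc (by positivity)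
    nlinarith
  choose r hr using fun s => exists_cn_sn_eq (norm_pos_iff.2 (hu0 s)) (hCu s) (hCpos s)
  obtain ⟨m, G, hG, huG, hGm⟩ := exists_hasWinding huc hu0 hup
  have hnorm : ∀ s, ‖u s‖ = Real.exp (G s).re := fun s => by rw [huG, norm_exp]
  refine ⟨m, transport c q k 1, transport c q k I, isPositiveFrame_transport hk hq, r,
    fun s => (G s).im, by fun_prop, fun s _ => ⟨(hr s).1, (hr s).2.1, ?_⟩, ?_⟩
  · have h1 : ‖u s‖ * Real.cos (G s).im = (u s).re := by rw [hnorm, huG, exp_re]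
    have h2 : ‖u s‖ * Real.sin (G s).im = (u s).im := by rw [hnorm, huG, exp_im]
    have h3 := hcu s
    rw [expPolar, (hr s).2.2.1, (hr s).2.2.2, smul_add, smul_smul, smul_smul, h1, h2]
    have h4 : l s = η s + p s * d := rfl
    have h5 : C s = k * η s + p s := rfl
    have h6 := hu1 s
    have h7 := hu2 s
    ext i
    fin_cases i
    · simp [point, transport, div_eq_mul_inv, ← hd]
      linear_combination (-q.re) * h5 - h6 + q.re * d * h3 + k * q.re * h4 +
        q.re * (p s - (1 - k) * l s) * hd1
    · simp [point, transport, div_eq_mul_inv, ← hd]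
      linear_combination (-q.im) * h5 - h7 + q.im * d * h3 + k * q.im * h4 +
        q.im * (p s - (1 - k) * l s) * hd1
    · simp [point, transport, div_eq_mul_inv, ← hd]
      rw [show η s = C s * k - c * (q.re * (u s).re + q.im * (u s).im) by
        rw [h3, h5]; linear_combination (-(1 - k ^ 2)) * h4 - (1 - k) * p s * hd1]
      ring
  · have h1 := im_of_periodic_log hGm 0
    rw [zero_add] at h1
    linarith

theorem HasIndex.of_index {c L : ℝ} {γ : ℝ → Fin 3 → ℝ} {P : Fin 3 → ℝ}
    (h : (0 < c → InOpenHemisphere c (insert P (γ '' Set.Icc 0 L))) ∧ ∃ m, HasIndex c L γ P m) :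
    HasIndex c L γ P (index c L γ P) := by
  rw [index, dif_pos h]
  exact h.2.choose_spec

/-- The index is the winding number in the orthogonal projection. For `c > 0` the upper half of the
sphere serves as the common hemisphere. -/
theorem hasWinding_index {c L : ℝ} (hL : 0 < L) {z : ℝ → ℂ} {η : ℝ → ℝ} (hz : Continuous z)
    (hη : Continuous η) (hzp : Function.Periodic z L) (hηp : Function.Periodic η L)
    (hη0 : ∀ s, 0 < η s) (hzη : ∀ s, η s ^ 2 + c * ((z s).re ^ 2 + (z s).im ^ 2) = 1)
    {q : ℂ} {k : ℝ} (hk : 0 < k) (hq : k ^ 2 + c * (q.re ^ 2 + q.im ^ 2) = 1)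
    (hzq : ∀ s, z s ≠ q) :
    HasWinding L (fun s => z s - q) (index c L (fun s => point c (z s) (η s)) (point c q k)) := by
  refine HasIndex.hasWinding hL hz hη hzp hηp hη0 hzη hk hq hzq (HasIndex.of_index ⟨fun hc => ?_,
    exists_hasIndex hz hη hzp hηp hη0 hzη hk hq hzq⟩)
  have h1 : 0 < √|c| := Real.sqrt_pos.2 (abs_pos.2 hc.ne')
  have h2 : sgn c = 1 := if_neg (not_lt.2 hc.le)
  refine ⟨![0, 0, 1], fun u hu => ?_⟩
  rcases hu with rfl | ⟨s, -, rfl⟩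
  · simpa [ip, point, h2] using div_pos hk h1
  · simpa [ip, point, h2] using div_pos (hη0 s) h1

/-- The index of a curve in the upper half of the sphere vanishes in the lower half. If the curve
and the point `P` lie in the open hemisphere about `w`, then a combination of `w` and of the
vertical vector is orthogonal to `P` and positive on the curve, which therefore stays on one side of
a line through the origin in the chart at `P`. -/
theorem index_eq_zero_of_neg {c L : ℝ} (hc : 0 < c) (hL : 0 ≤ L) {z : ℝ → ℂ} {η : ℝ → ℝ}
    (hη0 : ∀ s, 0 < η s) {q : ℂ} {k : ℝ} (hk : k < 0) :
    index c L (fun s => point c (z s) (η s)) (point c q k) = 0 := by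
  by_cases h : (0 < c → InOpenHemisphere c (insert (point c q k)
    ((fun s => point c (z s) (η s)) '' Set.Icc 0 L))) ∧
      ∃ m, HasIndex c L (fun s => point c (z s) (η s)) (point c q k) m
  swap
  · rw [index, dif_neg h]
  obtain ⟨e₁, e₂, he, r, ψ, hψ, hr, hm⟩ := HasIndex.of_index h
  set m := index c L (fun s => point c (z s) (η s)) (point c q k)
  obtain ⟨w, hw⟩ := h.1 hc
  have h1 : 0 < √|c| := Real.sqrt_pos.2 (abs_pos.2 hc.ne')
  have h2 : sgn c = 1 := if_neg (not_lt.2 hc.le)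
  set P := point c q k with hP
  have hP2 : P 2 < 0 := by simpa [hP, point] using div_neg_of_neg_of_pos hk h1
  set v : Fin 3 → ℝ := fun i => ip c w P * (![0, 0, 1] : Fin 3 → ℝ) i - P 2 * w i with hv
  have hvP : ip c v P = 0 := by
    simp [hv, ip, h2]
    ring
  have hve : ∀ s ∈ Set.Icc 0 L, 0 < ip c v (point c (z s) (η s)) := fun s hs => by
    have h3 : ip c v (point c (z s) (η s)) =
        ip c w P * (η s / √|c|) + -P 2 * ip c w (point c (z s) (η s)) := by
      simp [hv, ip, h2, point]
      ring
    rw [h3]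
    exact add_pos (mul_pos (hw P (Set.mem_insert _ _)) (div_pos (hη0 s) h1))
      (mul_pos (by linarith) (hw _ (Set.mem_insert_of_mem _ ⟨s, hs, rfl⟩)))
  set a : ℂ := ⟨ip c v e₁, -ip c v e₂⟩ with ha
  have hpos : ∀ s ∈ Set.Icc 0 L, 0 < (exp (ψ s * I) * a).re := fun s hs => by
    have h3 := hve s hs
    have h4 : ip c v (point c (z s) (η s)) = cn c (r s) * ip c v P +
        sn c (r s) * (Real.cos (ψ s) * ip c v e₁ + Real.sin (ψ s) * ip c v e₂) := by
      have := (hr s hs).2.2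
      simp only at this
      rw [this]
      simp only [ip, expPolar, Pi.add_apply, Pi.smul_apply, smul_eq_mul]
      ring
    rw [h4, hvP, mul_zero, zero_add] at h3
    have h5 := pos_of_mul_pos_right h3 (sn_pos (hr s hs).1 (hr s hs).2.1).le
    rw [exp_mul_I, ← ofReal_cos, ← ofReal_sin]
    simpa [ha, -ofReal_cos, -ofReal_sin] using h5
  have ha0 : a ≠ 0 := fun h => by
    have := hpos 0 ⟨le_rfl, hL⟩
    simp [h] at this
  have hexp : ∀ s, exp (ψ s * I + log a) = exp (ψ s * I) * a := fun s => by
    rw [exp_add, exp_log ha0]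
  have hψI : ContinuousOn (fun s => (ψ s : ℂ) * I) (Set.Icc 0 L) :=
    (continuous_ofReal.comp_continuousOn hψ).mul continuousOn_const
  have h3 := log_sub_log_eq (S := Set.Icc 0 L) isPreconnected_Icc
    (G := fun s => ψ s * I + log a) (H := fun s => log (exp (ψ s * I) * a))
    (hψI.add continuousOn_const)
    ((hψI.cexp.mul continuousOn_const).clog fun s hs => Or.inl (hpos s hs))
    (fun s hs => by
      rw [hexp, exp_log (mul_ne_zero (exp_ne_zero _) ha0)]) (a := L) (b := 0)
    ⟨hL, le_rfl⟩ ⟨le_rfl, hL⟩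
  have h4 : (ψ L : ℂ) = ψ 0 + 2 * Real.pi * m := by
    rw [show ψ L = ψ 0 + 2 * Real.pi * m by linarith]
    push_cast
    ring
  have hexpψ : exp (ψ L * I) = exp (ψ 0 * I) := by
    rw [h4, show (ψ 0 + 2 * Real.pi * m : ℂ) * I = ψ 0 * I + m * (2 * Real.pi * I) by ring]
    exact exp_periodic.int_mul m _
  simp only [hexpψ] at h3
  rw [h4] at h3
  apply two_pi_I_mul_int_inj
  push_cast
  linear_combination h3

theorem measurableEmbedding_lift (c σ : ℝ) : MeasurableEmbedding (lift c σ) := by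
  have h1 : Measurable (lift c σ) := by
    refine measurable_pi_iff.2 fun i => ?_
    fin_cases i
    · exact measurable_fst
    · exact measurable_snd
    · by_cases hc : c = 0
      · simp [lift, hc]
      · simp only [lift, hc, if_false]
        have : Continuous fun p : ℝ × ℝ => σ * √((1 - c * (p.1 ^ 2 + p.2 ^ 2)) / |c|) := by
          fun_prop
        exact this.measurable
  refine h1.measurableEmbedding fun p q h => ?_
  have h2 := congrFun h 0
  have h3 := congrFun h 1
  simp [lift] at h2 h3
  exact Prod.ext h2 h3

open MeasureTheory in
/-- Integration over the upper or lower half of `X²_c` in the coordinate plane. -/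
theorem integral_map_lift {c σ : ℝ} {f : (Fin 3 → ℝ) → ℝ} :
    (Integrable f ((sheetArea c).map (lift c σ)) ↔
      IntegrableOn (fun q : ℂ => f (point c q (σ * √(1 - c * ‖q‖ ^ 2))) * density c ‖q‖)
        {q : ℂ | 0 < 1 - c * ‖q‖ ^ 2}) ∧
    ∫ P, f P ∂((sheetArea c).map (lift c σ)) =
      ∫ q in {q : ℂ | 0 < 1 - c * ‖q‖ ^ 2},
        f (point c q (σ * √(1 - c * ‖q‖ ^ 2))) * density c ‖q‖ := by
  have hn : ∀ q : ℂ, ‖q‖ ^ 2 = q.re ^ 2 + q.im ^ 2 := fun q => by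
    rw [← normSq_eq_norm_sq, normSq_apply]
    ring
  have hd : Measurable fun p : ℝ × ℝ =>
      ENNReal.ofReal (1 / √(1 - c * (p.1 ^ 2 + p.2 ^ 2))) := by fun_prop
  have hS : {q : ℂ | 0 < 1 - c * ‖q‖ ^ 2} =
      measurableEquivRealProd ⁻¹' {p : ℝ × ℝ | 0 < 1 - c * (p.1 ^ 2 + p.2 ^ 2)} := by
    ext q
    simp [hn]
  have hfun : (fun q : ℂ => f (point c q (σ * √(1 - c * ‖q‖ ^ 2))) * density c ‖q‖) =
      (fun p : ℝ × ℝ => (ENNReal.ofReal (1 / √(1 - c * (p.1 ^ 2 + p.2 ^ 2)))).toReal •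
        f (lift c σ p)) ∘ measurableEquivRealProd := by
    funext q
    simp only [Function.comp, measurableEquivRealProd_apply, lift_eq_point]
    rw [ENNReal.toReal_ofReal (by positivity), smul_eq_mul, density, hn, mul_comm]
  rw [hfun, hS]
  have hmp := volume_preserving_equiv_real_prod
  constructor
  · rw [(measurableEmbedding_lift c σ).integrable_map_iff, sheetArea,
      integrable_withDensity_iff_integrable_smul' hd (by simp)]
    exact (hmp.integrableOn_comp_preimage measurableEquivRealProd.measurableEmbedding).symm
  · rw [(measurableEmbedding_lift c σ).integral_map, sheetArea,
      integral_withDensity_eq_integral_toReal_smul hd (by simp)]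
    exact (hmp.setIntegral_preimage_emb measurableEquivRealProd.measurableEmbedding _ _).symm

open MeasureTheory in
/-- The area with multiplicities enclosed by a curve in the open upper half of `X²_c`, as a line
integral. -/
theorem integrable_index_and_integral {c L : ℝ} (hL : 0 < L) {z z' : ℝ → ℂ} {η : ℝ → ℝ}
    (hz : ∀ s, HasDerivAt z (z' s) s) (hz' : Continuous z') (hη : Continuous η)
    (hzp : Function.Periodic z L) (hηp : Function.Periodic η L) (hη0 : ∀ s, 0 < η s)
    (hzη : ∀ s, η s ^ 2 + c * ((z s).re ^ 2 + (z s).im ^ 2) = 1) :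
    Integrable (fun P => (index c L (fun s => point c (z s) (η s)) P : ℝ)) (area c) ∧
    areaWithMultiplicities c L (fun s => point c (z s) (η s)) =
      ∫ s in (0 : ℝ)..L, (starRingEnd ℂ (z s) * z' s).im / (1 + η s) := by
  have hzc : Continuous z := continuous_of_hasDerivAt hz
  have hupper := integral_winding_mul_density hL hz hz' hzp hη0 hzη
    (ι := fun q => index c L (fun s => point c (z s) (η s)) (point c q (1 * √(1 - c * ‖q‖ ^ 2))))
    fun q hq hzq => by
      rw [one_mul]
      refine hasWinding_index hL hzc hη hzp hηp hη0 hzη (Real.sqrt_pos.2 hq) ?_ hzq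
      rw [Real.sq_sqrt hq.le, ← normSq_eq_norm_sq, normSq_apply]
      ring
  obtain ⟨h1, h2⟩ := integral_map_lift (c := c) (σ := 1)
    (f := fun P => (index c L (fun s => point c (z s) (η s)) P : ℝ))
  have hlower : Integrable (fun P => (index c L (fun s => point c (z s) (η s)) P : ℝ))
      (if 0 < c then (sheetArea c).map (lift c (-1)) else 0) ∧
      ∫ P, (index c L (fun s => point c (z s) (η s)) P : ℝ)
        ∂(if 0 < c then (sheetArea c).map (lift c (-1)) else 0) = 0 := by
    split_ifs with hc
    · obtain ⟨h3, h4⟩ := integral_map_lift (c := c) (σ := -1)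
        (f := fun P => (index c L (fun s => point c (z s) (η s)) P : ℝ))
      have hS : MeasurableSet {q : ℂ | 0 < 1 - c * ‖q‖ ^ 2} :=
        (isOpen_lt continuous_const (by fun_prop)).measurableSet
      have h5 : Set.EqOn (fun q : ℂ => (index c L (fun s => point c (z s) (η s))
          (point c q (-1 * √(1 - c * ‖q‖ ^ 2))) : ℝ) * density c ‖q‖) (fun _ => 0)
          {q : ℂ | 0 < 1 - c * ‖q‖ ^ 2} := fun q hq => by
        simp only
        rw [index_eq_zero_of_neg hc hL.le hη0 (by
          have := Real.sqrt_pos.2 (Set.mem_ofPred.1 hq)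
          linarith), Int.cast_zero, zero_mul]
      rw [h3, h4, setIntegral_congr_fun hS h5, integrableOn_congr_fun h5 hS]
      simp
    · simp
  rw [areaWithMultiplicities, area, integrable_add_measure]
  refine ⟨⟨h1.2 hupper.1, hlower.1⟩, ?_⟩
  rw [integral_add_measure (h1.2 hupper.1) hlower.1, hlower.2, add_zero, h2, hupper.2]

end SpaceForm

/-! ### Curves on the space form in projected coordinates -/

namespace SpaceForm

open Complex Winding

/-- Reflection in a vertical plane changes the sign of the curvature. -/
theorem IsFrenetCurve.conj {c L : ℝ} {T n g : ℝ → ℂ} {t u h κ κ' : ℝ → ℝ}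
    (F : IsFrenetCurve c L T n g t u h κ κ') :
    IsFrenetCurve c L (fun s => starRingEnd ℂ (T s)) (fun s => -starRingEnd ℂ (n s))
      (fun s => starRingEnd ℂ (g s)) t (fun s => -u s) h (fun s => -κ s) (fun s => -κ' s) where
  isFrame s := by
    have hF := F.isFrame s
    refine ⟨?_, ?_, ?_, ?_, ?_⟩
    · simpa using hF.norm_tangent
    · simpa using hF.inner_eq_zero
    · simpa using hF.norm_point
    · rw [hF.normal_eq]
      simp
    · rw [hF.normal_height]
      simp
      ring
  hasDerivAt_point s := (conjCLE.toContinuousLinearMap.hasFDerivAt.comp_hasDerivAt s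
    (F.hasDerivAt_point s))
  hasDerivAt_height := F.hasDerivAt_height
  hasDerivAt_tangent s := by
    convert! (conjCLE.toContinuousLinearMap.hasFDerivAt.comp_hasDerivAt s
      (F.hasDerivAt_tangent s)) using 1
    simp
  hasDerivAt_tangent_height s := by
    convert! F.hasDerivAt_tangent_height s using 1
    ring
  hasDerivAt_curvature s := (F.hasDerivAt_curvature s).neg
  continuous_deriv_curvature := F.continuous_deriv_curvature.neg
  periodic s := by
    obtain ⟨h1, h2, h3, h4, h5⟩ := F.periodic s
    simp only [h1, h2, h3, h4, h5, and_self]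

theorem hasDerivAt_mk {a b : ℝ → ℝ} {a' b' s : ℝ} (ha : HasDerivAt a a' s)
    (hb : HasDerivAt b b' s) : HasDerivAt (fun s => (⟨a s, b s⟩ : ℂ)) ⟨a', b'⟩ s := by
  simp only [mk_eq_add_mul_I]
  exact ha.ofReal_comp.add (hb.ofReal_comp.mul_const I)

theorem smul_point (c a : ℝ) (z : ℂ) (η : ℝ) : a • point c z η = point c (a * z) (a * η) := by
  ext i
  fin_cases i <;> simp [point, mul_div_assoc]

theorem point_add (c : ℝ) (z w : ℂ) (η χ : ℝ) :
    point c z η + point c w χ = point c (z + w) (η + χ) := by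
  ext i
  fin_cases i <;> simp [point, add_div]

theorem mul_sgn (c : ℝ) : c * sgn c = |c| := by
  unfold sgn
  split_ifs with h
  · rw [abs_of_neg h]
    ring
  · rw [abs_of_nonneg (not_lt.1 h), mul_one]

theorem contDiff_deriv {E : Type*} [NormedAddCommGroup E] [NormedSpace ℝ E] {f : ℝ → E}
    (hf : ContDiff ℝ (⊤ : ℕ∞) f) : ContDiff ℝ (⊤ : ℕ∞) (deriv f) :=
  (contDiff_infty_iff_deriv.1 hf).2

theorem hasDerivAt_apply {f : ℝ → Fin 3 → ℝ} (hf : ContDiff ℝ (⊤ : ℕ∞) f) (i : Fin 3) (s : ℝ) :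
    HasDerivAt (fun s => f s i) (deriv f s i) s :=
  hasDerivAt_pi.1 ((hf.differentiable (by simp)) s).hasDerivAt i

theorem periodic_deriv {E : Type*} [NormedAddCommGroup E] [NormedSpace ℝ E] {f : ℝ → E} {L : ℝ}
    (hf : Function.Periodic f L) : Function.Periodic (deriv f) L := fun s => by
  rw [← deriv_comp_add_const]
  exact congrArg (fun f => deriv f s) (funext hf)

/-- The vertical coordinates `h` and `t`, in the normalization of `IsFrame`, of a curve on
`X²_c`. -/
theorem exists_height {c L : ℝ} {γ : ℝ → Fin 3 → ℝ} (hs : ContDiff ℝ (⊤ : ℕ∞) γ)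
    (hm : ∀ s, γ s ∈ space c) (hper : Function.Periodic γ L)
    (ha : ∀ s, ip c (deriv γ s) (deriv γ s) = 1) :
    ∃ h t t' : ℝ → ℝ, ContDiff ℝ (⊤ : ℕ∞) h ∧ ContDiff ℝ (⊤ : ℕ∞) t ∧
      ContDiff ℝ (⊤ : ℕ∞) t' ∧ (∀ s, HasDerivAt h (c * t s) s) ∧ (∀ s, HasDerivAt t (t' s) s) ∧
      (∀ s, h (s + L) = h s ∧ t (s + L) = t s ∧ t' (s + L) = t' s) ∧
      (∀ s, deriv γ s 0 ^ 2 + deriv γ s 1 ^ 2 + c * t s ^ 2 = 1) ∧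
      (∀ s, deriv γ s 0 * γ s 0 + deriv γ s 1 * γ s 1 + h s * t s = 0) ∧
      (∀ s, h s ^ 2 + c * (γ s 0 ^ 2 + γ s 1 ^ 2) = 1) ∧
      (∀ s, γ s 2 = h s / √|c| ∧ deriv (deriv γ) s 2 = c * t' s / √|c|) ∧
      (c ≤ 0 → ∀ s, 0 < h s) := by
  have hs1 := contDiff_deriv hs
  have hs2 := contDiff_deriv hs1
  have hper1 := periodic_deriv hper
  have hper2 := periodic_deriv hper1
  have hc0 : ∀ {f : ℝ → Fin 3 → ℝ}, ContDiff ℝ (⊤ : ℕ∞) f → ∀ i,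
      ContDiff ℝ (⊤ : ℕ∞) fun s => f s i := fun hf i => contDiff_pi.1 hf i
  have hd := hasDerivAt_apply hs
  have hd1 := hasDerivAt_apply hs1
  by_cases hc : c = 0
  · subst hc
    have h2 : ∀ s, γ s 2 = 0 := fun s => by simpa [space] using hm s
    have h3 : ∀ s, deriv γ s 2 = 0 := fun s => by
      rw [← (hd 2 s).deriv, funext h2, deriv_const]
    have h4 : ∀ s, deriv (deriv γ) s 2 = 0 := fun s => by
      rw [← (hd1 2 s).deriv, funext h3, deriv_const]
    have ht : ∀ s, HasDerivAt (fun s => -(deriv γ s 0 * γ s 0 + deriv γ s 1 * γ s 1)) _ s :=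
      fun s => (((hd1 0 s).mul (hd 0 s)).add ((hd1 1 s).mul (hd 1 s))).neg
    refine ⟨fun _ => 1, _, _, contDiff_const, ?_, ?_, fun s => ?_, ht, fun s => ?_, fun s => ?_,
      fun s => ?_, fun s => ?_, fun s => ?_, fun _ _ => one_pos⟩
    · exact (((hc0 hs1 0).mul (hc0 hs 0)).add ((hc0 hs1 1).mul (hc0 hs 1))).neg
    · exact ((((hc0 hs2 0).mul (hc0 hs 0)).add ((hc0 hs1 0).mul (hc0 hs1 0))).add
        (((hc0 hs2 1).mul (hc0 hs 1)).add ((hc0 hs1 1).mul (hc0 hs1 1)))).neg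
    · rw [zero_mul]
      exact hasDerivAt_const s 1
    · simp only [hper s, hper1 s, hper2 s, and_self]
    · have := ha s
      simp only [ip, h3] at this
      linear_combination this
    · ring
    · ring
    · simp [h2, h4]
  · have h0 : 0 < √|c| := Real.sqrt_pos.2 (abs_pos.2 hc)
    have h1 : √|c| ^ 2 = c * sgn c := by rw [Real.sq_sqrt (abs_nonneg c), mul_sgn]
    have hn : ∀ s, (√|c| * γ s 2) ^ 2 + c * (γ s 0 ^ 2 + γ s 1 ^ 2) = 1 := fun s => by
      have h2 := hm s
      simp only [space, Set.mem_ofPred_eq, if_neg hc, ip] at h2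
      have h3 := h2.1
      field_simp at h3
      rw [mul_pow, h1]
      linear_combination h3
    have hdh : ∀ s, HasDerivAt (fun s => √|c| * γ s 2) (√|c| * deriv γ s 2) s :=
      fun s => (hd 2 s).const_mul _
    refine ⟨fun s => √|c| * γ s 2, fun s => √|c| / c * deriv γ s 2,
      fun s => √|c| / c * deriv (deriv γ) s 2, contDiff_const.mul (hc0 hs 2),
      contDiff_const.mul (hc0 hs1 2), contDiff_const.mul (hc0 hs2 2), fun s => ?_,
      fun s => (hd1 2 s).const_mul _, fun s => ?_, fun s => ?_, fun s => ?_, hn, fun s => ?_,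
      fun hc' s => ?_⟩
    · convert! hdh s using 1
      field_simp
    · simp only [hper s, hper1 s, hper2 s, and_self]
    · have h2 := ha s
      simp only [ip] at h2
      rw [mul_pow, div_pow, h1]
      field_simp
      linear_combination h2
    · have h2 : HasDerivAt (fun s => (√|c| * γ s 2) ^ 2 + c * (γ s 0 ^ 2 + γ s 1 ^ 2)) _ s :=
        ((hdh s).pow 2).add ((((hd 0 s).pow 2).add ((hd 1 s).pow 2)).const_mul c)
      rw [funext hn] at h2
      have h3 := h2.unique (hasDerivAt_const s (1 : ℝ))
      simp at h3
      field_simp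
      linear_combination h3 / 2
    · constructor
      · field_simp
      · field_simp
    · have h2 := hm s
      simp only [space, Set.mem_ofPred_eq, if_neg hc] at h2
      exact mul_pos h0 (h2.2 (lt_of_le_of_ne hc' hc))

/-- A curve on `X²_c` parametrized by arclength, with its signed curvature. -/
theorem exists_isFrenetCurve {c L : ℝ} {γ : ℝ → Fin 3 → ℝ} (hs : ContDiff ℝ (⊤ : ℕ∞) γ)
    (hm : ∀ s, γ s ∈ space c) (hper : Function.Periodic γ L)
    (ha : ∀ s, ip c (deriv γ s) (deriv γ s) = 1) :
    ∃ (T n g : ℝ → ℂ) (t u h κ κ' : ℝ → ℝ), IsFrenetCurve c L T n g t u h κ κ' ∧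
      (∀ s, γ s = point c (g s) (h s)) ∧
      (∀ s, deriv (deriv γ) s + c • γ s = κ s • point c (n s) (c * u s)) ∧
      (c ≤ 0 → ∀ s, 0 < h s) := by
  obtain ⟨h, t, t', hhs, hts, hts', hh, ht, hp, h1, h2, h3, h4, h5⟩ := exists_height hs hm hper ha
  have hs1 := contDiff_deriv hs
  have hs2 := contDiff_deriv hs1
  have hper1 := periodic_deriv hper
  have hper2 := periodic_deriv hper1
  have hc0 : ∀ {f : ℝ → Fin 3 → ℝ}, ContDiff ℝ (⊤ : ℕ∞) f → ∀ i,
      ContDiff ℝ (⊤ : ℕ∞) fun s => f s i := fun hf i => contDiff_pi.1 hf i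
  have hd := hasDerivAt_apply hs
  have hd1 := hasDerivAt_apply hs1
  set g : ℝ → ℂ := fun s => ⟨γ s 0, γ s 1⟩ with hg
  set T : ℝ → ℂ := fun s => ⟨deriv γ s 0, deriv γ s 1⟩ with hT
  set X : ℝ → ℂ := fun s => ⟨deriv (deriv γ) s 0 + c * γ s 0, deriv (deriv γ) s 1 + c * γ s 1⟩
    with hX
  set n : ℝ → ℂ := fun s => I * (h s * T s - c * t s * g s) with hn
  set u : ℝ → ℝ := fun s => (g s).re * (T s).im - (g s).im * (T s).re with hu
  have hF : ∀ s, IsFrame c (T s) (n s) (g s) (t s) (u s) (h s) := fun s =>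
    ⟨h1 s, h2 s, h3 s, rfl, rfl⟩
  set κ : ℝ → ℝ := fun s =>
    (X s).re * (n s).re + (X s).im * (n s).im + c * (u s * (t' s + h s)) with hκ
  have hκs : ContDiff ℝ (⊤ : ℕ∞) κ := by
    have h6 : κ = fun s =>
        (deriv (deriv γ) s 0 + c * γ s 0) * -(h s * deriv γ s 1 - c * t s * γ s 1) +
        (deriv (deriv γ) s 1 + c * γ s 1) * (h s * deriv γ s 0 - c * t s * γ s 0) +
        c * ((γ s 0 * deriv γ s 1 - γ s 1 * deriv γ s 0) * (t' s + h s)) := by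
      funext s
      simp only [hκ, (hF s).normal_re, (hF s).normal_im, hX, hT, hg, hu]
    rw [h6]
    have := hc0 hs 0
    have := hc0 hs 1
    have := hc0 hs1 0
    have := hc0 hs1 1
    have := hc0 hs2 0
    have := hc0 hs2 1
    fun_prop
  have hsplit : ∀ s, X s = κ s * n s ∧ t' s + h s = κ s * u s := fun s => by
    refine (hF s).eq_smul_normal ?_ ?_
    · have h6 : HasDerivAt (fun s => deriv γ s 0 * γ s 0 + deriv γ s 1 * γ s 1 + h s * t s) _ s :=
        (((hd1 0 s).mul (hd 0 s)).add ((hd1 1 s).mul (hd 1 s))).add ((hh s).mul (ht s))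
      rw [funext h2] at h6
      have h7 := h6.unique (hasDerivAt_const s (0 : ℝ))
      simp only [hX, hg]
      linear_combination h7 + h3 s - h1 s
    · have h6 : HasDerivAt (fun s => deriv γ s 0 ^ 2 + deriv γ s 1 ^ 2 + c * t s ^ 2) _ s :=
        (((hd1 0 s).pow 2).add ((hd1 1 s).pow 2)).add (((ht s).pow 2).const_mul c)
      rw [funext h1] at h6
      have h7 := h6.unique (hasDerivAt_const s (1 : ℝ))
      simp at h7
      simp only [hX, hT]
      linear_combination h7 / 2 + c * h2 s
  have hpκ : ∀ s, T (s + L) = T s ∧ g (s + L) = g s ∧ t (s + L) = t s ∧ h (s + L) = h s ∧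
      κ (s + L) = κ s := fun s => by
    obtain ⟨h6, h7, h8⟩ := hp s
    simp only [hκ, hn, hu, hX, hT, hg, h6, h7, h8, hper s, hper1 s, hper2 s, and_self]
  refine ⟨T, n, g, t, u, h, κ, deriv κ, ⟨hF, fun s => hasDerivAt_mk (hd 0 s) (hd 1 s), hh,
    fun s => ?_, fun s => ?_, fun s => (hκs.differentiable (by simp) s).hasDerivAt,
    (contDiff_deriv hκs).continuous, hpκ⟩, fun s => ?_, fun s => ?_, h5⟩
  · convert! hasDerivAt_mk (hd1 0 s) (hd1 1 s) using 1
    rw [← (hsplit s).1]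
    apply Complex.ext
    · simp [hX, hg]
    · simp [hX, hg]
  · convert! ht s using 1
    linarith [(hsplit s).2]
  · ext i
    fin_cases i
    · rfl
    · rfl
    · exact (h4 s).1
  · rw [smul_point, ← (hsplit s).1]
    ext i
    fin_cases i
    · rfl
    · rfl
    · have h6 : κ s * (c * u s) = c * (t' s + h s) := by rw [(hsplit s).2]; ring
      simp [point, (h4 s).1, (h4 s).2, h6]
      ring

end SpaceForm

/-! ### The area enclosed by an evolute in the upper half of the space form -/

namespace SpaceForm

open Complex Winding

theorem sn_inj {c r r' : ℝ} (hr : 0 < r) (hr' : 0 < r') (h : 0 < c → √c * r < Real.pi / 2)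
    (h' : 0 < c → √c * r' < Real.pi / 2) (hs : sn c r = sn c r') : r = r' := by
  unfold sn at hs
  split_ifs at hs with h1 h2
  · have h3 : 0 < √(-c) := Real.sqrt_pos.2 (by linarith)
    rw [div_left_inj' h3.ne', Real.sinh_inj] at hs
    exact mul_left_cancel₀ h3.ne' hs
  · exact hs
  · have hc : 0 < c := lt_of_le_of_ne (not_lt.1 h1) (Ne.symm h2)
    have h3 : 0 < √c := Real.sqrt_pos.2 hc
    have hpi := Real.pi_pos
    rw [div_left_inj' h3.ne'] at hs
    refine mul_left_cancel₀ h3.ne' (Real.injOn_sin ⟨?_, (h hc).le⟩ ⟨?_, (h' hc).le⟩ hs)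
    · linarith [mul_pos h3 hr]
    · linarith [mul_pos h3 hr']

/-- With `k` the curvature in the ambient space, `sn ρ = 1 / k` and `cn ρ = k_g / k`. -/
theorem cn_sn_radius {c : ℝ} {γ : ℝ → Fin 3 → ℝ} {s : ℝ} (h : 0 < geodesicCurvature c γ s)
    (hk : 0 < geodesicCurvature c γ s ^ 2 + c) :
    cn c (radius c γ s) =
        geodesicCurvature c γ s / spaceCurvature c (geodesicCurvature c γ s) ∧
      sn c (radius c γ s) = 1 / spaceCurvature c (geodesicCurvature c γ s) := by
  set κ := geodesicCurvature c γ s with hκ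
  have h1 := spaceCurvature_pos hk
  have h2 := spaceCurvature_sq hk
  obtain ⟨r, hr, hr1, hr2, hr3⟩ := exists_cn_sn_eq (one_div_pos.2 h1) (evolute_coeff hk)
    fun _ => div_pos h h1
  have hr4 : 0 < c → √c * r < Real.pi / 2 := fun hc => by
    by_contra! h3
    have h4 : cn c r ≤ 0 := by
      rw [cn, if_neg (not_lt.2 hc.le), if_neg hc.ne']
      exact Real.cos_nonpos_of_pi_div_two_le_of_le h3 (by linarith [hr1 hc, Real.pi_pos])
    rw [hr2] at h4
    linarith [div_pos h h1]
  have hset : {ρ : ℝ | 0 < ρ ∧ (0 < c → √c * ρ < Real.pi / 2) ∧ κ = cn c ρ / sn c ρ} = {r} := by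
    ext ρ
    simp only [Set.mem_ofPred_eq, Set.mem_singleton_iff]
    constructor
    · rintro ⟨h3, h4, h5⟩
      refine sn_inj h3 hr h4 hr4 ?_
      have h6 : 0 < sn c ρ := sn_pos h3 fun hc => by linarith [h4 hc, Real.pi_pos]
      have h7 := cn_sq_add_sn_sq c ρ
      rw [eq_div_iff h6.ne'] at h5
      rw [← h5] at h7
      have h8 : (sn c ρ * spaceCurvature c κ) ^ 2 = 1 := by
        rw [mul_pow, h2]
        linarith
      have h9 : sn c ρ * spaceCurvature c κ = 1 := by nlinarith [mul_pos h6 h1]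
      rw [hr3, eq_div_iff h1.ne', h9]
    · rintro rfl
      refine ⟨hr, hr4, ?_⟩
      rw [hr2, hr3]
      field_simp
  rw [radius, ← hκ, hset, csInf_singleton, hr2, hr3]
  exact ⟨rfl, rfl⟩

theorem ip_smul_smul (c a : ℝ) (u v : Fin 3 → ℝ) : ip c (a • u) (a • v) = a ^ 2 * ip c u v := by
  simp only [ip, Pi.smul_apply, smul_eq_mul]
  ring

/-- A closed strongly convex curve is, up to a reflection `θ`, a curve with positive curvature in
the coordinates of `IsFrame`. -/
theorem IsClosedStronglyConvex.exists_isFrenetCurve {c L : ℝ} {γ : ℝ → Fin 3 → ℝ}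
    (hγ : IsClosedStronglyConvex c L γ) :
    ∃ θ : ℂ → ℂ, (θ = id ∨ θ = starRingEnd ℂ) ∧ ∃ (T n g : ℝ → ℂ) (t u h κ κ' : ℝ → ℝ),
      IsFrenetCurve c L T n g t u h κ κ' ∧ (∀ s, 0 < κ s) ∧ (∀ s, 0 < κ s ^ 2 + c) ∧
      (c < 0 → ∀ s, √|c| < κ s) ∧ (c ≤ 0 → ∀ s, 0 < h s) ∧
      (∀ s, γ s = point c (θ (g s)) (h s)) ∧
      (∀ s, normal c γ s = point c (θ (n s)) (c * u s)) ∧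
      (∀ s, ambientCurvature c γ s = spaceCurvature c (κ s)) ∧
      ∀ s, evolute c γ s = point c (θ (evolutePoint c (κ s) (n s) (g s)))
        (evoluteHeight c (κ s) (u s) (h s)) := by
  obtain ⟨T, n, g, t, u, h, κ, κ', F, hg, hX, hh⟩ :=
    SpaceForm.exists_isFrenetCurve hγ.smooth hγ.mem_space hγ.closed hγ.arclength
  have hn : ∀ s, ip c (point c (n s) (c * u s)) (point c (n s) (c * u s)) = 1 := fun s => by
    rw [ip_point, show c * u s * (c * u s) / c = c * u s ^ 2 by
      by_cases hc : c = 0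
      · simp [hc]
      · field_simp]
    linear_combination (F.isFrame s).norm_normal
  have hkg : ∀ s, geodesicCurvature c γ s = |κ s| := fun s => by
    rw [geodesicCurvature, hX, ip_smul_smul, hn, mul_one, Real.sqrt_sq_eq_abs]
  have hka : ∀ s, ambientCurvature c γ s = spaceCurvature c (κ s) := fun s => by
    have h1 : deriv (deriv γ) s = point c (κ s * n s - c * g s) (κ s * (c * u s) - c * h s) := by
      have h2 := hX s
      rw [hg, smul_point, smul_point, ← eq_sub_iff_add_eq] at h2
      rw [h2, sub_eq_iff_eq_add, point_add]
      simp
    have h3 : (κ s * (c * u s) - c * h s) * (κ s * (c * u s) - c * h s) / c =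
        c * (κ s * u s - h s) ^ 2 := by
      by_cases hc : c = 0
      · simp [hc]
      · field_simp
    rw [ambientCurvature, spaceCurvature, h1, ip_point, h3]
    congr 1
    simp only [sub_re, sub_im, re_ofReal_mul, im_ofReal_mul]
    linear_combination κ s ^ 2 * (F.isFrame s).norm_normal + c * (F.isFrame s).norm_point -
      2 * κ s * c * (F.isFrame s).inner_normal_point
  have hpos : ∀ s, 0 < |κ s| := fun s => by
    rw [← hkg]
    rcases lt_or_ge c 0 with hc | hc
    · exact lt_of_le_of_lt (Real.sqrt_nonneg _) (hγ.convex_of_neg hc s)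
    · exact hγ.convex_of_nonneg hc s
  have hneg : c < 0 → ∀ s, √|c| < |κ s| := fun hc s => by
    rw [← hkg]
    exact hγ.convex_of_neg hc s
  have hk : ∀ s, 0 < κ s ^ 2 + c := fun s => by
    rcases lt_or_ge c 0 with hc | hc
    · have h1 := hneg hc s
      have h2 := Real.sq_sqrt (abs_nonneg c)
      have h3 := sq_abs (κ s)
      rw [abs_of_neg hc] at h1 h2
      nlinarith [Real.sqrt_nonneg (-c)]
    · have := pow_pos (hpos s) 2
      rw [sq_abs] at this
      linarith
  have hsq : ∀ s, spaceCurvature c |κ s| = spaceCurvature c (κ s) := fun s => by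
    rw [spaceCurvature, sq_abs, spaceCurvature]
  have he : ∀ s, evolute c γ s = (|κ s| / spaceCurvature c (κ s)) • γ s +
      (1 / spaceCurvature c (κ s)) • normal c γ s := fun s => by
    obtain ⟨h1, h2⟩ := cn_sn_radius (c := c) (γ := γ) (s := s) (by rw [hkg]; exact hpos s)
      (by rw [hkg, sq_abs]; exact hk s)
    rw [evolute, h1, h2, hkg, hsq]
  have hsign : (∀ s, 0 < κ s) ∨ ∀ s, κ s < 0 := by
    by_contra! h1
    obtain ⟨⟨a, ha⟩, b, hb⟩ := h1
    obtain ⟨s, hs⟩ := mem_range_of_exists_le_of_exists_ge F.continuous_curvature ⟨a, ha⟩ ⟨b, hb⟩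
    have := hpos s
    simp [hs] at this
  rcases hsign with hκ | hκ
  · have hnor : ∀ s, normal c γ s = point c (n s) (c * u s) := fun s => by
      rw [normal, hkg, abs_of_pos (hκ s), hX, inv_smul_smul₀ (hκ s).ne']
    refine ⟨id, Or.inl rfl, T, n, g, t, u, h, κ, κ', F, hκ, hk, fun hc s => ?_, hh, hg, hnor, hka,
      fun s => ?_⟩
    · rw [← abs_of_pos (hκ s)]
      exact hneg hc s
    · rw [he, hnor, hg, smul_point, smul_point, point_add, abs_of_pos (hκ s), id, evolutePoint,
        evoluteHeight]
      congr 1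
      ring
  · have hnor : ∀ s, normal c γ s = point c (-n s) (c * -u s) := fun s => by
      rw [normal, hkg, abs_of_neg (hκ s), hX, inv_neg, neg_smul, inv_smul_smul₀ (hκ s).ne,
        ← neg_one_smul ℝ (point c (n s) (c * u s)), smul_point]
      simp
    have hsn : ∀ s, spaceCurvature c (-κ s) = spaceCurvature c (κ s) := fun s => by
      rw [spaceCurvature, neg_sq, spaceCurvature]
    refine ⟨starRingEnd ℂ, Or.inr rfl, _, _, _, _, _, _, _, _, F.conj, fun s => neg_pos.2 (hκ s),
      fun s => by rw [neg_sq]; exact hk s, fun hc s => ?_, hh, fun s => ?_, fun s => ?_,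
      fun s => ?_, fun s => ?_⟩
    · rw [← abs_of_neg (hκ s)]
      exact hneg hc s
    · rw [hg, conj_conj]
    · rw [hnor, map_neg, conj_conj]
    · rw [hka, hsn]
    · rw [he, hnor, hg, smul_point, smul_point, point_add, abs_of_neg (hκ s), evolutePoint,
        evoluteHeight, hsn]
      simp only [map_add, map_mul, map_neg, conj_ofReal, conj_conj]
      congr 1
      ring

theorem IsFrenetCurve.periodic_evolute {c L : ℝ} {T n g : ℝ → ℂ} {t u h κ κ' : ℝ → ℝ}
    (F : IsFrenetCurve c L T n g t u h κ κ') (s : ℝ) :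
    evolutePoint c (κ (s + L)) (n (s + L)) (g (s + L)) = evolutePoint c (κ s) (n s) (g s) ∧
      evoluteHeight c (κ (s + L)) (u (s + L)) (h (s + L)) = evoluteHeight c (κ s) (u s) (h s) := by
  obtain ⟨-, h1, -, h2, h3⟩ := F.periodic s
  simp only [h1, h2, h3, F.periodic_normal s, F.periodic_normal_height s, and_self]

open MeasureTheory in
/-- A line integral over a curve with nonpositive winding numbers is nonpositive. -/
theorem integral_nonpos_of_winding_nonpos {c L : ℝ} (hL : 0 < L) {p p' : ℝ → ℂ} {η : ℝ → ℝ}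
    (hp : ∀ s, HasDerivAt p (p' s) s) (hp' : Continuous p') (hper : Function.Periodic p L)
    (hη : ∀ s, 0 < η s) (hpη : ∀ s, η s ^ 2 + c * ((p s).re ^ 2 + (p s).im ^ 2) = 1)
    (h : ∀ q : ℂ, 0 < 1 - c * ‖q‖ ^ 2 → (∀ s, p s ≠ q) →
      ∃ w ≤ 0, HasWinding L (fun s => p s - q) w) :
    ∫ s in (0 : ℝ)..L, (starRingEnd ℂ (p s) * p' s).im / (1 + η s) ≤ 0 := by
  have h1 : ∀ q : ℂ, ∃ w ≤ 0, 0 < 1 - c * ‖q‖ ^ 2 → (∀ s, p s ≠ q) →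
      HasWinding L (fun s => p s - q) w := fun q => by
    by_cases h2 : 0 < 1 - c * ‖q‖ ^ 2 ∧ ∀ s, p s ≠ q
    · obtain ⟨w, hw, hw'⟩ := h q h2.1 h2.2
      exact ⟨w, hw, fun _ _ => hw'⟩
    · exact ⟨0, le_rfl, fun h3 h4 => absurd ⟨h3, h4⟩ h2⟩
  choose ι hι0 hι using h1
  rw [← (integral_winding_mul_density hL hp hp' hper hη hpη hι).2]
  refine integral_nonpos fun q =>
    mul_nonpos_of_nonpos_of_nonneg (Int.cast_nonpos.2 (hι0 q)) ?_
  unfold density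
  positivity

open MeasureTheory in
/-- The area enclosed by the evolute, for a curve that lies together with its evolute in the open
upper half of `X²_c`; this is a restriction on the sphere only. -/
theorem evolute_area {c L : ℝ} {γ : ℝ → Fin 3 → ℝ} (hγ : IsClosedStronglyConvex c L γ)
    (hγ0 : 0 < c → ∀ s, 0 < γ s 2) (he : 0 < c → ∀ s, 0 < evolute c γ s 2) :
    Integrable (fun P => (index c L (evolute c γ) P : ℝ)) (area c) ∧
      (∫ s in (0 : ℝ)..L, ambientCurvature c γ s) - 2 * Real.pi =
        c * |areaWithMultiplicities c L (evolute c γ)| := by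
  obtain ⟨θ, hθ, T, n, g, t, u, h, κ, κ', F, hκ, hk, hκc, hh, hg, hn, hka, hev⟩ :=
    hγ.exists_isFrenetCurve
  have hL := hγ.length_pos
  have hs0 : ∀ hc : 0 < c, 0 < √|c| := fun hc => Real.sqrt_pos.2 (abs_pos.2 hc.ne')
  have hh0 : ∀ s, 0 < h s := fun s => by
    rcases le_or_gt c 0 with hc | hc
    · exact hh hc s
    · have h1 := hγ0 hc s
      rw [hg] at h1
      simpa [point, div_pos_iff_of_pos_right (hs0 hc)] using h1
  have hη0 : ∀ s, 0 < evoluteHeight c (κ s) (u s) (h s) := fun s => by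
    have h1 := spaceCurvature_pos (hk s)
    rcases lt_trichotomy c 0 with hc | hc | hc
    · -- here `κ h > |c| |u|`, since `h² = 1 + |c| (t² + u²)`
      have h2 : evoluteHeight c (κ s) (u s) (h s) =
          (κ s * h s + c * u s) / spaceCurvature c (κ s) := by
        rw [evoluteHeight]
        ring
      rw [h2]
      refine div_pos ?_ h1
      have h3 := (F.isFrame s).norm_height
      have h4 := mul_pos (hκ s) (hh0 s)
      by_contra! h5
      have h6 : (κ s * h s) ^ 2 ≤ (-(c * u s)) ^ 2 := pow_le_pow_left₀ h4.le (by linarith) 2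
      have h7 : -c * h s ^ 2 ≤ (κ s * h s) ^ 2 := by
        rw [mul_pow]
        exact mul_le_mul_of_nonneg_right (by linarith [hk s]) (sq_nonneg _)
      have h8 : 0 ≤ c ^ 2 * t s ^ 2 := by positivity
      nlinarith
    · subst hc
      have h2 : h s = 1 := by
        have h3 := (F.isFrame s).norm_point
        have h4 := hh0 s
        nlinarith
      have h3 : spaceCurvature 0 (κ s) = κ s := by
        rw [spaceCurvature, add_zero, Real.sqrt_sq (hκ s).le]
      rw [evoluteHeight, h3, h2, div_self (hκ s).ne']
      simp
    · have h2 := he hc s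
      rw [hev] at h2
      simpa [point, div_pos_iff_of_pos_right (hs0 hc)] using h2
  have hi : Set.InjOn g (Set.Ico 0 L) := fun a ha b hb hab => by
    refine hγ.simple ha hb ?_
    have h1 : h a = h b := by
      have h2 := (F.isFrame a).norm_point
      have h3 := (F.isFrame b).norm_point
      rw [hab] at h2
      nlinarith [hh0 a, hh0 b]
    rw [hg, hg, hab, h1]
  obtain ⟨hw, hA⟩ := F.evolute_winding_and_integral hL hi hk hh0 hη0
  have E := F.isFrontal_evolute hk
  have hpη := fun s => (E.isFrame s).norm_point
  have hp' : Continuous fun s =>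
      (evoluteSpeed c (κ s) (κ' s) * evoluteTangent c (κ s) (n s) (g s)) :=
    (continuous_ofReal.comp E.continuous_τ).mul (continuous_of_hasDerivAt E.hasDerivAt_N)
  have hηc := continuous_of_hasDerivAt E.hasDerivAt_η
  have hA0 := integral_nonpos_of_winding_nonpos hL E.hasDerivAt_B hp'
    (fun s => (F.periodic_evolute s).1) hη0 hpη fun q hq => hw q (by
      rw [← normSq_eq_norm_sq, normSq_apply] at hq
      linarith)
  set A := ∫ s in (0 : ℝ)..L, (starRingEnd ℂ (evolutePoint c (κ s) (n s) (g s)) *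
      (evoluteSpeed c (κ s) (κ' s) * evoluteTangent c (κ s) (n s) (g s))).im /
        (1 + evoluteHeight c (κ s) (u s) (h s)) with hAdef
  rw [funext hka]
  suffices hs : Integrable (fun P => (index c L (evolute c γ) P : ℝ)) (area c) ∧
      |areaWithMultiplicities c L (evolute c γ)| = -A from
    ⟨hs.1, by rw [hs.2]; linarith⟩
  rcases hθ with rfl | rfl
  · have h1 := integrable_index_and_integral hL E.hasDerivAt_B hp' hηc
      (fun s => (F.periodic_evolute s).1) (fun s => (F.periodic_evolute s).2) hη0 hpη
    have h2 : evolute c γ = fun s => point c (evolutePoint c (κ s) (n s) (g s))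
        (evoluteHeight c (κ s) (u s) (h s)) := funext hev
    rw [h2]
    exact ⟨h1.1, by rw [h1.2, abs_of_nonpos hA0]⟩
  · have hd : ∀ s, HasDerivAt (fun s => starRingEnd ℂ (evolutePoint c (κ s) (n s) (g s)))
        (starRingEnd ℂ (evoluteSpeed c (κ s) (κ' s) * evoluteTangent c (κ s) (n s) (g s))) s :=
      fun s => conjCLE.toContinuousLinearMap.hasFDerivAt.comp_hasDerivAt s (E.hasDerivAt_B s)
    have h1 := integrable_index_and_integral hL hd (continuous_conj.comp hp') hηc
      (fun s => congrArg (starRingEnd ℂ) (F.periodic_evolute s).1)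
      (fun s => (F.periodic_evolute s).2) hη0 (fun s => by simpa using hpη s)
    have h2 : evolute c γ = fun s => point c (starRingEnd ℂ (evolutePoint c (κ s) (n s) (g s)))
        (evoluteHeight c (κ s) (u s) (h s)) := funext hev
    rw [h2]
    refine ⟨h1.1, ?_⟩
    rw [h1.2, ← abs_neg, ← intervalIntegral.integral_neg, ← abs_of_nonpos hA0, hAdef]
    congr 2
    funext s
    rw [← map_mul, conj_im]
    ring

end SpaceForm

/-! ### Rotations of the sphere -/

namespace SpaceForm

open Matrix

theorem ip_eq_dotProduct {c : ℝ} (hc : 0 < c) (u v : Fin 3 → ℝ) : ip c u v = u ⬝ᵥ v := by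
  simp [ip, sgn, not_lt.2 hc.le, Fin.sum_univ_three, dotProduct]

theorem ip_mulVec {c : ℝ} (hc : 0 < c) {M : Matrix (Fin 3) (Fin 3) ℝ}
    (hM : Mᵀ * M = 1) (u v : Fin 3 → ℝ) : ip c (M *ᵥ u) (M *ᵥ v) = ip c u v := by
  rw [ip_eq_dotProduct hc, ip_eq_dotProduct hc, dotProduct_mulVec, vecMul_mulVec, hM, vecMul_one]

theorem exists_rotation {v : Fin 3 → ℝ} (hv : v ⬝ᵥ v = 1) :
    ∃ M : Matrix (Fin 3) (Fin 3) ℝ, Mᵀ * M = 1 ∧ M.det = 1 ∧ M *ᵥ v = ![0, 0, 1] := by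
  suffices h : ∃ M : Matrix (Fin 3) (Fin 3) ℝ, M * Mᵀ = 1 ∧ M.det = 1 ∧ M *ᵥ v = ![0, 0, 1] by
    obtain ⟨M, h1, h2⟩ := h
    exact ⟨M, mul_eq_one_comm.1 h1, h2⟩
  have hv' : v 0 ^ 2 + v 1 ^ 2 + v 2 ^ 2 = 1 := by
    simp [dotProduct, Fin.sum_univ_three] at hv
    linarith
  by_cases h2 : 1 + v 2 = 0
  · have h3 : v 2 = -1 := by linarith
    have h0 : v 0 = 0 := by nlinarith [sq_nonneg (v 0), sq_nonneg (v 1)]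
    have h1 : v 1 = 0 := by nlinarith [sq_nonneg (v 0), sq_nonneg (v 1)]
    refine ⟨!![1, 0, 0; 0, -1, 0; 0, 0, -1], ?_, ?_, ?_⟩
    · ext i j
      fin_cases i <;> fin_cases j <;> simp [Matrix.mul_apply, Fin.sum_univ_three]
    · simp [Matrix.det_fin_three]
    · ext i
      fin_cases i <;> simp [Matrix.mulVec, dotProduct, Fin.sum_univ_three, h0, h1, h3]
  · set d := (1 + v 2)⁻¹ with hd
    have hd1 : d * (1 + v 2) = 1 := inv_mul_cancel₀ h2
    refine ⟨!![1 - d * v 0 ^ 2, -(d * v 0 * v 1), -v 0; -(d * v 0 * v 1), 1 - d * v 1 ^ 2, -v 1;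
      v 0, v 1, v 2], ?_, ?_, ?_⟩
    · clear_value d
      ext i j
      fin_cases i <;> fin_cases j <;> simp [Matrix.mul_apply, Fin.sum_univ_three] <;> grind
    · clear_value d
      simp [Matrix.det_fin_three]
      grind
    · clear_value d
      ext i
      fin_cases i <;> simp [Matrix.mulVec, dotProduct, Fin.sum_univ_three] <;> grind

theorem deriv_mulVec (M : Matrix (Fin 3) (Fin 3) ℝ) {γ : ℝ → Fin 3 → ℝ}
    (hγ : ContDiff ℝ (⊤ : ℕ∞) γ) :
    deriv (fun s => M *ᵥ γ s) = fun s => M *ᵥ deriv γ s := by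
  funext s
  exact (M.mulVecLin.toContinuousLinearMap.hasFDerivAt.comp_hasDerivAt s
    (hγ.differentiable (by simp) s).hasDerivAt).deriv

section

variable {c L : ℝ} {M : Matrix (Fin 3) (Fin 3) ℝ} {γ : ℝ → Fin 3 → ℝ}

theorem geodesicCurvature_mulVec (hc : 0 < c) (hM : Mᵀ * M = 1) (hγ : ContDiff ℝ (⊤ : ℕ∞) γ) :
    geodesicCurvature c (fun s => M *ᵥ γ s) = geodesicCurvature c γ := by
  funext s
  rw [geodesicCurvature, geodesicCurvature, deriv_mulVec M hγ, deriv_mulVec M (contDiff_deriv hγ),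
    ← mulVec_smul, ← mulVec_add, ip_mulVec hc hM]

theorem ambientCurvature_mulVec (hc : 0 < c) (hM : Mᵀ * M = 1) (hγ : ContDiff ℝ (⊤ : ℕ∞) γ) :
    ambientCurvature c (fun s => M *ᵥ γ s) = ambientCurvature c γ := by
  funext s
  rw [ambientCurvature, ambientCurvature, deriv_mulVec M hγ, deriv_mulVec M (contDiff_deriv hγ),
    ip_mulVec hc hM]

theorem normal_mulVec (hc : 0 < c) (hM : Mᵀ * M = 1) (hγ : ContDiff ℝ (⊤ : ℕ∞) γ) :
    normal c (fun s => M *ᵥ γ s) = fun s => M *ᵥ normal c γ s := by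
  funext s
  rw [normal, normal, geodesicCurvature_mulVec hc hM hγ, deriv_mulVec M hγ,
    deriv_mulVec M (contDiff_deriv hγ), ← mulVec_smul, ← mulVec_add, ← mulVec_smul]

theorem evolute_mulVec (hc : 0 < c) (hM : Mᵀ * M = 1) (hγ : ContDiff ℝ (⊤ : ℕ∞) γ) :
    evolute c (fun s => M *ᵥ γ s) = fun s => M *ᵥ evolute c γ s := by
  funext s
  rw [evolute, evolute, radius, geodesicCurvature_mulVec hc hM hγ, ← radius,
    normal_mulVec hc hM hγ, mulVec_add, mulVec_smul, mulVec_smul]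

theorem mulVec_left_injective (hM : Mᵀ * M = 1) : Function.Injective fun u => M *ᵥ u :=
  Function.LeftInverse.injective (g := fun u => Mᵀ *ᵥ u) fun u => by
    simp only [mulVec_mulVec, hM, one_mulVec]

theorem IsClosedStronglyConvex.mulVec (hc : 0 < c) (hM : Mᵀ * M = 1)
    (hγ : IsClosedStronglyConvex c L γ) : IsClosedStronglyConvex c L fun s => M *ᵥ γ s where
  length_pos := hγ.length_pos
  smooth := M.mulVecLin.toContinuousLinearMap.contDiff.comp hγ.smooth
  mem_space s := by
    have h1 := hγ.mem_space s
    simp only [space, Set.mem_ofPred_eq, if_neg hc.ne', ip_mulVec hc hM] at h1 ⊢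
    exact ⟨h1.1, fun h => absurd h (not_lt.2 hc.le)⟩
  arclength s := by
    rw [deriv_mulVec M hγ.smooth, ip_mulVec hc hM]
    exact hγ.arclength s
  closed s := by simp only [hγ.closed s]
  simple := (mulVec_left_injective hM).comp_injOn hγ.simple
  convex_of_nonneg h s := by
    rw [geodesicCurvature_mulVec hc hM hγ.smooth]
    exact hγ.convex_of_nonneg h s
  convex_of_neg h := absurd h (not_lt.2 hc.le)

theorem normalVec_mulVec (hc : 0 < c) (P : Fin 3 → ℝ) :
    normalVec c (M *ᵥ P) = M *ᵥ normalVec c P := by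
  simp only [normalVec, if_neg hc.ne']

theorem IsPositiveFrame.mulVec (hc : 0 < c) (hM : Mᵀ * M = 1) (hdet : M.det = 1)
    {P e₁ e₂ : Fin 3 → ℝ} (he : IsPositiveFrame c P e₁ e₂) :
    IsPositiveFrame c (M *ᵥ P) (M *ᵥ e₁) (M *ᵥ e₂) where
  tangent₁ := by rw [normalVec_mulVec hc, ip_mulVec hc hM, he.tangent₁]
  tangent₂ := by rw [normalVec_mulVec hc, ip_mulVec hc hM, he.tangent₂]
  unit₁ := by rw [ip_mulVec hc hM, he.unit₁]
  unit₂ := by rw [ip_mulVec hc hM, he.unit₂]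
  orthogonal := by rw [ip_mulVec hc hM, he.orthogonal]
  positive := by
    have h1 : Matrix.of ![M *ᵥ e₁, M *ᵥ e₂, normalVec c (M *ᵥ P)] =
        Matrix.of ![e₁, e₂, normalVec c P] * Mᵀ := by
      rw [normalVec_mulVec hc]
      ext i j
      fin_cases i <;> simp [Matrix.mul_apply, Matrix.mulVec, dotProduct, mul_comm]
    rw [h1, det_mul, det_transpose, hdet, mul_one]
    exact he.positive

theorem HasIndex.mulVec (hc : 0 < c) (hM : Mᵀ * M = 1) (hdet : M.det = 1) {P : Fin 3 → ℝ} {m : ℤ}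
    (h : HasIndex c L γ P m) : HasIndex c L (fun s => M *ᵥ γ s) (M *ᵥ P) m := by
  obtain ⟨e₁, e₂, he, r, ψ, hψ, hr, hm⟩ := h
  refine ⟨_, _, he.mulVec hc hM hdet, r, ψ, hψ, fun s hs => ⟨(hr s hs).1, (hr s hs).2.1, ?_⟩, hm⟩
  simp only [(hr s hs).2.2, expPolar, mulVec_add, mulVec_smul]

theorem InOpenHemisphere.mulVec (hc : 0 < c) (hM : Mᵀ * M = 1) {A : Set (Fin 3 → ℝ)}
    (h : InOpenHemisphere c A) : InOpenHemisphere c ((fun u => M *ᵥ u) '' A) := by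
  obtain ⟨v, hv⟩ := h
  refine ⟨M *ᵥ v, ?_⟩
  rintro - ⟨u, hu, rfl⟩
  rw [ip_mulVec hc hM]
  exact hv u hu

/-- The index depends on the curve and the point only through the set of the winding numbers and
the hemisphere condition, although it is defined by a choice. -/
theorem index_congr {γ' : ℝ → Fin 3 → ℝ} {P P' : Fin 3 → ℝ}
    (h1 : HasIndex c L γ P = HasIndex c L γ' P')
    (h2 : InOpenHemisphere c (insert P (γ '' Set.Icc 0 L)) =
      InOpenHemisphere c (insert P' (γ' '' Set.Icc 0 L))) :
    index c L γ P = index c L γ' P' := by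
  have h3 : ∀ (p q : ℤ → Prop) (hp : ∃ m, p m) (hq : ∃ m, q m), p = q → hp.choose = hq.choose := by
    rintro p - hp hq rfl
    rfl
  by_cases h : (0 < c → InOpenHemisphere c (insert P (γ '' Set.Icc 0 L))) ∧ ∃ m, HasIndex c L γ P m
  · have h' := h
    rw [h1, h2] at h'
    rw [index, index, dif_pos h, dif_pos h']
    exact h3 _ _ _ _ h1
  · have h' := h
    rw [h1, h2] at h'
    rw [index, index, dif_neg h, dif_neg h']

theorem index_mulVec (hc : 0 < c) (hM : Mᵀ * M = 1) (hdet : M.det = 1) (P : Fin 3 → ℝ) :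
    index c L (fun s => M *ᵥ γ s) (M *ᵥ P) = index c L γ P := by
  have hM' : Mᵀᵀ * Mᵀ = 1 := by
    rw [transpose_transpose]
    exact mul_eq_one_comm.1 hM
  have hinv : ∀ u, Mᵀ *ᵥ (M *ᵥ u) = u := fun u => by rw [mulVec_mulVec, hM, one_mulVec]
  have h1 : HasIndex c L (fun s => M *ᵥ γ s) (M *ᵥ P) = HasIndex c L γ P := by
    funext m
    refine propext ⟨fun h => ?_, fun h => h.mulVec hc hM hdet⟩
    simpa only [hinv] using h.mulVec hc hM' ((det_transpose M).trans hdet)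
  have h2 : InOpenHemisphere c (insert (M *ᵥ P) ((fun s => M *ᵥ γ s) '' Set.Icc 0 L)) =
      InOpenHemisphere c (insert P (γ '' Set.Icc 0 L)) := by
    have h3 : insert (M *ᵥ P) ((fun s => M *ᵥ γ s) '' Set.Icc 0 L) =
        (fun u => M *ᵥ u) '' insert P (γ '' Set.Icc 0 L) := by
      rw [Set.image_insert_eq, Set.image_image]
    rw [h3]
    refine propext ⟨fun h => ?_, fun h => h.mulVec hc hM⟩
    have h4 := h.mulVec hc hM'
    simpa only [Set.image_image, hinv, Set.image_id'] using h4
  exact index_congr h1 h2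

end

end SpaceForm

/-! ### Invariance of the area of the sphere under rotations -/

namespace SpaceForm

open Matrix MeasureTheory Set
open scoped ENNReal

theorem measurePreserving_axis :
    MeasurePreserving (fun x : Fin 3 → ℝ => (x 2, (x 0, x 1))) volume
      ((volume : Measure ℝ).prod (volume : Measure (ℝ × ℝ))) := by
  have h1 := volume_preserving_piFinSuccAbove (fun _ : Fin 3 => ℝ) 2
  have h2 := (MeasurePreserving.id (volume : Measure ℝ)).prod (volume_preserving_finTwoArrow ℝ)
  exact h2.comp h1

/-- The differential of `x ↦ x₂ • lift c σ (x₀, x₁)`. -/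
noncomputable def coneDeriv (c σ : ℝ) (x : Fin 3 → ℝ) : Matrix (Fin 3) (Fin 3) ℝ :=
  !![x 2, 0, x 0; 0, x 2, x 1;
    -(x 2 * σ * x 0 / √((1 - c * (x 0 ^ 2 + x 1 ^ 2)) / c)),
    -(x 2 * σ * x 1 / √((1 - c * (x 0 ^ 2 + x 1 ^ 2)) / c)),
    σ * √((1 - c * (x 0 ^ 2 + x 1 ^ 2)) / c)]

section

variable {c σ : ℝ}

theorem lift_two (hc : 0 < c) (p : ℝ × ℝ) :
    lift c σ p 2 = σ * √((1 - c * (p.1 ^ 2 + p.2 ^ 2)) / c) := by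
  simp [lift, hc.ne', abs_of_pos hc]

theorem hasFDerivAt_cone (hc : 0 < c) {x : Fin 3 → ℝ} (hx : 0 < 1 - c * (x 0 ^ 2 + x 1 ^ 2)) :
    HasFDerivAt (fun x : Fin 3 → ℝ => x 2 • lift c σ (x 0, x 1))
      (coneDeriv c σ x).mulVecLin.toContinuousLinearMap x := by
  have h0 := hasFDerivAt_apply (𝕜 := ℝ) (0 : Fin 3) x
  have h1 := hasFDerivAt_apply (𝕜 := ℝ) (1 : Fin 3) x
  have h2 := hasFDerivAt_apply (𝕜 := ℝ) (2 : Fin 3) x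
  have hw : 0 < (1 - c * (x 0 ^ 2 + x 1 ^ 2)) / c := div_pos hx hc
  refine hasFDerivAt_pi'.2 fun i => ?_
  fin_cases i
  · convert! h2.mul h0 using 1
    ext v
    simp [coneDeriv, dotProduct, Fin.sum_univ_three]
  · convert! h2.mul h1 using 1
    ext v
    simp [coneDeriv, dotProduct, Fin.sum_univ_three]
  · have h3 : HasFDerivAt (fun x : Fin 3 → ℝ => (1 - c * (x 0 ^ 2 + x 1 ^ 2)) / c) _ x :=
      (((h0.pow 2).add (h1.pow 2)).const_mul c |>.const_sub 1).mul_const c⁻¹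
    have h4 := h2.mul ((h3.sqrt hw.ne').const_mul σ)
    have h5 : (fun x : Fin 3 → ℝ => (x 2 • lift c σ (x 0, x 1)) 2) = fun x =>
        x 2 * (σ * √((1 - c * (x 0 ^ 2 + x 1 ^ 2)) / c)) := by
      funext x
      rw [Pi.smul_apply, lift_two hc, smul_eq_mul]
    simp only [Fin.reduceFinMk]
    rw [h5]
    convert! h4 using 1
    ext v
    have := (Real.sqrt_pos.2 hw).ne'
    simp [coneDeriv, dotProduct, Fin.sum_univ_three]
    field_simp
    ring

theorem abs_det_coneDeriv (hc : 0 < c) (hσ : σ ^ 2 = 1) {x : Fin 3 → ℝ}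
    (hx : 0 < 1 - c * (x 0 ^ 2 + x 1 ^ 2)) :
    |(coneDeriv c σ x).mulVecLin.toContinuousLinearMap.det| =
      x 2 ^ 2 / √c * (1 / √(1 - c * (x 0 ^ 2 + x 1 ^ 2))) := by
  have h1 : (coneDeriv c σ x).mulVecLin.toContinuousLinearMap.det = (coneDeriv c σ x).det := by
    rw [ContinuousLinearMap.det, LinearMap.coe_toContinuousLinearMap, ← toLin'_apply',
      LinearMap.det_toLin']
  have hw : 0 < (1 - c * (x 0 ^ 2 + x 1 ^ 2)) / c := div_pos hx hc
  set w := √((1 - c * (x 0 ^ 2 + x 1 ^ 2)) / c) with hwdef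
  have hw0 : 0 < w := Real.sqrt_pos.2 hw
  have hw2 : c * w ^ 2 = 1 - c * (x 0 ^ 2 + x 1 ^ 2) := by
    rw [Real.sq_sqrt hw.le]
    field_simp
  have hwc : √(1 - c * (x 0 ^ 2 + x 1 ^ 2)) = √c * w := by
    rw [← hw2, Real.sqrt_mul hc.le, Real.sqrt_sq hw0.le]
  have h2 : (coneDeriv c σ x).det = σ * (x 2 ^ 2 / (c * w)) := by
    simp [coneDeriv, Matrix.det_fin_three, ← hwdef]
    field_simp
    linear_combination σ * x 2 ^ 2 * hw2
  have h3 : |σ| = 1 := by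
    rw [← Real.sqrt_sq_eq_abs, hσ, Real.sqrt_one]
  have h4 : √c ^ 2 = c := Real.sq_sqrt hc.le
  have h5 : 0 < √c := Real.sqrt_pos.2 hc
  rw [h1, h2, abs_mul, h3, one_mul, abs_of_nonneg (by positivity), hwc]
  field_simp
  rw [h4]

theorem lift_dotProduct_self (hc : 0 < c) (hσ : σ ^ 2 = 1) {p : ℝ × ℝ}
    (hp : 0 < 1 - c * (p.1 ^ 2 + p.2 ^ 2)) : c * (lift c σ p ⬝ᵥ lift c σ p) = 1 := by
  have h1 := Real.sq_sqrt (div_pos hp hc).le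
  simp only [dotProduct, Fin.sum_univ_three, lift_two hc]
  simp only [lift, Matrix.cons_val_zero, Matrix.cons_val_one]
  rw [mul_mul_mul_comm, ← pow_two, ← pow_two, ← pow_two, ← pow_two, hσ, h1]
  field_simp
  ring

/-- The central projection to the sphere. -/
noncomputable def centralProj (c : ℝ) (x : Fin 3 → ℝ) : Fin 3 → ℝ := (√(c * (x ⬝ᵥ x)))⁻¹ • x

theorem centralProj_smul_lift (hc : 0 < c) (hσ : σ ^ 2 = 1) {p : ℝ × ℝ}
    (hp : 0 < 1 - c * (p.1 ^ 2 + p.2 ^ 2)) {r : ℝ} (hr : 0 < r) :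
    centralProj c (r • lift c σ p) = lift c σ p := by
  have h1 := lift_dotProduct_self hc hσ hp
  rw [centralProj, dotProduct_smul, smul_dotProduct, smul_eq_mul, smul_eq_mul,
    show c * (r * (r * (lift c σ p ⬝ᵥ lift c σ p))) = r ^ 2 by linear_combination r ^ 2 * h1,
    Real.sqrt_sq hr.le, inv_smul_smul₀ hr.ne']

theorem image_cone (hc : 0 < c) (hσ : σ ^ 2 = 1) :
    (fun x : Fin 3 → ℝ => x 2 • lift c σ (x 0, x 1)) ''
      {x | 0 < x 2 ∧ x 2 < 1 ∧ 0 < 1 - c * (x 0 ^ 2 + x 1 ^ 2)} =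
      {x | 0 < σ * x 2 ∧ c * (x ⬝ᵥ x) < 1} := by
  ext y
  constructor
  · rintro ⟨x, ⟨h1, h2, h3⟩, rfl⟩
    have h4 := lift_dotProduct_self hc hσ (p := (x 0, x 1)) h3
    refine ⟨?_, ?_⟩
    · simp only [Pi.smul_apply, smul_eq_mul, lift_two hc]
      have h5 : 0 < √((1 - c * (x 0 ^ 2 + x 1 ^ 2)) / c) := Real.sqrt_pos.2 (div_pos h3 hc)
      rw [show ∀ w, σ * (x 2 * (σ * w)) = σ ^ 2 * (x 2 * w) by intro w; ring, hσ, one_mul]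
      exact mul_pos h1 h5
    · simp only [dotProduct_smul, smul_dotProduct, smul_eq_mul]
      rw [show ∀ w, c * (x 2 * (x 2 * w)) = x 2 ^ 2 * (c * w) by intro w; ring, h4, mul_one]
      nlinarith
  · rintro ⟨h1, h2⟩
    have hd : y ⬝ᵥ y = y 0 ^ 2 + y 1 ^ 2 + y 2 ^ 2 := by
      simp [dotProduct, Fin.sum_univ_three, pow_two]
    have hy2 : 0 < y 2 ^ 2 := by
      have := mul_pos h1 h1
      rw [show σ * y 2 * (σ * y 2) = σ ^ 2 * y 2 ^ 2 by ring, hσ, one_mul] at this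
      exact this
    have h3 : 0 < c * (y ⬝ᵥ y) := by
      rw [hd]
      exact mul_pos hc (by nlinarith [sq_nonneg (y 0), sq_nonneg (y 1)])
    set r := √(c * (y ⬝ᵥ y)) with hr
    have hr0 : 0 < r := Real.sqrt_pos.2 h3
    have hr2 : r ^ 2 = c * (y ⬝ᵥ y) := Real.sq_sqrt h3.le
    have h4 : 1 - c * ((y 0 / r) ^ 2 + (y 1 / r) ^ 2) = c * (σ * y 2 / r) ^ 2 := by
      field_simp
      rw [hσ, hr2, hd]
      ring
    refine ⟨![y 0 / r, y 1 / r, r], ⟨hr0, ?_, ?_⟩, ?_⟩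
    · rw [hr]
      simpa using (Real.sqrt_lt_sqrt h3.le h2).trans_eq Real.sqrt_one
    · change 0 < 1 - c * ((y 0 / r) ^ 2 + (y 1 / r) ^ 2)
      rw [h4]
      positivity
    · change r • lift c σ (y 0 / r, y 1 / r) = y
      ext i
      fin_cases i
      · simp [lift]
        field_simp
      · simp [lift]
        field_simp
      · change r * lift c σ (y 0 / r, y 1 / r) 2 = y 2
        rw [lift_two hc, h4, mul_div_cancel_left₀ _ hc.ne', Real.sqrt_sq (by positivity)]
        field_simp
        rw [hσ, one_mul]

theorem injOn_cone (hc : 0 < c) (hσ : σ ^ 2 = 1) :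
    InjOn (fun x : Fin 3 → ℝ => x 2 • lift c σ (x 0, x 1))
      {x | 0 < x 2 ∧ x 2 < 1 ∧ 0 < 1 - c * (x 0 ^ 2 + x 1 ^ 2)} := by
  rintro x ⟨hx1, -, hx3⟩ y ⟨hy1, -, hy3⟩ hxy
  simp only at hxy
  have h1 : lift c σ (x 0, x 1) = lift c σ (y 0, y 1) := by
    rw [← centralProj_smul_lift hc hσ (p := (x 0, x 1)) hx3 hx1, hxy,
      centralProj_smul_lift hc hσ (p := (y 0, y 1)) hy3 hy1]
  have h2 : x 2 = y 2 := by
    have h3 : lift c σ (y 0, y 1) ≠ 0 := fun h => by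
      have := lift_dotProduct_self hc hσ (p := (y 0, y 1)) hy3
      simp [h] at this
    rw [h1] at hxy
    exact smul_left_injective ℝ h3 hxy
  have h4 := congrFun h1 0
  have h5 := congrFun h1 1
  simp [lift] at h4 h5
  ext i
  fin_cases i
  · exact h4
  · exact h5
  · exact h2

theorem measurable_centralProj : Measurable (centralProj c) := by
  unfold centralProj dotProduct
  fun_prop

/-- Integration over the upper or the lower half of the solid ball in the coordinates
`x₂ • lift c σ (x₀, x₁)`, which separates the radius from the area of the sphere. -/
theorem lintegral_halfBall (hc : 0 < c) (hσ : σ ^ 2 = 1) {f : (Fin 3 → ℝ) → ℝ≥0∞}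
    (hf : Measurable f) :
    ∫⁻ x in {x | 0 < σ * x 2 ∧ c * (x ⬝ᵥ x) < 1}, f (centralProj c x) =
      ENNReal.ofReal (1 / (3 * √c)) * ∫⁻ P, f P ∂((sheetArea c).map (lift c σ)) := by
  have hD : MeasurableSet {p : ℝ × ℝ | 0 < 1 - c * (p.1 ^ 2 + p.2 ^ 2)} :=
    (isOpen_lt continuous_const (by fun_prop)).measurableSet
  have hl := (measurableEmbedding_lift c σ).measurable
  have hS : {x : Fin 3 → ℝ | 0 < x 2 ∧ x 2 < 1 ∧ 0 < 1 - c * (x 0 ^ 2 + x 1 ^ 2)} =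
      (fun x : Fin 3 → ℝ => (x 2, (x 0, x 1))) ⁻¹'
        (Ioo 0 1 ×ˢ {p : ℝ × ℝ | 0 < 1 - c * (p.1 ^ 2 + p.2 ^ 2)}) := by
    ext x
    simp [and_assoc]
  have hSm : MeasurableSet
      {x : Fin 3 → ℝ | 0 < x 2 ∧ x 2 < 1 ∧ 0 < 1 - c * (x 0 ^ 2 + x 1 ^ 2)} := by
    rw [hS]
    exact measurePreserving_axis.measurable (measurableSet_Ioo.prod hD)
  have hd : Measurable fun p : ℝ × ℝ =>
      ENNReal.ofReal (1 / √(1 - c * (p.1 ^ 2 + p.2 ^ 2))) := by fun_prop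
  rw [← image_cone hc hσ, lintegral_image_eq_lintegral_abs_det_fderiv_mul volume hSm
    (fun x hx => (hasFDerivAt_cone hc hx.2.2).hasFDerivWithinAt) (injOn_cone hc hσ)]
  set G : ℝ × (ℝ × ℝ) → ℝ≥0∞ := fun y => ENNReal.ofReal (y.1 ^ 2 / √c) *
    (ENNReal.ofReal (1 / √(1 - c * (y.2.1 ^ 2 + y.2.2 ^ 2))) * f (lift c σ y.2)) with hG
  have hW : Measurable fun p : ℝ × ℝ =>
      ENNReal.ofReal (1 / √(1 - c * (p.1 ^ 2 + p.2 ^ 2))) * f (lift c σ p) := hd.mul (hf.comp hl)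
  have hV : Measurable fun r : ℝ => ENNReal.ofReal (r ^ 2 / √c) := by fun_prop
  have hGm : Measurable G := (hV.comp measurable_fst).mul (hW.comp measurable_snd)
  have h1 : ∫⁻ x in {x : Fin 3 → ℝ | 0 < x 2 ∧ x 2 < 1 ∧ 0 < 1 - c * (x 0 ^ 2 + x 1 ^ 2)},
      ENNReal.ofReal |(coneDeriv c σ x).mulVecLin.toContinuousLinearMap.det| *
        f (centralProj c (x 2 • lift c σ (x 0, x 1))) =
      ∫⁻ x in {x : Fin 3 → ℝ | 0 < x 2 ∧ x 2 < 1 ∧ 0 < 1 - c * (x 0 ^ 2 + x 1 ^ 2)},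
        G (x 2, (x 0, x 1)) := by
    refine setLIntegral_congr_fun hSm fun x hx => ?_
    rw [abs_det_coneDeriv hc hσ hx.2.2, centralProj_smul_lift hc hσ (p := (x 0, x 1)) hx.2.2 hx.1,
      ENNReal.ofReal_mul (by have := hx.1; positivity), mul_assoc]
  rw [h1, hS, measurePreserving_axis.setLIntegral_comp_preimage (measurableSet_Ioo.prod hD) hGm,
    ← Measure.prod_restrict, hG,
    lintegral_prod_mul hV.aemeasurable hW.aemeasurable]
  congr 1
  · have h2 : 0 < √c := Real.sqrt_pos.2 hc
    rw [← ofReal_integral_eq_lintegral_ofReal]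
    · congr 1
      rw [← integral_Ioc_eq_integral_Ioo, ← intervalIntegral.integral_of_le zero_le_one,
        intervalIntegral.integral_div, integral_pow]
      norm_num
      field_simp
    · refine IntegrableOn.mono_set (t := Icc 0 1) ?_ Ioo_subset_Icc_self
      exact (by fun_prop : Continuous fun r : ℝ => r ^ 2 / √c).continuousOn.integrableOn_Icc
    · exact Filter.Eventually.of_forall fun r => by positivity
  · rw [lintegral_map hf hl, sheetArea, lintegral_withDensity_eq_lintegral_mul _ hd
      (g := fun p => f (lift c σ p)) (hf.comp hl)]
    rfl

/-- The area of the sphere is, up to a factor, the image of Lebesgue measure on the ball under the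
central projection. -/
theorem lintegral_ball (hc : 0 < c) {f : (Fin 3 → ℝ) → ℝ≥0∞} (hf : Measurable f) :
    ∫⁻ x in {x | c * (x ⬝ᵥ x) < 1}, f (centralProj c x) =
      ENNReal.ofReal (1 / (3 * √c)) * ∫⁻ P, f P ∂(area c) := by
  have hm : ∀ σ : ℝ, MeasurableSet {x : Fin 3 → ℝ | 0 < σ * x 2 ∧ c * (x ⬝ᵥ x) < 1} := fun σ => by
    unfold dotProduct
    exact ((isOpen_lt continuous_const (g := fun x : Fin 3 → ℝ => σ * x 2) (by fun_prop)).inter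
      (isOpen_lt (f := fun x : Fin 3 → ℝ => c * ∑ i, x i * x i) (by fun_prop)
        continuous_const)).measurableSet
  have h0 : volume {x : Fin 3 → ℝ | x 2 = 0} = 0 := by
    have h1 : {x : Fin 3 → ℝ | x 2 = 0} = (fun x : Fin 3 → ℝ => (x 2, (x 0, x 1))) ⁻¹'
        ({0} ×ˢ univ) := by
      ext x
      simp
    rw [h1, measurePreserving_axis.measure_preimage
      ((measurableSet_singleton 0).prod MeasurableSet.univ).nullMeasurableSet, Measure.prod_prod]
    simp
  have h1 : {x : Fin 3 → ℝ | c * (x ⬝ᵥ x) < 1} =ᵐ[volume]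
      ({x | 0 < 1 * x 2 ∧ c * (x ⬝ᵥ x) < 1} ∪ {x | 0 < -1 * x 2 ∧ c * (x ⬝ᵥ x) < 1} :
        Set (Fin 3 → ℝ)) := by
    have h2 : ∀ᵐ x : Fin 3 → ℝ, x 2 ≠ 0 := by
      rw [ae_iff]
      simpa using h0
    filter_upwards [h2] with x hx
    refine propext ⟨fun h => ?_, fun h => h.elim (fun h => h.2) fun h => h.2⟩
    rcases hx.lt_or_gt with h3 | h3
    · exact Or.inr ⟨by linarith, h⟩
    · exact Or.inl ⟨by linarith, h⟩
  rw [setLIntegral_congr h1, lintegral_union (hm _), lintegral_halfBall hc (by norm_num) hf,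
    lintegral_halfBall hc (by norm_num) hf, area, if_pos hc, lintegral_add_measure, mul_add]
  rw [disjoint_left]
  rintro x ⟨h2, -⟩ ⟨h3, -⟩
  linarith

/-- The area of the sphere is invariant under rotations, since Lebesgue measure is. -/
theorem area_mulVec (hc : 0 < c) {M : Matrix (Fin 3) (Fin 3) ℝ} (hM : Mᵀ * M = 1)
    (hdet : M.det = 1) : MeasurePreserving (fun u => M *ᵥ u) (area c) (area c) := by
  have hMm : Measurable fun u => M *ᵥ u :=
    M.mulVecLin.toContinuousLinearMap.continuous.measurable
  have hvol : MeasurePreserving (fun u => M *ᵥ u) volume volume := by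
    refine ⟨hMm, ?_⟩
    have h1 := Real.map_matrix_volume_pi_eq_smul_volume_pi (M := M)
      (by rw [hdet]; exact one_ne_zero)
    rw [hdet] at h1
    simp only [inv_one, abs_one, ENNReal.ofReal_one, one_smul] at h1
    exact h1
  have hdot : ∀ u, (M *ᵥ u) ⬝ᵥ (M *ᵥ u) = u ⬝ᵥ u := fun u => by
    rw [← ip_eq_dotProduct hc, ip_mulVec hc hM, ip_eq_dotProduct hc]
  have hmball : MeasurableSet {x : Fin 3 → ℝ | c * (x ⬝ᵥ x) < 1} := by
    unfold dotProduct
    exact (isOpen_lt (f := fun x : Fin 3 → ℝ => c * ∑ i, x i * x i) (by fun_prop)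
      continuous_const).measurableSet
  have hK : ENNReal.ofReal (1 / (3 * √c)) ≠ 0 := by
    have : 0 < √c := Real.sqrt_pos.2 hc
    rw [Ne, ENNReal.ofReal_eq_zero, not_le]
    positivity
  refine ⟨hMm, Measure.ext fun s hs => ?_⟩
  rw [Measure.map_apply hMm hs]
  have key : ∀ f : (Fin 3 → ℝ) → ℝ≥0∞, Measurable f →
      ∫⁻ P, f (M *ᵥ P) ∂(area c) = ∫⁻ P, f P ∂(area c) := fun f hf => by
    refine (ENNReal.mul_right_inj hK ENNReal.ofReal_ne_top).1 ?_
    rw [← lintegral_ball hc hf, ← lintegral_ball hc (f := fun u => f (M *ᵥ u)) (hf.comp hMm)]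
    have h1 : {x : Fin 3 → ℝ | c * (x ⬝ᵥ x) < 1} =
        (fun u => M *ᵥ u) ⁻¹' {x : Fin 3 → ℝ | c * (x ⬝ᵥ x) < 1} := by
      ext x
      simp [hdot]
    rw [← hvol.setLIntegral_comp_preimage hmball (f := fun x => f (centralProj c x))
      (hf.comp measurable_centralProj), ← h1]
    simp only [centralProj, hdot, mulVec_smul]
  have h2 := key (s.indicator 1) (measurable_one.indicator hs)
  rw [lintegral_indicator_one hs] at h2
  rw [← h2, ← lintegral_indicator_one (hMm hs)]
  rfl

end

end SpaceForm

/-! ### Convex curves on the sphere -/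

namespace SpaceForm

open Matrix

section

variable {c L : ℝ} {γ : ℝ → Fin 3 → ℝ}

theorem mulVec_two_eq_dotProduct {v : Fin 3 → ℝ} {M : Matrix (Fin 3) (Fin 3) ℝ}
    (hM : Mᵀ * M = 1) (hv : M *ᵥ v = ![0, 0, 1]) (u : Fin 3 → ℝ) : (M *ᵥ u) 2 = u ⬝ᵥ v := by
  have h1 : (M *ᵥ u) ⬝ᵥ (M *ᵥ v) = u ⬝ᵥ v := by
    rw [dotProduct_mulVec, vecMul_mulVec, hM, vecMul_one]
  rw [← h1, hv]
  simp [dotProduct, Fin.sum_univ_three]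

/-- A rotation that carries a given nonzero vector to the positive vertical axis. -/
theorem exists_rotation_dotProduct {v : Fin 3 → ℝ} (hv : v ≠ 0) :
    ∃ M : Matrix (Fin 3) (Fin 3) ℝ, Mᵀ * M = 1 ∧ M.det = 1 ∧ ∃ a : ℝ, 0 < a ∧
      M *ᵥ v = ![0, 0, a] ∧ ∀ u, u ⬝ᵥ v = a * (M *ᵥ u) 2 := by
  have h0 : 0 < v ⬝ᵥ v := lt_of_le_of_ne (by
    simp only [dotProduct]
    exact Finset.sum_nonneg fun i _ => mul_self_nonneg _) fun h =>
      hv (dotProduct_self_eq_zero.1 h.symm)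
  have ha : 0 < √(v ⬝ᵥ v) := Real.sqrt_pos.2 h0
  obtain ⟨M, hM, hdet, hMv⟩ := exists_rotation (v := (√(v ⬝ᵥ v))⁻¹ • v) (by
    rw [dotProduct_smul, smul_dotProduct, smul_eq_mul, smul_eq_mul, ← mul_assoc, ← mul_inv,
      Real.mul_self_sqrt h0.le, inv_mul_cancel₀ h0.ne'])
  refine ⟨M, hM, hdet, √(v ⬝ᵥ v), ha, ?_, fun u => ?_⟩
  · have h1 : v = √(v ⬝ᵥ v) • ((√(v ⬝ᵥ v))⁻¹ • v) := (smul_inv_smul₀ ha.ne' v).symm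
    conv_lhs => rw [h1]
    rw [mulVec_smul, hMv]
    simp
  · rw [mulVec_two_eq_dotProduct hM hMv, dotProduct_smul, smul_eq_mul, ← mul_assoc,
      mul_inv_cancel₀ ha.ne', one_mul]

theorem point_two (hc : 0 < c) (z : ℂ) (η : ℝ) : point c z η 2 = η / √c := by
  simp [point, abs_of_pos hc]

/-- A closed convex curve on the sphere has no more than two tangent great circles through a
generic point. -/
theorem IsClosedStronglyConvex.not_four_sign_changes (hc : 0 < c)
    (hγ : IsClosedStronglyConvex c L γ) {P : Fin 3 → ℝ} (hP : ∀ (r s : ℝ), r • γ s ≠ P)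
    {s₀ s₁ s₂ s₃ : ℝ} (h01 : s₀ < s₁) (h12 : s₁ < s₂) (h23 : s₂ < s₃) (h30 : s₃ < s₀ + L)
    (hu0 : normal c γ s₀ ⬝ᵥ P < 0) (hu1 : 0 < normal c γ s₁ ⬝ᵥ P) (hu2 : normal c γ s₂ ⬝ᵥ P < 0)
    (hu3 : 0 < normal c γ s₃ ⬝ᵥ P) : False := by
  have hP0 : P ≠ 0 := fun h => hP 0 0 (by rw [zero_smul, h])
  obtain ⟨M, hM, -, a, ha, hMP, hdot⟩ := exists_rotation_dotProduct hP0
  obtain ⟨θ, hθ, T, n, g, t, u, h, κ, κ', F, hκ, -, -, -, hg, hn, -, -⟩ :=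
    (hγ.mulVec hc hM).exists_isFrenetCurve
  simp only [normal_mulVec hc hM hγ.smooth] at hn
  have hθ0 : θ 0 = 0 := by
    rcases hθ with rfl | rfl <;> simp
  have hs : 0 < √c := Real.sqrt_pos.2 hc
  have hu : ∀ s, normal c γ s ⬝ᵥ P = a * √c * u s := fun s => by
    rw [hdot, hn, point_two hc]
    have := Real.mul_self_sqrt hc.le
    field_simp
    linear_combination (-u s) * this
  have hpos : 0 < a * √c := mul_pos ha hs
  rw [hu] at hu0 hu1 hu2 hu3
  refine F.not_four_sign_changes hc hγ.length_pos (fun x hx y hy hxy => ?_) hκ (fun s hs0 => ?_)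
    h01 h12 h23 h30 (neg_of_mul_neg_right hu0 hpos.le) (pos_of_mul_pos_right hu1 hpos.le)
    (neg_of_mul_neg_right hu2 hpos.le) (pos_of_mul_pos_right hu3 hpos.le)
  · refine (hγ.mulVec hc hM).simple hx hy ?_
    simp only [Prod.mk.injEq] at hxy
    rw [hg, hg, hxy.1, hxy.2]
  · have h1 := (F.isFrame s).norm_point
    rw [hs0] at h1
    have h2 : h s ≠ 0 := fun h => by simp [h] at h1
    refine hP (a * √c / h s) s (mulVec_left_injective hM ?_)
    simp only
    rw [mulVec_smul, hMP, hg, hs0, hθ0]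
    ext i
    fin_cases i
    · simp [point]
    · simp [point]
    · simp only [Fin.reduceFinMk, Pi.smul_apply, point_two hc, smul_eq_mul]
      simp only [Matrix.cons_val]
      field_simp

theorem normal_dotProduct_self (hc : 0 < c) (hγ : IsClosedStronglyConvex c L γ) (s : ℝ) :
    normal c γ s ⬝ᵥ normal c γ s = 1 ∧ normal c γ s ⬝ᵥ γ s = 0 := by
  obtain ⟨θ, hθ, T, n, g, t, u, h, κ, κ', F, hκ, -, -, -, hg, hn, -, -⟩ := hγ.exists_isFrenetCurve
  rw [← ip_eq_dotProduct hc, ← ip_eq_dotProduct hc, hg, hn, ip_point, ip_point,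
    show c * u s * (c * u s) / c = c * u s ^ 2 by field_simp,
    show c * u s * h s / c = h s * u s by field_simp, ← (F.isFrame s).norm_normal,
    ← (F.isFrame s).inner_normal_point]
  rcases hθ with rfl | rfl
  · simp only [id]
    exact ⟨by ring, trivial⟩
  · simp only [Complex.conj_re, Complex.conj_im]
    exact ⟨by ring, by ring⟩

theorem continuous_normal (hγ : IsClosedStronglyConvex c L γ) : Continuous (normal c γ) := by
  obtain ⟨θ, hθ, T, n, g, t, u, h, κ, κ', F, hκ, -, -, -, hg, hn, -, -⟩ := hγ.exists_isFrenetCurve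
  have h1 := F.continuous_normal
  have h2 := F.continuous_normal_height
  have h3 : Continuous θ := by
    rcases hθ with rfl | rfl
    · exact continuous_id
    · exact Complex.continuous_conj
  rw [funext hn]
  refine continuous_pi fun i => ?_
  fin_cases i
  · exact Complex.continuous_re.comp (h3.comp h1)
  · exact Complex.continuous_im.comp (h3.comp h1)
  · exact (continuous_const.mul h2).div_const _

theorem periodic_normal (hγ : IsClosedStronglyConvex c L γ) :
    Function.Periodic (normal c γ) L := fun s => by
  have h1 := periodic_deriv (periodic_deriv hγ.closed)
  rw [normal, normal, geodesicCurvature, geodesicCurvature, h1, hγ.closed]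

/-- Near each of its points, a convex curve on the sphere lies on the positive side of its tangent
great circles. -/
theorem exists_pos_near (hc : 0 < c) (hγ : IsClosedStronglyConvex c L γ) (s : ℝ) {b : ℝ}
    (hb : 0 < b) : ∃ δ, 0 < δ ∧ δ < b ∧ 0 < normal c γ (s + δ) ⬝ᵥ γ s ∧
      0 < normal c γ (s - δ) ⬝ᵥ γ s := by
  have hγ0 : γ s ≠ 0 := fun h => by
    have := hγ.mem_space s
    simp [space, hc.ne', h, ip] at this
    exact absurd this.1 (by positivity)
  obtain ⟨M, hM, -, a, ha, hMP, hdot⟩ := exists_rotation_dotProduct hγ0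
  obtain ⟨θ, hθ, T, n, g, t, u, h, κ, κ', F, hκ, -, -, -, hg, hn, -, -⟩ :=
    (hγ.mulVec hc hM).exists_isFrenetCurve
  simp only [normal_mulVec hc hM hγ.smooth] at hn
  have hs : 0 < √c := Real.sqrt_pos.2 hc
  have hu : ∀ x, normal c γ x ⬝ᵥ γ s = a * √c * u x := fun x => by
    rw [hdot, hn, point_two hc]
    have := Real.mul_self_sqrt hc.le
    field_simp
    linear_combination (-u x) * this
  have hpos : 0 < a * √c := mul_pos ha hs
  have hus : u s = 0 := by
    have h1 := hu s
    rw [(normal_dotProduct_self hc hγ s).2] at h1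
    rcases mul_eq_zero.1 h1.symm with h2 | h2
    · exact absurd h2 hpos.ne'
    · exact h2
  have hgs : g s = 0 := by
    have h1 : θ (g s) = 0 := by
      have h2 := (hg s).symm.trans hMP
      exact Complex.ext (congrFun h2 0) (congrFun h2 1)
    rcases hθ with rfl | rfl
    · exact h1
    · simpa using h1
  have hhs : 0 < h s := by
    have h2 := congrFun ((hg s).symm.trans hMP) 2
    rw [point_two hc] at h2
    have h3 : h s / √c = a := h2
    rw [div_eq_iff hs.ne'] at h3
    rw [h3]
    exact hpos
  have hts : t s = 0 := by
    have h1 := (F.isFrame s).inner_eq_zero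
    rw [hgs] at h1
    simpa [hhs.ne'] using h1
  have htd : HasDerivAt t (-h s) s := by
    simpa [hus] using F.hasDerivAt_tangent_height s
  have hslope := hasDerivAt_iff_tendsto_slope.1 htd
  have hev := hslope.eventually (gt_mem_nhds (neg_neg_of_pos hhs))
  rw [eventually_nhdsWithin_iff, Metric.eventually_nhds_iff] at hev
  obtain ⟨ε, hε, hev⟩ := hev
  have hsl : ∀ y, |y - s| < ε → y ≠ s → t y / (y - s) < 0 := fun y hy hys => by
    have := hev (by rwa [Real.dist_eq]) hys
    rwa [slope_def_field, hts, sub_zero] at this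
  set δ := min (ε / 2) (b / 2) with hδ
  have hδ0 : 0 < δ := lt_min (by linarith) (by linarith)
  have hδε : δ < ε := lt_of_le_of_lt (min_le_left _ _) (by linarith)
  have huc := F.continuous_normal_height
  refine ⟨δ, hδ0, lt_of_le_of_lt (min_le_right _ _) (by linarith), ?_, ?_⟩
  · rw [hu]
    refine mul_pos hpos ?_
    obtain ⟨ξ, hξ, hξ'⟩ := exists_hasDerivAt_eq_slope u (fun x => -(κ x * t x))
      (show s < s + δ by linarith) huc.continuousOn fun x _ => F.hasDerivAt_normal_height x
    have h1 : t ξ < 0 := by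
      have h2 := hsl ξ (by rw [abs_of_pos (by linarith [hξ.1])]; linarith [hξ.2]) hξ.1.ne'
      rcases div_neg_iff.1 h2 with h3 | h3
      · linarith [h3.2, hξ.1]
      · exact h3.1
    rw [hus, sub_zero, eq_div_iff (by linarith)] at hξ'
    rw [← hξ']
    nlinarith [mul_pos (hκ ξ) (neg_pos.2 h1)]
  · rw [hu]
    refine mul_pos hpos ?_
    obtain ⟨ξ, hξ, hξ'⟩ := exists_hasDerivAt_eq_slope u (fun x => -(κ x * t x))
      (show s - δ < s by linarith) huc.continuousOn fun x _ => F.hasDerivAt_normal_height x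
    have h1 : 0 < t ξ := by
      have h2 := hsl ξ (by rw [abs_of_neg (by linarith [hξ.2])]; linarith [hξ.1]) hξ.2.ne
      rcases div_neg_iff.1 h2 with h3 | h3
      · exact h3.1
      · linarith [h3.2, hξ.2]
    rw [hus, zero_sub, eq_div_iff (by linarith)] at hξ'
    nlinarith [mul_pos (hκ ξ) h1]

/-- A closed convex curve on the sphere lies on one side of each of its tangent great circles.
Otherwise, for a generic point near the curve, on the other side of the tangent great circle, there
would be four tangent great circles through it. -/
theorem normal_dotProduct_nonneg (hc : 0 < c) (hγ : IsClosedStronglyConvex c L γ) (s x : ℝ) :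
    0 ≤ normal c γ x ⬝ᵥ γ s := by
  by_contra! hneg
  obtain ⟨y, hy, hxy⟩ := (periodic_normal hγ).exists_mem_Ico hγ.length_pos x s
  rw [hxy] at hneg
  obtain ⟨hns, hn0⟩ := normal_dotProduct_self hc hγ s
  have hys : s < y := lt_of_le_of_ne hy.1 fun h => by
    rw [← h, hn0] at hneg
    exact lt_irrefl _ hneg
  obtain ⟨δ, hδ, hδb, h1, h2⟩ := exists_pos_near hc hγ s
    (b := min (y - s) (s + L - y)) (lt_min (by linarith) (by linarith [hy.2]))
  have h3 : δ < y - s := hδb.trans_le (min_le_left _ _)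
  have h4 : δ < s + L - y := hδb.trans_le (min_le_right _ _)
  rw [← periodic_normal hγ] at h2
  set U : Set (Fin 3 → ℝ) := {P | normal c γ y ⬝ᵥ P < 0 ∧ 0 < normal c γ (s + δ) ⬝ᵥ P ∧
    0 < normal c γ (s - δ + L) ⬝ᵥ P} with hU
  have hdotc : ∀ v : Fin 3 → ℝ, Continuous fun P => v ⬝ᵥ P := fun v => by
    unfold dotProduct
    fun_prop
  have hUo : IsOpen U := (isOpen_lt (hdotc _) continuous_const).inter
    ((isOpen_lt continuous_const (hdotc _)).inter (isOpen_lt continuous_const (hdotc _)))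
  have hUs : γ s ∈ U := ⟨hneg, h1, h2⟩
  have hlim : Filter.Tendsto (fun ε : ℝ => γ s - ε • normal c γ s) (nhdsWithin 0 (Set.Ioi 0))
      (nhds (γ s)) := by
    have h5 : Continuous fun ε : ℝ => γ s - ε • normal c γ s := by fun_prop
    simpa using (h5.tendsto 0).mono_left nhdsWithin_le_nhds
  obtain ⟨ε, hεU, hε⟩ := ((hlim.eventually (hUo.mem_nhds hUs)).and self_mem_nhdsWithin).exists
  have hVo : IsOpen (U ∩ {P | normal c γ s ⬝ᵥ P < 0}) :=
    hUo.inter (isOpen_lt (hdotc _) continuous_const)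
  have hV : (U ∩ {P | normal c γ s ⬝ᵥ P < 0}).Nonempty := by
    refine ⟨_, hεU, ?_⟩
    simp only [Set.mem_ofPred_eq]
    rw [dotProduct_sub, dotProduct_smul, hn0, hns, smul_eq_mul, mul_one, zero_sub]
    exact neg_neg_of_pos hε
  have hd : Dense (Set.range fun p : ℝ × ℝ => p.1 • γ p.2)ᶜ := by
    refine ContDiff.dense_compl_range_of_finrank_lt_finrank (F := Fin 3 → ℝ) ?_ (by simp)
    exact contDiff_fst.smul ((hγ.smooth.of_le (by simp)).comp contDiff_snd)
  obtain ⟨P, ⟨⟨hP1, hP2, hP3⟩, hP4⟩, hP5⟩ := hd.inter_open_nonempty _ hVo hV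
  exact hγ.not_four_sign_changes hc (fun r s h => hP5 ⟨(r, s), h⟩) (s₀ := s) (s₁ := s + δ)
    (s₂ := y) (s₃ := s - δ + L) (by linarith) (by linarith) (by linarith) (by linarith) hP4 hP2 hP1
    hP3

/-- A closed convex curve on the sphere and its evolute lie in a common open hemisphere, centred at
the point of the convex hull of the curve that is nearest to the origin. -/
theorem exists_hemisphere (hc : 0 < c) (hγ : IsClosedStronglyConvex c L γ) :
    ∃ v : Fin 3 → ℝ, v ≠ 0 ∧ (∀ s, 0 < γ s ⬝ᵥ v) ∧ ∀ s, 0 < evolute c γ s ⬝ᵥ v := by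
  have hL := hγ.length_pos
  have hnc := continuous_normal hγ
  have hγc := hγ.smooth.continuous
  -- the integral of the normal vector separates the curve from the origin
  set m : Fin 3 → ℝ := fun i => ∫ x in (0 : ℝ)..L, normal c γ x i with hm
  have hmγ : ∀ s, 0 < m ⬝ᵥ γ s := fun s => by
    have hci : ∀ i, Continuous fun x => normal c γ x i := fun i => (continuous_apply i).comp hnc
    have h1 : m ⬝ᵥ γ s = ∫ x in (0 : ℝ)..L, normal c γ x ⬝ᵥ γ s := by
      simp only [dotProduct, hm]
      rw [intervalIntegral.integral_finsetSum (f := fun i x => normal c γ x i * γ s i) fun i _ =>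
        ((hci i).mul continuous_const).intervalIntegrable _ _]
      simp only [intervalIntegral.integral_mul_const]
    have hcont : Continuous fun x => normal c γ x ⬝ᵥ γ s := by
      unfold dotProduct
      exact continuous_finsetSum _ fun i _ => (hci i).mul continuous_const
    obtain ⟨δ, hδ, -, h2, -⟩ := exists_pos_near hc hγ s hL
    obtain ⟨y, hy, hxy⟩ := (periodic_normal hγ).exists_mem_Ico₀ hL (s + δ)
    rw [hxy] at h2
    rw [h1]
    exact intervalIntegral.integral_pos hL hcont.continuousOn
      (fun x _ => normal_dotProduct_nonneg hc hγ s x) ⟨y, ⟨hy.1, hy.2.le⟩, h2⟩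
  set f : ℝ → EuclideanSpace ℝ (Fin 3) := fun s => WithLp.toLp 2 (γ s) with hf
  have hfc : Continuous f := (PiLp.continuous_toLp 2 _).comp hγc
  have hfp : Function.Periodic f L := fun s => by simp only [hf, hγ.closed s]
  set K := closure (convexHull ℝ (Set.range f)) with hK
  have hKconv : Convex ℝ K := (convex_convexHull ℝ _).closure
  have hfK : ∀ s, f s ∈ K := fun s => subset_closure (subset_convexHull ℝ _ ⟨s, rfl⟩)
  have hinner : ∀ (w w' : Fin 3 → ℝ), inner ℝ (WithLp.toLp 2 w : EuclideanSpace ℝ (Fin 3))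
      (WithLp.toLp 2 w') = w ⬝ᵥ w' := fun w w' => by
    simp [PiLp.inner_apply, dotProduct, mul_comm]
  have hhalf : ∀ (w : EuclideanSpace ℝ (Fin 3)) (d : ℝ), (∀ s, d ≤ inner ℝ w (f s)) →
      ∀ y ∈ K, d ≤ inner ℝ w y := fun w d h y hy =>
    closure_minimal (t := {y | d ≤ inner ℝ w y})
      (convexHull_min (by rintro - ⟨s, rfl⟩; exact h s)
        (convex_halfSpace_ge (innerₛₗ ℝ w).isLinear d))
      (isClosed_le continuous_const (by fun_prop)) hy
  obtain ⟨v, hvK, hv⟩ := exists_norm_eq_iInf_of_complete_convex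
    (K := K) ⟨f 0, hfK 0⟩ isClosed_closure.isComplete hKconv 0
  rw [norm_eq_iInf_iff_real_inner_le_zero hKconv hvK] at hv
  have hnv : ∀ x, 0 ≤ inner ℝ (WithLp.toLp 2 (normal c γ x) : EuclideanSpace ℝ (Fin 3)) v :=
    fun x => hhalf _ 0 (fun s => by
      rw [hinner]
      exact normal_dotProduct_nonneg hc hγ s x) v hvK
  have hmv : 0 < inner ℝ (WithLp.toLp 2 m : EuclideanSpace ℝ (Fin 3)) v := by
    have hcont : Continuous fun y : EuclideanSpace ℝ (Fin 3) => inner ℝ (WithLp.toLp 2 m) y := by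
      fun_prop
    obtain ⟨-, ⟨s, rfl⟩, hmin⟩ := (hfp.compact_of_continuous hL.ne' hfc).exists_isMinOn
      (Set.range_nonempty f) hcont.continuousOn
    refine lt_of_lt_of_le (hmγ s) ?_
    rw [← hinner]
    exact hhalf _ _ (fun x => hmin ⟨x, rfl⟩) v hvK
  have hv0 : v ≠ 0 := fun h => by simp [h] at hmv
  have hγv : ∀ s, 0 < γ s ⬝ᵥ WithLp.ofLp v := fun s => by
    have h1 := hv (f s) (hfK s)
    have h2 : 0 < inner ℝ v v := real_inner_self_pos.2 hv0
    rw [zero_sub, inner_neg_left, inner_sub_right] at h1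
    have h3 : inner ℝ v (f s) = γ s ⬝ᵥ WithLp.ofLp v := by
      rw [real_inner_comm, ← hinner]
    linarith
  refine ⟨WithLp.ofLp v, fun h => hv0 (by ext i; exact congrFun h i), hγv, fun s => ?_⟩
  have hκ := hγ.convex_of_nonneg hc.le s
  have hk : 0 < geodesicCurvature c γ s ^ 2 + c := by positivity
  obtain ⟨h1, h2⟩ := cn_sn_radius hκ hk
  have h3 := spaceCurvature_pos hk
  have h4 := hnv s
  rw [show v = WithLp.toLp 2 (WithLp.ofLp v) from rfl, hinner] at h4
  rw [evolute, h1, h2, add_dotProduct, smul_dotProduct, smul_dotProduct]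
  exact add_pos_of_pos_of_nonneg (mul_pos (div_pos hκ h3) (hγv s))
    (mul_nonneg (one_div_pos.2 h3).le h4)

end

end SpaceForm

theorem theorem4p2 (c L : ℝ) (γ : ℝ → Fin 3 → ℝ)
    (hγ : SpaceForm.IsClosedStronglyConvex c L γ)
    (hpos : SpaceForm.IsPositivelyOriented c L γ) :
    MeasureTheory.Integrable
        (fun P => (SpaceForm.index c L (SpaceForm.evolute c γ) P : ℝ)) (SpaceForm.area c) ∧
      (∫ s in (0 : ℝ)..L, SpaceForm.ambientCurvature c γ s) - 2 * Real.pi =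
        c * |SpaceForm.areaWithMultiplicities c L (SpaceForm.evolute c γ)| := by
  open SpaceForm in
  rcases le_or_gt c 0 with hc | hc
  · exact evolute_area hγ (fun h => absurd h (not_lt.2 hc)) fun h => absurd h (not_lt.2 hc)
  obtain ⟨v, hv, hγv, hev⟩ := exists_hemisphere hc hγ
  obtain ⟨M, hM, hdet, a, ha, -, hdot⟩ := exists_rotation_dotProduct hv
  have h1 := evolute_area (hγ.mulVec hc hM)
    (fun _ s => by
      have := hγv s
      rw [hdot] at this
      exact pos_of_mul_pos_right this ha.le)
    (fun _ s => by
      have := hev s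
      rw [hdot] at this
      rw [evolute_mulVec hc hM hγ.smooth]
      exact pos_of_mul_pos_right this ha.le)
  rw [ambientCurvature_mulVec hc hM hγ.smooth, evolute_mulVec hc hM hγ.smooth] at h1
  have hMe : MeasurableEmbedding fun u => M.mulVec u :=
    (area_mulVec hc hM hdet).measurable.measurableEmbedding (mulVec_left_injective hM)
  have h2 := (area_mulVec hc hM hdet).integrable_comp_emb hMe
    (g := fun P => (index c L (fun s => M.mulVec (evolute c γ s)) P : ℝ))
  have h3 := (area_mulVec hc hM hdet).integral_comp hMe
    (fun P => (index c L (fun s => M.mulVec (evolute c γ s)) P : ℝ))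
  simp only [Function.comp_def, index_mulVec hc hM hdet] at h2 h3
  rw [areaWithMultiplicities, h3]
  exact ⟨h2.2 h1.1, h1.2⟩
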